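/- Let $L\ge 1$ and consider a binary Gauss--Markov tree with nodes $x_i^{(k)}$, $1\le k\le L$, $1\le i\le 2^{k-1}$: $x_1^{(1)}=n_1^{(1)}$ and, for $1\le k<L$, $$x_{2i-1}^{(k+1)}=\alpha_{2i-1}^{(k+1)}x_i^{(k)}+n_{2i-1}^{(k+1)},\qquad x_{2i}^{(k+1)}=\alpha_{2i}^{(k+1)}x_i^{(k)}+n_{2i}^{(k+1)},$$ where the $\alpha_i^{(k)}$ are real and the $n_i^{(k)}$ are independent zero-mean Gaussian variables with variances $\sigma^2_{n_i^{(k)}}$. Put $N=2^{L-1}$. All logarithms and mutual informations are in nats. **Inner region.** For $a\in[0,1]^N$ let $u_j=a_jx_j^{(L)}+w_j$, $1\le j\le N$, where the $w_j$ are zero-mean Gaussian with variance $(1-a_j^2)\operatorname{Var}(x_j^{(L)})$, independent of each other and of the tree. Let $\mathcal{RD}_{\rm in}$ be the set of all $(R_1,\dots,R_N,d)\in\mathbb R^{N+1}$ for which some such $u=(u_1,\dots,u_N)$ satisfies $\mathbb E\big[(x_1^{(1)}-\mathbb E[x_1^{(1)}\mid u])^2\big]\le d$ and $\sum_{j\in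 A}R_j\ge I(x^{(L)}_A;u_A\mid u_{A^c})$ for every $A\subseteq\{1,\dots,N\}$. **Outer region.** For a node let $\mathcal O(x_i^{(k)})=\{j: 2^{L-k}(i-1)<j\le 2^{L-k}i\}$ be the set of indices of the leaves below it, and, for $k<L$, let $$f_{x_i^{(k)}}(r_1,r_2)=\tfrac12\log\Big(1+\tfrac{(\alpha_{2i-1}^{(k+1)})^2\sigma^2_{n_i^{(k)}}}{\sigma^2_{n_{2i-1}^{(k+1)}}}(1-e^{-2r_1})+\tfrac{(\alpha_{2i}^{(k+1)})^2\sigma^2_{n_i^{(k)}}}{\sigma^2_{n_{2i}^{(k+1)}}}(1-e^{-2r_2})\Big).$$ For $d>0$ let $\mathcal F_r(d)$ be the set of all families $r_i^{(k)}\ge 0$ ($1\le k\le L$, $1\le i\le 2^{k-1}$) with $r_1^{(1)}\ge\frac12\log(\sigma^2_{n_1^{(1)}}/d)$ and $r_i^{(k)}\le f_{x_i^{(k)}}(r_{2i-1}^{(k+1)},r_{2i}^{(k+1)})$ for all $k<L$. For $A\subseteq\{1,\dots,N\}$ and $r\in\mathcal F_r(d)$ define $f^{A}_{x_i^{(k)}}(r)$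 recursively: it is $r_i^{(k)}$ if $\mathcal O(x_i^{(k)})\subseteq A$; it is $0$ if $\mathcal O(x_i^{(k)})\subseteq A^c$; and otherwise it is $f_{x_i^{(k)}}\big(f^{A}_{x_{2i-1}^{(k+1)}}(r),f^{A}_{x_{2i}^{(k+1)}}(r)\big)$. Put $A^{(k)}=\{i:\mathcal O(x_i^{(k)})\cap A\ne\emptyset\}$. Let $\mathcal{RD}_{\rm out}$ be the set of all $(R_1,\dots,R_N,d)$ with $R_j\ge 0$ for all $j$ and $d>0$ for which there is $r\in\mathcal F_r(d)$ such that, for every $A\subseteq\{1,\dots,N\}$, $$\sum_{j\in A}R_j\ \ge\ \sum_{k=1}^{L}\ \sum_{i\in A^{(k)}}\Big(r_i^{(k)}-f^{A^c}_{x_i^{(k)}}(r)\Big).$$ **Lemma.** If all noise variances are positive, i.e. $\sigma^2_{n_i^{(k)}}>0$ for all $1\le k\le L$, $1\le i\le 2^{k-1}$ (for the root, $\sigma^2_{n_1^{(1)}}=\operatorname{Var}(x_1^{(1)})$), then $$\mathcal{RD}_{\rm out}=\mathrm{co}(\mathcal{RD}_{\rm in}),$$ where $\mathrm{co}$ denotes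 the closure of the convex hull in $\mathbb R^{N+1}$. -/

import Mathlib

open MeasureTheory ProbabilityTheory InformationTheory
open scoped ENNReal NNReal

/-- The conditional mutual information `I(X; Y | Z)` in nats: the Kullback-Leibler divergence
of the joint law `P_{Z,X,Y}` from `P_Z ⊗ (P_{X|Z} × P_{Y|Z})`. -/
noncomputable def condMutualInfo {Ω 𝓧 𝓨 𝓩 : Type*} [MeasurableSpace Ω]
    [MeasurableSpace 𝓧] [StandardBorelSpace 𝓧] [Nonempty 𝓧]
    [MeasurableSpace 𝓨] [StandardBorelSpace 𝓨] [Nonempty 𝓨] [MeasurableSpace 𝓩]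
    (X : Ω → 𝓧) (Y : Ω → 𝓨) (Z : Ω → 𝓩) (P : Measure Ω) [IsFiniteMeasure P] : ℝ≥0∞ :=
  klDiv (P.map fun ω => (Z ω, (X ω, Y ω)))
    (P.map Z ⊗ₘ (condDistrib X Z P ×ₖ condDistrib Y Z P))

/-- Parameters of a binary Gauss-Markov tree with levels `0, …, K` (so `L = K + 1` levels).
Level `k` has the nodes `(k, i)`, `i < 2 ^ k`; the node `(k, i)` with `k < K` has the children
`(k + 1, 2 * i)` and `(k + 1, 2 * i + 1)`.  All indices start at `0`.  Only the values at
`k ≤ K`, `i < 2 ^ k` matter.  `gain k i` (for `k ≥ 1`) is the coefficient on the edge from the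
parent of `(k, i)` to `(k, i)`; `noiseVar k i` is the variance of the noise added at `(k, i)`;
for the root, `noiseVar 0 0` is the variance of the root variable itself. -/
structure GaussTree (K : ℕ) where
  gain : ℕ → ℕ → ℝ
  noiseVar : ℕ → ℕ → ℝ≥0

namespace GaussTree

variable {K : ℕ} (T : GaussTree K)

/-- The nodes of the tree, as a finite type. -/
abbrev Node (K : ℕ) : Type := Σ k : Fin (K + 1), Fin (2 ^ (k : ℕ))

/-- The observations, i.e. the leaves `(K, j)`. -/
abbrev Leaf (K : ℕ) : Type := Fin (2 ^ K)

/-- All noise variances (including the variance of the root) are positive. -/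
def PosNoise : Prop := ∀ k ≤ K, ∀ i < 2 ^ k, 0 < T.noiseVar k i

/-! ### The source -/

/-- The noise at the node `(k, i)`, read off from a point of the sample space. -/
def noise (k i : ℕ) (ω : Node K → ℝ) : ℝ :=
  if h : k < K + 1 ∧ i < 2 ^ k then ω ⟨⟨k, h.1⟩, ⟨i, h.2⟩⟩ else 0

/-- The joint law of the noises: independent, centred Gaussian with the given variances. -/
noncomputable def noiseLaw : Measure (Node K → ℝ) :=
  Measure.pi fun v => gaussianReal 0 (T.noiseVar v.1 v.2)

/-- The source variable at the node `(k, i)`: the root is its own noise, and every other node is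
its gain times its parent plus its noise. -/
def source : ℕ → ℕ → (Node K → ℝ) → ℝ
  | 0, i, ω => noise 0 i ω
  | k + 1, i, ω => T.gain (k + 1) i * source k (i / 2) ω + noise (k + 1) i ω

/-- The variance of the observation `j`. -/
noncomputable def obsVar (j : Leaf K) : ℝ := Var[T.source K j; T.noiseLaw]

/-! ### The inner bound -/

/-- The joint law of the source noises and of the independent test-channel noises `w j`, where
`w j` is centred Gaussian with variance `(1 - a j ^ 2) * σ²`, `σ²` the variance of the
observation `j`. -/
noncomputable def testLaw (a : Leaf K → ℝ) : Measure ((Node K → ℝ) × (Leaf K → ℝ)) :=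
  T.noiseLaw.prod
    (Measure.pi fun j => gaussianReal 0 (((1 - a j ^ 2) * T.obsVar j).toNNReal))

instance instIsProbabilityMeasureTestLaw (a : Leaf K → ℝ) :
    IsProbabilityMeasure (T.testLaw a) := by
  unfold testLaw noiseLaw
  infer_instance

/-- The root variable. -/
def root (ω : (Node K → ℝ) × (Leaf K → ℝ)) : ℝ := T.source 0 0 ω.1

/-- The observations with index in `A`. -/
def obs (A : Finset (Leaf K)) (ω : (Node K → ℝ) × (Leaf K → ℝ)) (j : A) : ℝ :=
  T.source K (j : Leaf K) ω.1

/-- The auxiliary variables `u j = a j * x j + w j`. -/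
def aux (a : Leaf K → ℝ) (ω : (Node K → ℝ) × (Leaf K → ℝ)) (j : Leaf K) : ℝ :=
  a j * T.source K j ω.1 + ω.2 j

/-- The auxiliary variables with index in `A`. -/
def auxOn (a : Leaf K → ℝ) (A : Finset (Leaf K)) (ω : (Node K → ℝ) × (Leaf K → ℝ))
    (j : A) : ℝ :=
  T.aux a ω j

/-- The minimum mean-square error `E[(x - E[x | u])²]` of the root given all the auxiliary
variables. -/
noncomputable def mmse (a : Leaf K → ℝ) : ℝ :=
  ∫ ω, (T.root ω - ((T.testLaw a)[T.root | MeasurableSpace.comap (T.aux a) inferInstance]) ω) ^ 2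
    ∂(T.testLaw a)

/-- The test channels that are admissible at distortion `d`. -/
def testChannels (d : ℝ) : Set (Leaf K → ℝ) :=
  {a | (∀ j, a j ∈ Set.Icc (0 : ℝ) 1) ∧ T.mmse a ≤ d}

/-- The Berger-Tung region: all `(R, d)` such that for some admissible `u`, for all `A`,
`∑_{j ∈ A} R j ≥ I(x_A ; u_A | u_{Aᶜ})`. -/
def rdIn : Set ((Leaf K → ℝ) × ℝ) :=
  {p | ∃ a ∈ T.testChannels p.2, ∀ A : Finset (Leaf K),
    (condMutualInfo (T.obs A) (T.auxOn a A) (T.auxOn a Aᶜ) (T.testLaw a) : EReal)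
      ≤ ((∑ j ∈ A, p.1 j : ℝ) : EReal)}

/-! ### The outer bound -/

/-- The observations below the node `(k, i)`. -/
def below (K k i : ℕ) : Finset (Leaf K) :=
  Finset.univ.filter fun j => i * 2 ^ (K - k) ≤ (j : ℕ) ∧ (j : ℕ) < (i + 1) * 2 ^ (K - k)

/-- The function `f` of the node `(k, i)`, `k < K`, with the rates of its two children as
arguments. -/
noncomputable def nodeFun (k i : ℕ) (r₁ r₂ : ℝ) : ℝ :=
  1 / 2 * Real.log (1
    + T.gain (k + 1) (2 * i) ^ 2 * T.noiseVar k i / T.noiseVar (k + 1) (2 * i)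
        * (1 - Real.exp (-2 * r₁))
    + T.gain (k + 1) (2 * i + 1) ^ 2 * T.noiseVar k i / T.noiseVar (k + 1) (2 * i + 1)
        * (1 - Real.exp (-2 * r₂)))

/-- The iterated substitution of the functions `nodeFun` at the node `(K - h, i)`: descend from
that node, stop at the first nodes all of whose observations lie in `A` or all in `Aᶜ`, and
insert the rates `r` of these nodes.  Every leaf is such a node. -/
noncomputable def telescope (A : Finset (Leaf K)) (r : ℕ → ℕ → ℝ) : ℕ → ℕ → ℝ
  | 0, i => r K i
  | h + 1, i =>
    if below K (K - (h + 1)) i ⊆ A ∨ below K (K - (h + 1)) i ⊆ Aᶜ then r (K - (h + 1)) i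
    else T.nodeFun (K - (h + 1)) i
      (telescope A r h (2 * i)) (telescope A r h (2 * i + 1))

/-- The function `f^A` of the node `(k, i)`: the iterated substitution, with the rates of the
nodes whose observations are not all in `A` replaced by zero. -/
noncomputable def restrictedFun (A : Finset (Leaf K)) (r : ℕ → ℕ → ℝ) (k i : ℕ) : ℝ :=
  T.telescope A (fun l j => if below K l j ⊆ A then r l j else 0) (K - k) i

/-- The ancestors at level `k` of the observations in `A`. -/
def ancestors (A : Finset (Leaf K)) (k : ℕ) : Finset ℕ :=
  (Finset.range (2 ^ k)).filter fun i => (below K k i ∩ A).Nonempty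

/-- The admissible noise-quantization rates at a distortion `d > 0`. -/
def noiseRates (d : ℝ) : Set (ℕ → ℕ → ℝ) :=
  {r | (∀ k ≤ K, ∀ i < 2 ^ k, 0 ≤ r k i)
    ∧ 1 / 2 * Real.log (T.noiseVar 0 0 / d) ≤ r 0 0
    ∧ ∀ k < K, ∀ i < 2 ^ k,
        r k i ≤ T.nodeFun k i (r (k + 1) (2 * i)) (r (k + 1) (2 * i + 1))}

/-- The outer region, for nonnegative rates and positive distortion. -/
def rdOut : Set ((Leaf K → ℝ) × ℝ) :=
  {p | (∀ j, 0 ≤ p.1 j) ∧ 0 < p.2 ∧ ∃ r ∈ T.noiseRates p.2, ∀ A : Finset (Leaf K),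
    ∑ k ∈ Finset.range (K + 1), ∑ i ∈ ancestors A k, (r k i - T.restrictedFun Aᶜ r k i)
      ≤ ∑ j ∈ A, p.1 j}

end GaussTree

/-! The hull turns out to be superfluous: the inner and the outer region are equal, and the outer
region is already convex and closed.

Write F_S(r) for the sum of f^S over all nodes (`totalRate`). A node without leaves in A has f^{Aᶜ}
= r, so the outer constraint of A reads F_univ(r) - F_{Aᶜ}(r) ≤ ∑_{j ∈ A} R_j. Here F_univ is linear
in r and every F_S is concave, since the node functions are increasing and concave; this gives
convexity. The constraint of the full leaf set bounds every rate, so limits can be taken by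
compactness; this gives closedness.

Inner ⊆ outer. A test channel makes the likelihood of every node, given u_S, Gaussian, with a
precision λ that message passing computes from the leaves upwards. The rates r = ½ log(1 + σ²λ), for
S the set of all leaves, satisfy every node constraint with equality, and f^S evaluated at them is
the rate of the node when only u_S is observed (`restrictedFun_eq_precisionRate`). The root has the
mean-square error σ²/(1 + σ²λ) (`mmse_eq`), and the expected information density between the
observations and u_S is F_S(r) (`integral_infoDensity`), so the inner constraints are the outer
constraints at this r. A channel with a_j = 1 has infinite information and is excluded.

Outer ⊆ inner. Every nonnegative choice of leaf rates comes from a test channel, so families with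
equality at all inner nodes are realized. It remains to find such a feasible family for the same R
and d. Take one that minimizes F_univ. If a node had slack, no positive rate of a child could be
lowered, so each is blocked by a tight set that contains all leaves below this child but not all
below its sibling (`IsMinimalRates.exists_tight`). Let A and B be these sets for the two children.
Below the node they are exchanged for their union and intersection; by submodularity of the node
function and the slack, the sum of the two values of F over the subtree drops strictly, while the
uncovered leaf weight does not grow. This local crossing is carried up to the root
(`HasCrossing.parent`), where it contradicts the feasibility of r. A child of rate zero is treated
separately, with one tight set. -/

/-! ### The rate function of a node -/

/-- The rate of a node as a function of the rates of its two children. -/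
noncomputable def rateFun (p q x y : ℝ) : ℝ :=
  1 / 2 * Real.log (1 + p * (1 - Real.exp (-2 * x)) + q * (1 - Real.exp (-2 * y)))

theorem rateFun_comm (p q x y : ℝ) : rateFun p q x y = rateFun q p y x := by
  unfold rateFun; ring_nf

theorem one_sub_exp_nonneg {x : ℝ} (hx : 0 ≤ x) : 0 ≤ 1 - Real.exp (-2 * x) := by
  have : Real.exp (-2 * x) ≤ 1 := Real.exp_le_one_iff.mpr (by linarith)
  linarith

theorem one_sub_exp_mono {x y : ℝ} (h : x ≤ y) :
    1 - Real.exp (-2 * x) ≤ 1 - Real.exp (-2 * y) := by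
  have : Real.exp (-2 * y) ≤ Real.exp (-2 * x) := Real.exp_le_exp.mpr (by linarith)
  linarith

theorem one_le_rateFun_arg {p q x y : ℝ} (hp : 0 ≤ p) (hq : 0 ≤ q) (hx : 0 ≤ x) (hy : 0 ≤ y) :
    1 ≤ 1 + p * (1 - Real.exp (-2 * x)) + q * (1 - Real.exp (-2 * y)) := by
  have := mul_nonneg hp (one_sub_exp_nonneg hx)
  have := mul_nonneg hq (one_sub_exp_nonneg hy)
  linarith

theorem rateFun_zero_zero (p q : ℝ) : rateFun p q 0 0 = 0 := by simp [rateFun]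

theorem rateFun_nonneg {p q x y : ℝ} (hp : 0 ≤ p) (hq : 0 ≤ q) (hx : 0 ≤ x) (hy : 0 ≤ y) :
    0 ≤ rateFun p q x y := by
  have := Real.log_nonneg (one_le_rateFun_arg hp hq hx hy)
  unfold rateFun; linarith

theorem rateFun_mono {p q x y x' y' : ℝ} (hp : 0 ≤ p) (hq : 0 ≤ q) (hx : 0 ≤ x) (hy : 0 ≤ y)
    (hxx : x ≤ x') (hyy : y ≤ y') : rateFun p q x y ≤ rateFun p q x' y' := by
  have h1 := one_le_rateFun_arg hp hq hx hy
  have h2 := mul_le_mul_of_nonneg_left (one_sub_exp_mono hxx) hp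
  have h3 := mul_le_mul_of_nonneg_left (one_sub_exp_mono hyy) hq
  have := Real.log_le_log (x := 1 + p * (1 - Real.exp (-2 * x)) + q * (1 - Real.exp (-2 * y)))
    (y := 1 + p * (1 - Real.exp (-2 * x')) + q * (1 - Real.exp (-2 * y')))
    (by linarith) (by linarith)
  unfold rateFun; linarith

/-- Any increasing concave function has this property. With capitals for the exponentials, (Y - A)(Y
- B) ≥ 0 and AB ≤ XY give (A + B)Y ≤ (X + Y)Y. -/
theorem one_sub_exp_submodular {a b x y : ℝ} (hya : y ≤ a) (hyb : y ≤ b) (h : x + y ≤ a + b) :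
    (1 - Real.exp (-2 * x)) + (1 - Real.exp (-2 * y))
      ≤ (1 - Real.exp (-2 * a)) + (1 - Real.exp (-2 * b)) := by
  set A := Real.exp (-2 * a) with hA
  set B := Real.exp (-2 * b) with hB
  set X := Real.exp (-2 * x)
  set Y := Real.exp (-2 * y)
  have hY : 0 < Y := Real.exp_pos _
  have hAY : A ≤ Y := Real.exp_le_exp.mpr (by linarith)
  have hBY : B ≤ Y := Real.exp_le_exp.mpr (by linarith)
  have hXY : A * B ≤ X * Y := by
    rw [hA, hB, ← Real.exp_add, ← Real.exp_add]
    exact Real.exp_le_exp.mpr (by linarith)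
  have : (A + B) * Y ≤ (X + Y) * Y := by
    nlinarith [mul_nonneg (sub_nonneg.mpr hAY) (sub_nonneg.mpr hBY)]
  have := le_of_mul_le_mul_right this hY
  linarith

/-- The same property for the logarithm: xy ≤ (a + b - y)y = ab - (a - y)(b - y) ≤ ab. -/
theorem log_submodular {a b x y : ℝ} (hx : 0 < x) (hy : 0 < y) (hya : y ≤ a) (hyb : y ≤ b)
    (h : x + y ≤ a + b) : Real.log x + Real.log y ≤ Real.log a + Real.log b := by
  rw [← Real.log_mul hx.ne' hy.ne', ← Real.log_mul (by linarith) (by linarith)]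
  apply Real.log_le_log (mul_pos hx hy)
  nlinarith [mul_nonneg (sub_nonneg.mpr hya) (sub_nonneg.mpr hyb)]

/-- Submodularity of the rate function: `x₂`, `y₂` are the meets, and `x₁`, `y₁` are at most the
joins. -/
theorem rateFun_submodular {p q a b x₁ x₂ c d y₁ y₂ : ℝ} (hp : 0 ≤ p) (hq : 0 ≤ q)
    (hx₁ : 0 ≤ x₁) (hx₂ : 0 ≤ x₂) (hy₁ : 0 ≤ y₁) (hy₂ : 0 ≤ y₂)
    (hxa : x₂ ≤ a) (hxb : x₂ ≤ b) (hx : x₁ + x₂ ≤ a + b)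
    (hyc : y₂ ≤ c) (hyd : y₂ ≤ d) (hy : y₁ + y₂ ≤ c + d) :
    rateFun p q x₁ y₁ + rateFun p q x₂ y₂ ≤ rateFun p q a c + rateFun p q b d := by
  have h1 := one_le_rateFun_arg hp hq hx₁ hy₁
  have h2 := one_le_rateFun_arg hp hq hx₂ hy₂
  have e1 := mul_le_mul_of_nonneg_left (one_sub_exp_mono hxa) hp
  have e2 := mul_le_mul_of_nonneg_left (one_sub_exp_mono hxb) hp
  have e3 := mul_le_mul_of_nonneg_left (one_sub_exp_mono hyc) hq
  have e4 := mul_le_mul_of_nonneg_left (one_sub_exp_mono hyd) hq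
  have e5 := mul_le_mul_of_nonneg_left (one_sub_exp_submodular hxa hxb hx) hp
  have e6 := mul_le_mul_of_nonneg_left (one_sub_exp_submodular hyc hyd hy) hq
  have := log_submodular (a := 1 + p * (1 - Real.exp (-2 * a)) + q * (1 - Real.exp (-2 * c)))
    (b := 1 + p * (1 - Real.exp (-2 * b)) + q * (1 - Real.exp (-2 * d)))
    (lt_of_lt_of_le one_pos h1) (lt_of_lt_of_le one_pos h2)
    (by linarith) (by linarith) (by linarith)
  unfold rateFun; linarith

theorem ContinuousOn.rateFun {α : Type*} [TopologicalSpace α] {s : Set α} {f g : α → ℝ} {p q : ℝ}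
    (hp : 0 ≤ p) (hq : 0 ≤ q) (hf : ContinuousOn f s) (hg : ContinuousOn g s)
    (hf0 : ∀ x ∈ s, 0 ≤ f x) (hg0 : ∀ x ∈ s, 0 ≤ g x) :
    ContinuousOn (fun x => rateFun p q (f x) (g x)) s := by
  unfold _root_.rateFun
  refine continuousOn_const.mul (ContinuousOn.log ?_ fun x hx => ?_)
  · exact (continuousOn_const.add (continuousOn_const.mul (continuousOn_const.sub
      (Real.continuous_exp.comp_continuousOn (continuousOn_const.mul hf))))).add
      (continuousOn_const.mul (continuousOn_const.sub
      (Real.continuous_exp.comp_continuousOn (continuousOn_const.mul hg))))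
  · have := one_le_rateFun_arg hp hq (hf0 x hx) (hg0 x hx)
    exact (by linarith : (0:ℝ) < _).ne'

theorem one_sub_exp_concave (x x' : ℝ) {s t : ℝ} (hs : 0 ≤ s) (ht : 0 ≤ t) (hst : s + t = 1) :
    s * (1 - Real.exp (-2 * x)) + t * (1 - Real.exp (-2 * x'))
      ≤ 1 - Real.exp (-2 * (s * x + t * x')) := by
  have := convexOn_exp.2 (Set.mem_univ (-2 * x)) (Set.mem_univ (-2 * x')) hs ht hst
  simp only [smul_eq_mul] at this
  have e : s * (-2 * x) + t * (-2 * x') = -2 * (s * x + t * x') := by ring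
  rw [e] at this
  nlinarith

theorem rateFun_concave {p q x y x' y' s t : ℝ} (hp : 0 ≤ p) (hq : 0 ≤ q) (hx : 0 ≤ x)
    (hy : 0 ≤ y) (hx' : 0 ≤ x') (hy' : 0 ≤ y') (hs : 0 ≤ s) (ht : 0 ≤ t) (hst : s + t = 1) :
    s * rateFun p q x y + t * rateFun p q x' y'
      ≤ rateFun p q (s * x + t * x') (s * y + t * y') := by
  have h1 := one_le_rateFun_arg hp hq hx hy
  have h2 := one_le_rateFun_arg hp hq hx' hy'
  have h3 := strictConcaveOn_log_Ioi.concaveOn.2 (Set.mem_Ioi.mpr (lt_of_lt_of_le one_pos h1))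
    (Set.mem_Ioi.mpr (lt_of_lt_of_le one_pos h2)) hs ht hst
  simp only [smul_eq_mul] at h3
  have e1 := mul_le_mul_of_nonneg_left (one_sub_exp_concave x x' hs ht hst) hp
  have e2 := mul_le_mul_of_nonneg_left (one_sub_exp_concave y y' hs ht hst) hq
  have h4 : Real.log (s * (1 + p * (1 - Real.exp (-2 * x)) + q * (1 - Real.exp (-2 * y)))
      + t * (1 + p * (1 - Real.exp (-2 * x')) + q * (1 - Real.exp (-2 * y'))))
      ≤ Real.log (1 + p * (1 - Real.exp (-2 * (s * x + t * x')))
        + q * (1 - Real.exp (-2 * (s * y + t * y')))) := by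
    apply Real.log_le_log
    · nlinarith [mul_le_mul_of_nonneg_left h1 hs, mul_le_mul_of_nonneg_left h2 ht]
    · nlinarith
  unfold rateFun; linarith

/-! ### Sums over subtrees -/

/-- The sum of `F` over the subtree of height `h` rooted at the node `(k, i)`. -/
def subtreeSum (F : ℕ → ℕ → ℝ) : ℕ → ℕ → ℕ → ℝ
  | 0, k, i => F k i
  | h + 1, k, i => F k i + subtreeSum F h (k + 1) (2 * i) + subtreeSum F h (k + 1) (2 * i + 1)

theorem subtreeSum_eq (F : ℕ → ℕ → ℝ) (h : ℕ) : ∀ k i, subtreeSum F h k i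
    = ∑ l ∈ Finset.range (h + 1), ∑ m ∈ Finset.range (2 ^ l), F (k + l) (i * 2 ^ l + m) := by
  induction h with
  | zero => intro k i; simp [subtreeSum]
  | succ h ih =>
    intro k i
    rw [subtreeSum, ih, ih, Finset.sum_range_succ' _ (h + 1), add_assoc, ← Finset.sum_add_distrib,
      add_comm]
    congr 1
    · refine Finset.sum_congr rfl fun l _ => ?_
      rw [pow_succ, mul_two, Finset.sum_range_add]
      congr 1
      · refine Finset.sum_congr rfl fun m _ => ?_
        congr 1 <;> ring
      · refine Finset.sum_congr rfl fun m _ => ?_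
        congr 1 <;> ring
    · simp

theorem subtreeSum_root (F : ℕ → ℕ → ℝ) (K : ℕ) : subtreeSum F K 0 0
    = ∑ k ∈ Finset.range (K + 1), ∑ i ∈ Finset.range (2 ^ k), F k i := by
  simp [subtreeSum_eq]

namespace GaussTree

variable {K : ℕ} (T : GaussTree K)

/-! ### The observations below a node -/

/-- In this form the ancestor of a leaf is an integer quotient, and passing to the parent is
halving. -/
theorem mem_below {k i : ℕ} {j : Leaf K} : j ∈ below K k i ↔ (j : ℕ) / 2 ^ (K - k) = i := by
  have h2 : 0 < 2 ^ (K - k) := by positivity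
  rw [below, Finset.mem_filter, Nat.div_eq_iff h2]
  simp only [Finset.mem_univ, true_and]
  rw [Nat.add_mul, one_mul, mul_comm]
  omega

theorem mem_below_iff_child {k i : ℕ} (hk : k < K) {j : Leaf K} :
    j ∈ below K k i ↔ j ∈ below K (k + 1) (2 * i) ∨ j ∈ below K (k + 1) (2 * i + 1) := by
  simp only [mem_below]
  have : K - k = (K - (k + 1)) + 1 := by omega
  rw [this, pow_succ, ← Nat.div_div_eq_div_mul]
  omega

theorem below_eq_union {k i : ℕ} (hk : k < K) :
    below K k i = below K (k + 1) (2 * i) ∪ below K (k + 1) (2 * i + 1) := by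
  ext j; rw [Finset.mem_union, mem_below_iff_child hk]

theorem disjoint_below_children (k i : ℕ) :
    Disjoint (below K (k + 1) (2 * i)) (below K (k + 1) (2 * i + 1)) := by
  rw [Finset.disjoint_left]
  intro j h1 h2
  rw [mem_below] at h1 h2
  omega

theorem below_nonempty {k i : ℕ} (hk : k ≤ K) (hi : i < 2 ^ k) : (below K k i).Nonempty := by
  refine ⟨⟨i * 2 ^ (K - k), ?_⟩, ?_⟩
  · calc i * 2 ^ (K - k) < 2 ^ k * 2 ^ (K - k) := by
          exact Nat.mul_lt_mul_of_pos_right hi (by positivity)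
      _ = 2 ^ K := by rw [← pow_add]; congr 1; omega
  · rw [mem_below]
    exact Nat.mul_div_cancel _ (by positivity)

theorem below_root : below K 0 0 = Finset.univ := by
  ext j
  simp only [mem_below, Finset.mem_univ, iff_true]
  exact Nat.div_eq_of_lt (by simp)

theorem below_leaf (j : Leaf K) : below K K j = {j} := by
  ext x
  simp only [mem_below, Finset.mem_singleton, Nat.sub_self, pow_zero, Nat.div_one]
  exact Fin.val_inj

theorem child_lt {k i : ℕ} (hi : i < 2 ^ k) : 2 * i < 2 ^ (k + 1) ∧ 2 * i + 1 < 2 ^ (k + 1) := by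
  rw [pow_succ]; omega

/-! ### The restricted rates -/

/-- The coefficient of the child `c` in the rate function of the node `(k, i)`. -/
noncomputable def coef (k i c : ℕ) : ℝ :=
  T.gain (k + 1) c ^ 2 * T.noiseVar k i / T.noiseVar (k + 1) c

theorem coef_nonneg (k i c : ℕ) : 0 ≤ T.coef k i c := by unfold coef; positivity

theorem nodeFun_eq (k i : ℕ) (x y : ℝ) :
    T.nodeFun k i x y = rateFun (T.coef k i (2 * i)) (T.coef k i (2 * i + 1)) x y := rfl

theorem telescope_congr {S S' : Finset (Leaf K)} {r r' : ℕ → ℕ → ℝ} (h : ℕ) : ∀ i, h ≤ K →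
    (∀ j ∈ below K (K - h) i, j ∈ S ↔ j ∈ S') →
    (∀ k, K - h ≤ k → k ≤ K → ∀ m, below K k m ⊆ below K (K - h) i → r k m = r' k m) →
    T.telescope S r h i = T.telescope S' r' h i := by
  induction h with
  | zero => intro i _ hS hr; simpa [telescope] using hr K (by simp) le_rfl i (by simp)
  | succ h ih =>
    intro i hK hS hr
    have e : K - (h + 1) + 1 = K - h := by omega
    have hk : K - (h + 1) < K := by omega
    have c1 : below K (K - h) (2 * i) ⊆ below K (K - (h + 1)) i := by
      rw [below_eq_union hk, e]; exact Finset.subset_union_left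
    have c2 : below K (K - h) (2 * i + 1) ⊆ below K (K - (h + 1)) i := by
      rw [below_eq_union hk, e]; exact Finset.subset_union_right
    rw [telescope, telescope, hr _ le_rfl (by omega) i subset_rfl,
      ih (2 * i) (by omega) (fun j hj => hS j (c1 hj))
        (fun k h1 h2 m hm => hr k (by omega) h2 m (hm.trans c1)),
      ih (2 * i + 1) (by omega) (fun j hj => hS j (c2 hj))
        (fun k h1 h2 m hm => hr k (by omega) h2 m (hm.trans c2))]
    have h1 : below K (K - (h + 1)) i ⊆ S ↔ below K (K - (h + 1)) i ⊆ S' :=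
      forall₂_congr fun j hj => hS j hj
    have h2 : below K (K - (h + 1)) i ⊆ Sᶜ ↔ below K (K - (h + 1)) i ⊆ S'ᶜ := by
      refine forall₂_congr fun j hj => ?_
      simp only [Finset.mem_compl]
      exact not_congr (hS j hj)
    simp only [h1, h2]

theorem restrictedFun_congr_set {S S' : Finset (Leaf K)} (r : ℕ → ℕ → ℝ) {k i : ℕ} (hk : k ≤ K)
    (hS : ∀ j ∈ below K k i, j ∈ S ↔ j ∈ S') :
    T.restrictedFun S r k i = T.restrictedFun S' r k i := by
  unfold restrictedFun
  have e : K - (K - k) = k := by omega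
  apply telescope_congr T (K - k) i (by omega) (by rwa [e])
  intro l h1 h2 m hm
  rw [e] at hm
  have : below K l m ⊆ S ↔ below K l m ⊆ S' := forall₂_congr fun j hj => hS j (hm hj)
  simp only [this]

theorem telescope_of_subset {S : Finset (Leaf K)} {r : ℕ → ℕ → ℝ} {h i : ℕ}
    (hS : below K (K - h) i ⊆ S ∨ below K (K - h) i ⊆ Sᶜ) :
    T.telescope S r h i = r (K - h) i := by
  cases h with
  | zero => rfl
  | succ h => rw [telescope, if_pos hS]

theorem restrictedFun_of_subset {S : Finset (Leaf K)} (r : ℕ → ℕ → ℝ) {k i : ℕ} (hk : k ≤ K)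
    (hS : below K k i ⊆ S) : T.restrictedFun S r k i = r k i := by
  unfold restrictedFun
  have e : K - (K - k) = k := by omega
  rw [telescope_of_subset T (by rw [e]; exact Or.inl hS), e, if_pos hS]

theorem restrictedFun_of_subset_compl {S : Finset (Leaf K)} (r : ℕ → ℕ → ℝ) {k i : ℕ} (hk : k ≤ K)
    (hi : i < 2 ^ k) (hS : below K k i ⊆ Sᶜ) : T.restrictedFun S r k i = 0 := by
  unfold restrictedFun
  have e : K - (K - k) = k := by omega
  rw [telescope_of_subset T (by rw [e]; exact Or.inr hS), e, if_neg]
  intro h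
  obtain ⟨j, hj⟩ := below_nonempty hk hi
  exact Finset.mem_compl.mp (hS hj) (h hj)

theorem restrictedFun_leaf_of_notMem {S : Finset (Leaf K)} (r : ℕ → ℕ → ℝ) {i : ℕ}
    (hS : ¬ below K K i ⊆ S) : T.restrictedFun S r K i = 0 := by
  unfold restrictedFun
  rw [Nat.sub_self, telescope, if_neg hS]

/-- The recursion also covers the nodes without leaves in S, because a node function vanishes at (0,
0). Afterwards f^S has only two cases: the node lies in S, or the recursion applies. -/
theorem restrictedFun_of_not_subset {S : Finset (Leaf K)} (r : ℕ → ℕ → ℝ) {k i : ℕ} (hk : k < K)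
    (hi : i < 2 ^ k) (hS : ¬ below K k i ⊆ S) : T.restrictedFun S r k i
      = T.nodeFun k i (T.restrictedFun S r (k + 1) (2 * i))
        (T.restrictedFun S r (k + 1) (2 * i + 1)) := by
  by_cases hc : below K k i ⊆ Sᶜ
  · rw [below_eq_union hk, Finset.union_subset_iff] at hc
    rw [restrictedFun_of_subset_compl T r hk (child_lt hi).1 hc.1,
      restrictedFun_of_subset_compl T r hk (child_lt hi).2 hc.2,
      restrictedFun_of_subset_compl T r hk.le hi (by
        rw [below_eq_union hk, Finset.union_subset_iff]; exact hc), nodeFun_eq,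
      rateFun_zero_zero]
  · unfold restrictedFun
    have e : K - k = (K - (k + 1)) + 1 := by omega
    have e2 : K - (K - (k + 1) + 1) = k := by omega
    rw [e, telescope, e2, if_neg (by tauto)]

/-- Induction over the nodes, from the leaves to the root. -/
theorem node_induction {P : ℕ → ℕ → Prop} (leaf : ∀ i < 2 ^ K, P K i)
    (node : ∀ k < K, ∀ i < 2 ^ k, P (k + 1) (2 * i) → P (k + 1) (2 * i + 1) → P k i) :
    ∀ k ≤ K, ∀ i < 2 ^ k, P k i := by
  intro k hk
  induction hk using Nat.decreasingInduction with
  | self => exact leaf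
  | of_succ k hk ih =>
    exact fun i hi => node k hk i hi (ih _ (child_lt hi).1) (ih _ (child_lt hi).2)

/-- The families of rates that are nonnegative on the tree. -/
def nonnegRates (K : ℕ) : Set (ℕ → ℕ → ℝ) := {r | ∀ k ≤ K, ∀ i < 2 ^ k, 0 ≤ r k i}

theorem restrictedFun_nonneg (S : Finset (Leaf K)) {r : ℕ → ℕ → ℝ} (hr : r ∈ nonnegRates K) :
    ∀ k ≤ K, ∀ i < 2 ^ k, 0 ≤ T.restrictedFun S r k i := by
  apply node_induction
  · intro i hi
    by_cases hS : below K K i ⊆ S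
    · rw [restrictedFun_of_subset T r le_rfl hS]; exact hr K le_rfl i hi
    · rw [restrictedFun_leaf_of_notMem T r hS]
  · intro k hk i hi h1 h2
    by_cases hS : below K k i ⊆ S
    · rw [restrictedFun_of_subset T r hk.le hS]; exact hr k hk.le i hi
    · rw [restrictedFun_of_not_subset T r hk hi hS, nodeFun_eq]
      exact rateFun_nonneg (T.coef_nonneg ..) (T.coef_nonneg ..) h1 h2

theorem continuousOn_restrictedFun (S : Finset (Leaf K)) : ∀ k ≤ K, ∀ i < 2 ^ k,
    ContinuousOn (fun r => T.restrictedFun S r k i) (nonnegRates K) := by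
  apply node_induction
  · intro i hi
    by_cases hS : below K K i ⊆ S
    · simp only [restrictedFun_of_subset T _ le_rfl hS]
      fun_prop
    · simp only [restrictedFun_leaf_of_notMem T _ hS]
      fun_prop
  · intro k hk i hi h1 h2
    by_cases hS : below K k i ⊆ S
    · simp only [restrictedFun_of_subset T _ hk.le hS]
      fun_prop
    · simp only [restrictedFun_of_not_subset T _ hk hi hS, nodeFun_eq]
      exact h1.rateFun (T.coef_nonneg ..) (T.coef_nonneg ..) h2
        (fun r hr => T.restrictedFun_nonneg S hr _ hk _ (child_lt hi).1)
        (fun r hr => T.restrictedFun_nonneg S hr _ hk _ (child_lt hi).2)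

/-- At nodes contained in S the function is a coordinate, hence linear; elsewhere it is an
increasing concave function of two concave ones. -/
theorem restrictedFun_concave (S : Finset (Leaf K)) {r r' : ℕ → ℕ → ℝ} (hr : r ∈ nonnegRates K)
    (hr' : r' ∈ nonnegRates K) {s t : ℝ} (hs : 0 ≤ s) (ht : 0 ≤ t) (hst : s + t = 1) :
    ∀ k ≤ K, ∀ i < 2 ^ k, s * T.restrictedFun S r k i + t * T.restrictedFun S r' k i
      ≤ T.restrictedFun S (s • r + t • r') k i := by
  apply node_induction
  · intro i hi
    by_cases hS : below K K i ⊆ S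
    · simp [restrictedFun_of_subset T _ le_rfl hS]
    · simp [restrictedFun_leaf_of_notMem T _ hS]
  · intro k hk i hi h1 h2
    by_cases hS : below K k i ⊆ S
    · simp [restrictedFun_of_subset T _ hk.le hS]
    · simp only [restrictedFun_of_not_subset T _ hk hi hS, nodeFun_eq]
      have n1 := T.restrictedFun_nonneg S hr _ hk _ (child_lt hi).1
      have n2 := T.restrictedFun_nonneg S hr _ hk _ (child_lt hi).2
      have n3 := T.restrictedFun_nonneg S hr' _ hk _ (child_lt hi).1
      have n4 := T.restrictedFun_nonneg S hr' _ hk _ (child_lt hi).2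
      refine (rateFun_concave (T.coef_nonneg ..) (T.coef_nonneg ..) n1 n2 n3 n4 hs ht hst).trans ?_
      exact rateFun_mono (T.coef_nonneg ..) (T.coef_nonneg ..) (by positivity) (by positivity) h1 h2

/-! ### The total of the restricted rates -/

/-- The sum of the restricted rates over the whole tree. -/
noncomputable def totalRate (S : Finset (Leaf K)) (r : ℕ → ℕ → ℝ) : ℝ :=
  ∑ k ∈ Finset.range (K + 1), ∑ i ∈ Finset.range (2 ^ k), T.restrictedFun S r k i

theorem totalRate_univ (r : ℕ → ℕ → ℝ) : T.totalRate Finset.univ r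
    = ∑ k ∈ Finset.range (K + 1), ∑ i ∈ Finset.range (2 ^ k), r k i := by
  refine Finset.sum_congr rfl fun k hk => Finset.sum_congr rfl fun i _ => ?_
  exact T.restrictedFun_of_subset r (by simpa [Nat.lt_succ_iff] using hk) (Finset.subset_univ _)

theorem totalRate_empty (r : ℕ → ℕ → ℝ) : T.totalRate ∅ r = 0 := by
  refine Finset.sum_eq_zero fun k hk => Finset.sum_eq_zero fun i hi => ?_
  exact T.restrictedFun_of_subset_compl r (by simpa [Nat.lt_succ_iff] using hk)
    (Finset.mem_range.mp hi) (by simp)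

/-- A node that is not an ancestor of A has all its leaves in Aᶜ, so its term r - f^{Aᶜ} is zero and
the sum may run over the whole tree. -/
theorem sum_ancestors_eq (A : Finset (Leaf K)) (r : ℕ → ℕ → ℝ) :
    ∑ k ∈ Finset.range (K + 1), ∑ i ∈ ancestors A k, (r k i - T.restrictedFun Aᶜ r k i)
      = T.totalRate Finset.univ r - T.totalRate Aᶜ r := by
  rw [totalRate_univ, totalRate, ← Finset.sum_sub_distrib]
  refine Finset.sum_congr rfl fun k hk => ?_
  rw [← Finset.sum_sub_distrib]
  refine Finset.sum_subset (Finset.filter_subset _ _) fun i hi h => ?_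
  rw [T.restrictedFun_of_subset r (by simpa [Nat.lt_succ_iff] using hk), sub_self]
  intro j hj
  rw [Finset.mem_compl]
  intro hA
  exact h (Finset.mem_filter.mpr ⟨hi, ⟨j, Finset.mem_inter.mpr ⟨hj, hA⟩⟩⟩)

theorem continuousOn_totalRate (S : Finset (Leaf K)) :
    ContinuousOn (T.totalRate S) (nonnegRates K) := by
  refine continuousOn_finsetSum _ fun k hk => continuousOn_finsetSum _ fun i hi => ?_
  exact T.continuousOn_restrictedFun S k (by simpa [Nat.lt_succ_iff] using hk) i
    (Finset.mem_range.mp hi)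

theorem totalRate_concave (S : Finset (Leaf K)) {r r' : ℕ → ℕ → ℝ} (hr : r ∈ nonnegRates K)
    (hr' : r' ∈ nonnegRates K) {s t : ℝ} (hs : 0 ≤ s) (ht : 0 ≤ t) (hst : s + t = 1) :
    s * T.totalRate S r + t * T.totalRate S r' ≤ T.totalRate S (s • r + t • r') := by
  simp only [totalRate, Finset.mul_sum, ← Finset.sum_add_distrib]
  refine Finset.sum_le_sum fun k hk => Finset.sum_le_sum fun i hi => ?_
  exact T.restrictedFun_concave S hr hr' hs ht hst k (by simpa [Nat.lt_succ_iff] using hk) i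
    (Finset.mem_range.mp hi)

end GaussTree

/-! ### Closedness and convexity of the outer region. -/

namespace GaussTree

variable {K : ℕ} (T : GaussTree K)

/-- The families of rates in `noiseRates d` that satisfy the constraints of the outer region for
the rates `R` of the observations. -/
def feasibleRates (R : Leaf K → ℝ) (d : ℝ) : Set (ℕ → ℕ → ℝ) :=
  {r | r ∈ T.noiseRates d ∧
    ∀ S : Finset (Leaf K), T.totalRate Finset.univ r - T.totalRate S r ≤ ∑ j ∈ Sᶜ, R j}

theorem mem_rdOut_iff {p : (Leaf K → ℝ) × ℝ} : p ∈ T.rdOut ↔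
    (∀ j, 0 ≤ p.1 j) ∧ 0 < p.2 ∧ (T.feasibleRates p.1 p.2).Nonempty := by
  simp only [rdOut, Set.mem_ofPred_eq, sum_ancestors_eq, feasibleRates, Set.Nonempty]
  refine and_congr_right fun _ => and_congr_right fun _ => exists_congr fun r =>
    and_congr_right fun _ => ⟨fun h S => by simpa using h Sᶜ, fun h A => by simpa using h Aᶜ⟩

theorem noiseRates_subset (d : ℝ) : T.noiseRates d ⊆ nonnegRates K := fun _ h => h.1

/-- Every rate is bounded by the sum of the rates of the observations. -/
theorem le_of_mem_feasibleRates {R : Leaf K → ℝ} {d : ℝ} {r : ℕ → ℕ → ℝ}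
    (hr : r ∈ T.feasibleRates R d) {k i : ℕ} (hk : k ≤ K) (hi : i < 2 ^ k) :
    r k i ≤ ∑ j, R j := by
  -- The constraint of the set of all leaves: nothing is subtracted, so the sum of all rates is
  -- bounded.
  have h := hr.2 ∅
  rw [totalRate_empty, totalRate_univ, sub_zero, Finset.compl_empty] at h
  refine le_trans ?_ h
  have hn : ∀ l ∈ Finset.range (K + 1), ∀ m ∈ Finset.range (2 ^ l), 0 ≤ r l m :=
    fun l hl m hm => hr.1.1 l (by simpa [Nat.lt_succ_iff] using hl) m (Finset.mem_range.mp hm)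
  calc r k i ≤ ∑ m ∈ Finset.range (2 ^ k), r k m :=
        Finset.single_le_sum (hn k (by simpa [Nat.lt_succ_iff] using hk))
          (Finset.mem_range.mpr hi)
    _ ≤ _ := Finset.single_le_sum (f := fun l => ∑ m ∈ Finset.range (2 ^ l), r l m)
        (fun l hl => Finset.sum_nonneg (hn l hl))
        (by simpa [Nat.lt_succ_iff] using hk)

theorem totalRate_congr (S : Finset (Leaf K)) {r r' : ℕ → ℕ → ℝ}
    (h : ∀ k ≤ K, ∀ i < 2 ^ k, r k i = r' k i) : T.totalRate S r = T.totalRate S r' := by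
  refine Finset.sum_congr rfl fun k hk => Finset.sum_congr rfl fun i hi => ?_
  have hk' : k ≤ K := by simpa [Nat.lt_succ_iff] using hk
  revert k
  suffices ∀ k ≤ K, ∀ i < 2 ^ k, T.restrictedFun S r k i = T.restrictedFun S r' k i from
    fun k _ hi hk => this k hk i (Finset.mem_range.mp hi)
  apply node_induction
  · intro i hi
    by_cases hS : below K K i ⊆ S
    · rw [restrictedFun_of_subset T r le_rfl hS, restrictedFun_of_subset T r' le_rfl hS]
      exact h K le_rfl i hi
    · rw [restrictedFun_leaf_of_notMem T r hS, restrictedFun_leaf_of_notMem T r' hS]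
  · intro k hk i hi h1 h2
    by_cases hS : below K k i ⊆ S
    · rw [restrictedFun_of_subset T r hk.le hS, restrictedFun_of_subset T r' hk.le hS]
      exact h k hk.le i hi
    · rw [restrictedFun_of_not_subset T r hk hi hS, restrictedFun_of_not_subset T r' hk hi hS,
        h1, h2]

/-- The families of rates that vanish off the tree, with values in `[0, M]`. -/
def rateBox (K : ℕ) (M : ℝ) : Set (ℕ → ℕ → ℝ) :=
  Set.univ.pi fun k => Set.univ.pi fun i => Set.Icc 0 (if k ≤ K ∧ i < 2 ^ k then M else 0)

theorem isCompact_rateBox (K : ℕ) (M : ℝ) : IsCompact (rateBox K M) :=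
  isCompact_univ_pi fun _ => isCompact_univ_pi fun _ => isCompact_Icc

theorem rateBox_subset (M : ℝ) : rateBox K M ⊆ nonnegRates K :=
  fun _ h k _ i _ => (h k trivial i trivial).1

/-- A family of rates, set to zero off the tree. -/
noncomputable def truncate (K : ℕ) (r : ℕ → ℕ → ℝ) (k i : ℕ) : ℝ :=
  if k ≤ K ∧ i < 2 ^ k then r k i else 0

theorem truncate_apply {r : ℕ → ℕ → ℝ} {k i : ℕ} (hk : k ≤ K) (hi : i < 2 ^ k) :
    truncate K r k i = r k i := if_pos ⟨hk, hi⟩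

/-- Values off the tree are irrelevant to the constraints. Setting them to zero puts the family into
a compact box. -/
theorem truncate_mem {R : Leaf K → ℝ} {d : ℝ} {r : ℕ → ℕ → ℝ} (hr : r ∈ T.feasibleRates R d) :
    truncate K r ∈ T.feasibleRates R d ∩ rateBox K (∑ j, R j) := by
  refine ⟨⟨⟨fun k hk i hi => ?_, ?_, fun k hk i hi => ?_⟩, fun S => ?_⟩, fun k _ i _ => ?_⟩
  · rw [truncate_apply hk hi]; exact hr.1.1 k hk i hi
  · rw [truncate_apply (Nat.zero_le K) (by simp)]; exact hr.1.2.1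
  · rw [truncate_apply hk.le hi, truncate_apply hk (child_lt hi).1,
      truncate_apply hk (child_lt hi).2]
    exact hr.1.2.2 k hk i hi
  · rw [T.totalRate_congr S (r' := r) fun k hk i hi => truncate_apply hk hi,
      T.totalRate_congr Finset.univ (r' := r) fun k hk i hi => truncate_apply hk hi]
    exact hr.2 S
  · by_cases h : k ≤ K ∧ i < 2 ^ k
    · simp only [truncate, if_pos h]
      exact ⟨hr.1.1 k h.1 i h.2, T.le_of_mem_feasibleRates hr h.1 h.2⟩
    · simp [truncate, if_neg h]

theorem continuousOn_nodeFun {k i : ℕ} (hk : k < K) (hi : i < 2 ^ k) :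
    ContinuousOn (fun r : ℕ → ℕ → ℝ => T.nodeFun k i (r (k + 1) (2 * i)) (r (k + 1) (2 * i + 1)))
      (nonnegRates K) := by
  simp only [nodeFun_eq]
  exact ContinuousOn.rateFun (T.coef_nonneg ..) (T.coef_nonneg ..) (by fun_prop) (by fun_prop)
    (fun r hr => hr _ hk _ (child_lt hi).1) (fun r hr => hr _ hk _ (child_lt hi).2)

open Filter Topology in
/-- The constraints of the outer region are closed. -/
theorem mem_feasibleRates_of_tendsto {R : ℕ → Leaf K → ℝ} {d : ℕ → ℝ} {r : ℕ → ℕ → ℕ → ℝ}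
    {R' : Leaf K → ℝ} {d' : ℝ} {r' : ℕ → ℕ → ℝ} (h : ∀ n, r n ∈ T.feasibleRates (R n) (d n))
    (hR : Tendsto R atTop (𝓝 R')) (hd : Tendsto d atTop (𝓝 d')) (hr : Tendsto r atTop (𝓝 r'))
    (hd' : 0 < d') (h0 : 0 < T.noiseVar 0 0) : r' ∈ T.feasibleRates R' d' := by
  have hcoord : ∀ k i, Tendsto (fun n => r n k i) atTop (𝓝 (r' k i)) := fun k i =>
    ((continuous_apply_apply k i).tendsto r').comp hr
  have hnn : r' ∈ nonnegRates K := fun k hk i hi =>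
    ge_of_tendsto' (hcoord k i) fun n => (h n).1.1 k hk i hi
  have hw : Tendsto r atTop (𝓝[nonnegRates K] r') :=
    tendsto_nhdsWithin_iff.mpr ⟨hr, Eventually.of_forall fun n => (h n).1.1⟩
  refine ⟨⟨hnn, ?_, fun k hk i hi => ?_⟩, fun S => ?_⟩
  · refine le_of_tendsto_of_tendsto' (Tendsto.const_mul _ ?_) (hcoord 0 0) fun n => (h n).1.2.1
    have : (T.noiseVar 0 0 / d' : ℝ) ≠ 0 := by positivity
    exact (tendsto_const_nhds.div hd hd'.ne').log this
  · exact le_of_tendsto_of_tendsto' (hcoord k i)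
      ((T.continuousOn_nodeFun hk hi r' hnn).tendsto.comp hw) fun n => (h n).1.2.2 k hk i hi
  · refine le_of_tendsto_of_tendsto'
      (((T.continuousOn_totalRate _ r' hnn).tendsto.comp hw).sub
        ((T.continuousOn_totalRate S r' hnn).tendsto.comp hw))
      (tendsto_finsetSum _ fun j _ => ((continuous_apply j).tendsto R').comp hR)
      fun n => (h n).2 S

open Filter Topology in
-- Witness families of a convergent sequence of points lie, after truncation, in one compact box; a
-- cluster point of them is a witness for the limit.
theorem isClosed_rdOut (h0 : 0 < T.noiseVar 0 0) : IsClosed T.rdOut := by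
  refine isClosed_of_closure_subset fun p hp => ?_
  obtain ⟨u, hu, hlim⟩ := mem_closure_iff_seq_limit.mp hp
  have hlim1 : Tendsto (fun n => (u n).1) atTop (𝓝 p.1) := (continuous_fst.tendsto p).comp hlim
  have hlim2 : Tendsto (fun n => (u n).2) atTop (𝓝 p.2) := (continuous_snd.tendsto p).comp hlim
  have hu' := fun n => T.mem_rdOut_iff.mp (hu n)
  choose r hr using fun n => (hu' n).2.2
  have hsum : Tendsto (fun n => ∑ j, (u n).1 j) atTop (𝓝 (∑ j, p.1 j)) :=
    tendsto_finsetSum _ fun j _ => ((continuous_apply j).tendsto p.1).comp hlim1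
  obtain ⟨M, hM⟩ := hsum.bddAbove_range
  have hM' : ∀ n, ∑ j, (u n).1 j ≤ M := fun n => hM ⟨n, rfl⟩
  have hbox : ∀ n, truncate K (r n) ∈ rateBox K M := fun n k _ i _ => by
    have := (T.truncate_mem (hr n)).2 k trivial i trivial
    refine ⟨this.1, this.2.trans ?_⟩
    split_ifs
    · exact hM' n
    · exact le_rfl
  obtain ⟨r', -, φ, hφ, hr'⟩ := (isCompact_rateBox K M).tendsto_subseq hbox
  have hd : 0 < p.2 := by
    -- The distortion cannot tend to zero: the root rate is at least ½ log(σ²/d) and at most M.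
    have hle : ∀ n, (T.noiseVar 0 0 : ℝ) * Real.exp (-2 * M) ≤ (u n).2 := fun n => by
      have h1 := (hr n).1.2.1
      have h2 := T.le_of_mem_feasibleRates (hr n) (Nat.zero_le K) (i := 0) (by simp)
      have hd := (hu' n).2.1
      have h3 : Real.log (T.noiseVar 0 0 / (u n).2) ≤ 2 * M := by linarith [hM' n]
      rw [Real.log_le_iff_le_exp (by positivity), div_le_iff₀ hd] at h3
      calc (T.noiseVar 0 0 : ℝ) * Real.exp (-2 * M)
          ≤ Real.exp (2 * M) * (u n).2 * Real.exp (-2 * M) :=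
            mul_le_mul_of_nonneg_right h3 (Real.exp_pos _).le
        _ = (u n).2 * (Real.exp (2 * M) * Real.exp (-2 * M)) := by ring
        _ = (u n).2 := by rw [← Real.exp_add]; simp
    exact lt_of_lt_of_le (by positivity) (ge_of_tendsto' hlim2 hle)
  refine T.mem_rdOut_iff.mpr ⟨fun j => ?_, hd, r', ?_⟩
  · exact ge_of_tendsto' (((continuous_apply j).tendsto p.1).comp hlim1) fun n => (hu' n).1 j
  · exact T.mem_feasibleRates_of_tendsto (fun n => (T.truncate_mem (hr (φ n))).1)
      (hlim1.comp hφ.tendsto_atTop) (hlim2.comp hφ.tendsto_atTop) hr' hd h0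

/-- The average of two witness families is a witness: ½ log(σ²/d) is convex in d, the node functions
are concave, and F_univ - F_S is a linear function minus a concave one. -/
theorem convex_rdOut (h0 : 0 < T.noiseVar 0 0) : Convex ℝ T.rdOut := by
  rintro ⟨R, d⟩ hp ⟨R', d'⟩ hp' s t hs ht hst
  obtain ⟨hR, hd, r, hr⟩ := T.mem_rdOut_iff.mp hp
  obtain ⟨hR', hd', r', hr'⟩ := T.mem_rdOut_iff.mp hp'
  simp only at hR hR' hd hd' hr hr'
  have hdd : 0 < s * d + t * d' := by
    rcases hs.eq_or_lt with rfl | hs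
    · simp at hst; subst hst; simpa
    · have := mul_pos hs hd
      have := mul_nonneg ht hd'.le
      linarith
  refine T.mem_rdOut_iff.mpr ⟨fun j => ?_, hdd, s • r + t • r', ⟨fun k hk i hi => ?_, ?_,
    fun k hk i hi => ?_⟩, fun S => ?_⟩
  · exact add_nonneg (mul_nonneg hs (hR j)) (mul_nonneg ht (hR' j))
  · exact add_nonneg (mul_nonneg hs (hr.1.1 k hk i hi)) (mul_nonneg ht (hr'.1.1 k hk i hi))
  · have h1 := mul_le_mul_of_nonneg_left hr.1.2.1 hs
    have h2 := mul_le_mul_of_nonneg_left hr'.1.2.1 ht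
    have h3 := strictConcaveOn_log_Ioi.concaveOn.2 (Set.mem_Ioi.mpr hd) (Set.mem_Ioi.mpr hd')
      hs ht hst
    simp only [smul_eq_mul] at h3
    have hn : (T.noiseVar 0 0 : ℝ) ≠ 0 := by positivity
    rw [Real.log_div hn hd.ne'] at h1
    rw [Real.log_div hn hd'.ne'] at h2
    change 1 / 2 * Real.log (T.noiseVar 0 0 / (s * d + t * d')) ≤ s * r 0 0 + t * r' 0 0
    rw [Real.log_div hn hdd.ne']
    have : t = 1 - s := by linarith
    subst this
    nlinarith
  · have h1 := mul_le_mul_of_nonneg_left (hr.1.2.2 k hk i hi) hs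
    have h2 := mul_le_mul_of_nonneg_left (hr'.1.2.2 k hk i hi) ht
    have h3 := rateFun_concave (T.coef_nonneg k i (2 * i)) (T.coef_nonneg k i (2 * i + 1))
      (hr.1.1 _ hk _ (child_lt hi).1) (hr.1.1 _ hk _ (child_lt hi).2)
      (hr'.1.1 _ hk _ (child_lt hi).1) (hr'.1.1 _ hk _ (child_lt hi).2) hs ht hst
    rw [nodeFun_eq] at *
    change s * r k i + t * r' k i ≤ rateFun _ _ (s * r (k + 1) (2 * i) + t * r' (k + 1) (2 * i))
      (s * r (k + 1) (2 * i + 1) + t * r' (k + 1) (2 * i + 1))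
    linarith
  · have h1 := mul_le_mul_of_nonneg_left (hr.2 S) hs
    have h2 := mul_le_mul_of_nonneg_left (hr'.2 S) ht
    have h3 := T.totalRate_concave S (T.noiseRates_subset _ hr.1) (T.noiseRates_subset _ hr'.1)
      hs ht hst
    have h4 : T.totalRate Finset.univ (s • r + t • r')
        = s * T.totalRate Finset.univ r + t * T.totalRate Finset.univ r' := by
      simp only [totalRate_univ, Finset.mul_sum, ← Finset.sum_add_distrib]
      rfl
    have h5 : ∑ j ∈ Sᶜ, (s • (R, d) + t • (R', d')).1 j
        = s * ∑ j ∈ Sᶜ, R j + t * ∑ j ∈ Sᶜ, R' j := by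
      simp only [Finset.mul_sum, ← Finset.sum_add_distrib]
      rfl
    rw [h4, h5]
    linarith

end GaussTree

namespace GaussTree

variable {K : ℕ} (T : GaussTree K)

/-! ### Decreasing a rate -/

/-- `c` and `q` are the two children, in some order, of the node `(k, i)`. -/
def IsChildPair (i c q : ℕ) : Prop := c = 2 * i ∧ q = 2 * i + 1 ∨ c = 2 * i + 1 ∧ q = 2 * i

theorem IsChildPair.symm {i c q : ℕ} (h : IsChildPair i c q) : IsChildPair i q c := by
  unfold IsChildPair at *; tauto

theorem IsChildPair.lt {k i c q : ℕ} (h : IsChildPair i c q) (hi : i < 2 ^ k) :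
    c < 2 ^ (k + 1) ∧ q < 2 ^ (k + 1) := by
  have := child_lt hi
  rcases h with ⟨rfl, rfl⟩ | ⟨rfl, rfl⟩ <;> simp [this]

theorem IsChildPair.nodeFun_eq {i c q : ℕ} (h : IsChildPair i c q) (k : ℕ) (r : ℕ → ℝ) :
    T.nodeFun k i (r (2 * i)) (r (2 * i + 1))
      = rateFun (T.coef k i c) (T.coef k i q) (r c) (r q) := by
  rcases h with ⟨rfl, rfl⟩ | ⟨rfl, rfl⟩
  · rfl
  · rw [rateFun_comm]; rfl

theorem IsChildPair.below_eq {k i c q : ℕ} (h : IsChildPair i c q) (hk : k < K) :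
    below K k i = below K (k + 1) c ∪ below K (k + 1) q := by
  rcases h with ⟨rfl, rfl⟩ | ⟨rfl, rfl⟩
  · exact below_eq_union hk
  · rw [Finset.union_comm]; exact below_eq_union hk

theorem IsChildPair.disjoint {i c q : ℕ} (h : IsChildPair i c q) (k : ℕ) :
    Disjoint (below K (k + 1) c) (below K (k + 1) q) := by
  rcases h with ⟨rfl, rfl⟩ | ⟨rfl, rfl⟩
  · exact disjoint_below_children k i
  · exact (disjoint_below_children k i).symm

theorem IsChildPair.restrictedFun_eq {k i c q : ℕ} (h : IsChildPair i c q) (hk : k < K)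
    (hi : i < 2 ^ k) {S : Finset (Leaf K)} (r : ℕ → ℕ → ℝ) (hS : ¬ below K k i ⊆ S) :
    T.restrictedFun S r k i = rateFun (T.coef k i c) (T.coef k i q)
      (T.restrictedFun S r (k + 1) c) (T.restrictedFun S r (k + 1) q) := by
  rw [T.restrictedFun_of_not_subset r hk hi hS, h.nodeFun_eq T k (T.restrictedFun S r (k + 1))]

/-- The family of rates `r` with the rate of the node `(k, c)` decreased by `ε`. -/
def decrease (r : ℕ → ℕ → ℝ) (k c : ℕ) (ε : ℝ) (l m : ℕ) : ℝ :=
  if l = k ∧ m = c then r l m - ε else r l m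

theorem decrease_self (r : ℕ → ℕ → ℝ) (k c : ℕ) (ε : ℝ) : decrease r k c ε k c = r k c - ε := by
  simp [decrease]

theorem decrease_of_ne (r : ℕ → ℕ → ℝ) {k c : ℕ} (ε : ℝ) {l m : ℕ} (h : ¬ (l = k ∧ m = c)) :
    decrease r k c ε l m = r l m := by
  simp [decrease, h]

theorem continuous_decrease (r : ℕ → ℕ → ℝ) (k c : ℕ) : Continuous (decrease r k c) := by
  refine continuous_pi fun l => continuous_pi fun m => ?_
  unfold decrease
  split_ifs <;> fun_prop

theorem decrease_zero (r : ℕ → ℕ → ℝ) (k c : ℕ) : decrease r k c 0 = r := by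
  funext l m; simp [decrease]

theorem sum_node_single (F : ℕ → ℕ → ℝ) {k c : ℕ} (hk : k ≤ K) (hc : c < 2 ^ k)
    (h : ∀ l ≤ K, ∀ m < 2 ^ l, ¬ (l = k ∧ m = c) → F l m = 0) :
    ∑ l ∈ Finset.range (K + 1), ∑ m ∈ Finset.range (2 ^ l), F l m = F k c := by
  rw [Finset.sum_eq_single k, Finset.sum_eq_single c]
  · intro m hm hmc
    exact h k hk m (Finset.mem_range.mp hm) (by tauto)
  · intro h; exact absurd (Finset.mem_range.mpr hc) h
  · intro l hl hlk
    refine Finset.sum_eq_zero fun m hm => ?_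
    exact h l (by simpa [Nat.lt_succ_iff] using hl) m (Finset.mem_range.mp hm) (by tauto)
  · intro h; exact absurd (Finset.mem_range.mpr (Nat.lt_succ_of_le hk)) h

theorem totalRate_univ_decrease (r : ℕ → ℕ → ℝ) {k c : ℕ} (ε : ℝ) (hk : k ≤ K) (hc : c < 2 ^ k) :
    T.totalRate Finset.univ (decrease r k c ε) = T.totalRate Finset.univ r - ε := by
  rw [totalRate_univ, totalRate_univ, eq_sub_iff_add_eq, ← eq_sub_iff_add_eq', ← neg_inj, neg_sub]
  simp only [← Finset.sum_sub_distrib]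
  rw [sum_node_single _ hk hc fun l _ m _ h => by rw [decrease_of_ne r ε h, sub_self],
    decrease_self]
  ring

/-- f^S never reads the rate of a node that has a leaf outside S. -/
theorem totalRate_decrease_of_not_subset (S : Finset (Leaf K)) (r : ℕ → ℕ → ℝ) {k c : ℕ} (ε : ℝ)
    (hS : ¬ below K k c ⊆ S) : T.totalRate S (decrease r k c ε) = T.totalRate S r := by
  suffices ∀ l ≤ K, ∀ m < 2 ^ l,
      T.restrictedFun S (decrease r k c ε) l m = T.restrictedFun S r l m from
    Finset.sum_congr rfl fun l hl => Finset.sum_congr rfl fun m hm =>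
      this l (by simpa [Nat.lt_succ_iff] using hl) m (Finset.mem_range.mp hm)
  have hne : ∀ l m, below K l m ⊆ S → decrease r k c ε l m = r l m := fun l m h =>
    decrease_of_ne r ε (by rintro ⟨rfl, rfl⟩; exact hS h)
  apply node_induction
  · intro m _
    by_cases h : below K K m ⊆ S
    · rw [restrictedFun_of_subset T _ le_rfl h, restrictedFun_of_subset T _ le_rfl h, hne _ _ h]
    · rw [restrictedFun_leaf_of_notMem T _ h, restrictedFun_leaf_of_notMem T _ h]
  · intro l hl m hm h1 h2
    by_cases h : below K l m ⊆ S
    · rw [restrictedFun_of_subset T _ hl.le h, restrictedFun_of_subset T _ hl.le h, hne _ _ h]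
    · rw [restrictedFun_of_not_subset T _ hl hm h, restrictedFun_of_not_subset T _ hl hm h, h1, h2]

theorem IsChildPair.eq_of_child {i c q m : ℕ} (h : IsChildPair i c q)
    (hm : 2 * m = c ∨ 2 * m + 1 = c) : m = i := by
  rcases h with ⟨rfl, rfl⟩ | ⟨rfl, rfl⟩ <;> omega

/-- The rate of c enters f^S at c itself and otherwise only through the parent. The parent ignores
it if its coefficient is zero, or if the parent lies in S and contributes its own rate. So only the
summand at c changes. -/
theorem totalRate_decrease_of_subset {S : Finset (Leaf K)} (r : ℕ → ℕ → ℝ) {k i c q : ℕ} (ε : ℝ)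
    (hk : k < K) (hi : i < 2 ^ k) (hcq : IsChildPair i c q) (hS : below K (k + 1) c ⊆ S)
    (h : T.coef k i c = 0 ∨ below K k i ⊆ S) :
    T.totalRate S (decrease r (k + 1) c ε) = T.totalRate S r - ε := by
  have key : ∀ l ≤ K, ∀ m < 2 ^ l, ¬ (l = k + 1 ∧ m = c) →
      T.restrictedFun S (decrease r (k + 1) c ε) l m = T.restrictedFun S r l m := by
    apply node_induction
    · intro m _ hne
      by_cases h : below K K m ⊆ S
      · rw [restrictedFun_of_subset T _ le_rfl h, restrictedFun_of_subset T _ le_rfl h,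
          decrease_of_ne r ε hne]
      · rw [restrictedFun_leaf_of_notMem T _ h, restrictedFun_leaf_of_notMem T _ h]
    · intro l hl m hm h1 h2 hne
      by_cases hf : below K l m ⊆ S
      · rw [restrictedFun_of_subset T _ hl.le hf, restrictedFun_of_subset T _ hl.le hf,
          decrease_of_ne r ε hne]
      by_cases hlk : l = k ∧ m = i
      · obtain ⟨rfl, rfl⟩ := hlk
        have h0 := h.resolve_right hf
        have hq : T.restrictedFun S (decrease r (l + 1) c ε) (l + 1) q
            = T.restrictedFun S r (l + 1) q := by
          rcases hcq with ⟨rfl, rfl⟩ | ⟨rfl, rfl⟩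
          · exact h2 (by omega)
          · exact h1 (by omega)
        rw [hcq.restrictedFun_eq T hl hm _ hf, hcq.restrictedFun_eq T hl hm _ hf, h0, hq]
        simp [rateFun]
      · rw [restrictedFun_of_not_subset T _ hl hm hf, restrictedFun_of_not_subset T _ hl hm hf,
          h1 fun e => hlk ⟨by omega, hcq.eq_of_child (Or.inl e.2)⟩,
          h2 fun e => hlk ⟨by omega, hcq.eq_of_child (Or.inr e.2)⟩]
  unfold totalRate
  rw [eq_sub_iff_add_eq, ← eq_sub_iff_add_eq', ← neg_inj, neg_sub]
  simp only [← Finset.sum_sub_distrib]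
  rw [sum_node_single _ hk (hcq.lt hi).1 fun l hl m hm h => by rw [key l hl m hm h, sub_self],
    restrictedFun_of_subset T _ hk hS, restrictedFun_of_subset T _ hk hS, decrease_self]
  ring

/-! ### Minimal families of rates and tight sets. -/

/-- A set is tight if its constraint of the outer region holds with equality. -/
def IsTight (R : Leaf K → ℝ) (r : ℕ → ℕ → ℝ) (S : Finset (Leaf K)) : Prop :=
  T.totalRate Finset.univ r - T.totalRate S r = ∑ j ∈ Sᶜ, R j

/-- A feasible family of rates is minimal if the sum of the rates cannot be decreased. -/
def IsMinimalRates (R : Leaf K → ℝ) (d : ℝ) (r : ℕ → ℕ → ℝ) : Prop :=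
  r ∈ T.feasibleRates R d ∧
    ∀ r' ∈ T.feasibleRates R d, T.totalRate Finset.univ r ≤ T.totalRate Finset.univ r'

theorem isClosed_feasibleRates {R : Leaf K → ℝ} {d : ℝ} (hd : 0 < d) (h0 : 0 < T.noiseVar 0 0) :
    IsClosed (T.feasibleRates R d) := by
  refine isClosed_of_closure_subset fun r hr => ?_
  obtain ⟨u, hu, hlim⟩ := mem_closure_iff_seq_limit.mp hr
  exact T.mem_feasibleRates_of_tendsto hu tendsto_const_nhds tendsto_const_nhds hlim hd h0

/-- Truncation does not change F_univ, so it suffices to minimize over the compact part of the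
feasible set inside the box. -/
theorem exists_isMinimalRates {R : Leaf K → ℝ} {d : ℝ} (hd : 0 < d) (h0 : 0 < T.noiseVar 0 0)
    (h : (T.feasibleRates R d).Nonempty) : ∃ r, T.IsMinimalRates R d r := by
  have hc : IsCompact (T.feasibleRates R d ∩ rateBox K (∑ j, R j)) :=
    (isCompact_rateBox K _).inter_left (T.isClosed_feasibleRates hd h0)
  have hne : (T.feasibleRates R d ∩ rateBox K (∑ j, R j)).Nonempty :=
    h.imp' _ fun _ hr => T.truncate_mem hr
  obtain ⟨r, hr, hmin⟩ := hc.exists_isMinOn hne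
    ((T.continuousOn_totalRate Finset.univ).mono
      (Set.inter_subset_right.trans (rateBox_subset _)))
  refine ⟨r, hr.1, fun r' hr' => (hmin (T.truncate_mem hr')).trans_eq ?_⟩
  exact T.totalRate_congr _ fun k hk i hi => truncate_apply hk hi

open Filter Topology in
/-- In a minimal family, a positive rate whose decrease would not violate the constraint of its
parent is blocked by a tight set. -/
theorem IsMinimalRates.exists_tight {R : Leaf K → ℝ} {d : ℝ} {r : ℕ → ℕ → ℝ}
    (hr : T.IsMinimalRates R d r) {k i c q : ℕ} (hk : k < K) (hi : i < 2 ^ k)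
    (hcq : IsChildPair i c q) (hpos : 0 < r (k + 1) c)
    (hslack : r k i < T.nodeFun k i (r (k + 1) (2 * i)) (r (k + 1) (2 * i + 1))
      ∨ T.coef k i c = 0) :
    ∃ S, T.IsTight R r S ∧ below K (k + 1) c ⊆ S ∧ ¬ below K (k + 1) q ⊆ S
      ∧ T.coef k i c ≠ 0 := by
  -- Without such a tight set the rate of c could be lowered by a small ε > 0, which keeps the
  -- family feasible and decreases F_univ.
  by_contra! hcon
  have hc := (hcq.lt hi).1
  obtain ⟨hf, hmin⟩ := hr
  set ρ := decrease r (k + 1) c with hρ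
  have hlim : Tendsto ρ (𝓝[>] 0) (𝓝 r) := by
    have := (continuous_decrease r (k + 1) c).tendsto 0
    rw [decrease_zero] at this
    exact this.mono_left nhdsWithin_le_nhds
  have hε : ∀ᶠ ε in 𝓝[>] (0 : ℝ), 0 < ε := eventually_mem_nhdsWithin
  have hsmall : ∀ᶠ ε in 𝓝[>] (0 : ℝ), ε < r (k + 1) c :=
    nhdsWithin_le_nhds (Iio_mem_nhds hpos)
  have hnn : ∀ᶠ ε in 𝓝[>] (0 : ℝ), ρ ε ∈ nonnegRates K := by
    filter_upwards [hsmall] with ε h l hl m hm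
    by_cases hlm : l = k + 1 ∧ m = c
    · obtain ⟨rfl, rfl⟩ := hlm
      rw [hρ, decrease_self]; linarith
    · rw [hρ, decrease_of_ne r ε hlm]; exact hf.1.1 l hl m hm
  have hwlim : Tendsto ρ (𝓝[>] 0) (𝓝[nonnegRates K] r) := tendsto_nhdsWithin_iff.mpr ⟨hlim, hnn⟩
  have hnode : ∀ᶠ ε in 𝓝[>] (0 : ℝ), r k i
      ≤ T.nodeFun k i (ρ ε (k + 1) (2 * i)) (ρ ε (k + 1) (2 * i + 1)) := by
    rcases hslack with h | h
    · have := ((T.continuousOn_nodeFun hk hi r hf.1.1).tendsto.comp hwlim).eventually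
        (lt_mem_nhds h)
      filter_upwards [this] with ε h using h.le
    · refine Eventually.of_forall fun ε => (hf.1.2.2 k hk i hi).trans_eq ?_
      have hne : ¬ (k + 1 = k + 1 ∧ q = c) := by
        rcases hcq with ⟨rfl, rfl⟩ | ⟨rfl, rfl⟩ <;> omega
      rw [hcq.nodeFun_eq T k (r (k + 1)), hcq.nodeFun_eq T k (ρ ε (k + 1)), h, hρ,
        decrease_of_ne r ε hne]
      simp [rateFun]
  have hset : ∀ᶠ ε in 𝓝[>] (0 : ℝ), ∀ S : Finset (Leaf K),
      T.totalRate Finset.univ (ρ ε) - T.totalRate S (ρ ε) ≤ ∑ j ∈ Sᶜ, R j := by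
    rw [eventually_all]
    intro S
    -- Three kinds of S. If c is not inside S, only F_univ drops. If c is inside S and the parent
    -- does not read its rate, F_univ and F_S drop equally. Otherwise S is not tight, and continuity
    -- preserves the strict inequality for small ε.
    by_cases hS : below K (k + 1) c ⊆ S
    · by_cases hS' : T.coef k i c = 0 ∨ below K k i ⊆ S
      · refine Eventually.of_forall fun ε => ?_
        rw [hρ, T.totalRate_univ_decrease r ε hk hc,
          T.totalRate_decrease_of_subset r ε hk hi hcq hS hS']
        linarith [hf.2 S]
      · have hnt : ¬ T.IsTight R r S := fun ht => hS' <| by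
          by_cases hq : below K (k + 1) q ⊆ S
          · right
            rw [hcq.below_eq hk]
            exact Finset.union_subset hS hq
          · exact Or.inl (hcon S ht hS hq)
        have hlt := lt_of_le_of_ne (hf.2 S) hnt
        have := (((T.continuousOn_totalRate Finset.univ r hf.1.1).tendsto.comp hwlim).sub
          ((T.continuousOn_totalRate S r hf.1.1).tendsto.comp hwlim)).eventually (gt_mem_nhds hlt)
        filter_upwards [this] with ε h using h.le
    · filter_upwards [hε] with ε h
      rw [hρ, T.totalRate_univ_decrease r ε hk hc, T.totalRate_decrease_of_not_subset S r ε hS]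
      linarith [hf.2 S]
  obtain ⟨ε, h1, h3, h4, h5⟩ := (hε.and (hnn.and (hnode.and hset))).exists
  have hmem : ρ ε ∈ T.feasibleRates R d := by
    refine ⟨⟨h3, ?_, fun l hl m hm => ?_⟩, h5⟩
    -- The lowered node is at level k + 1 ≥ 1, so the root rate is untouched.
    · rw [hρ, decrease_of_ne r ε (by omega)]
      exact hf.1.2.1
    · by_cases hlm : l = k ∧ m = i
      · obtain ⟨rfl, rfl⟩ := hlm
        rw [hρ, decrease_of_ne r ε (by omega)]
        exact h4
      · rw [hρ, decrease_of_ne (l := l + 1) (m := 2 * m) r ε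
          fun e => hlm ⟨by omega, hcq.eq_of_child (Or.inl e.2)⟩,
          decrease_of_ne (l := l + 1) (m := 2 * m + 1) r ε
          fun e => hlm ⟨by omega, hcq.eq_of_child (Or.inr e.2)⟩]
        refine le_trans ?_ (hf.1.2.2 l hl m hm)
        unfold decrease
        split_ifs <;> linarith
  have := hmin _ hmem
  rw [hρ, T.totalRate_univ_decrease r ε hk hc] at this
  linarith

end GaussTree

theorem rateFun_pos {p q x y : ℝ} (hp : 0 < p) (hq : 0 ≤ q) (hx : 0 < x) (hy : 0 ≤ y) :
    0 < rateFun p q x y := by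
  have h1 := mul_nonneg hq (one_sub_exp_nonneg hy)
  have h2 : 0 < 1 - Real.exp (-2 * x) := by
    have : Real.exp (-2 * x) < 1 := by rw [Real.exp_lt_one_iff]; linarith
    linarith
  have h3 := mul_pos hp h2
  have := Real.log_pos (show 1 < 1 + p * (1 - Real.exp (-2 * x)) + q * (1 - Real.exp (-2 * y)) by
    linarith)
  unfold rateFun; linarith

namespace GaussTree

variable {K : ℕ} (T : GaussTree K)

/-! ### Uncrossing tight sets -/

/-- The sum of the restricted rates over the subtree rooted at the node `(k, i)`. -/
noncomputable def subtreeRate (S : Finset (Leaf K)) (r : ℕ → ℕ → ℝ) (k i : ℕ) : ℝ :=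
  subtreeSum (T.restrictedFun S r) (K - k) k i

theorem subtreeRate_root (S : Finset (Leaf K)) (r : ℕ → ℕ → ℝ) :
    T.subtreeRate S r 0 0 = T.totalRate S r := by
  rw [subtreeRate, Nat.sub_zero, subtreeSum_root, totalRate]

theorem subtreeRate_eq {S : Finset (Leaf K)} (r : ℕ → ℕ → ℝ) {k i c q : ℕ} (hk : k < K)
    (hcq : IsChildPair i c q) : T.subtreeRate S r k i
      = T.restrictedFun S r k i + T.subtreeRate S r (k + 1) c + T.subtreeRate S r (k + 1) q := by
  unfold subtreeRate
  have e : K - k = K - (k + 1) + 1 := by omega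
  rw [e, subtreeSum]
  rcases hcq with ⟨rfl, rfl⟩ | ⟨rfl, rfl⟩
  · rfl
  · ring

theorem subtreeRate_congr {S S' : Finset (Leaf K)} (r : ℕ → ℕ → ℝ) :
    ∀ k ≤ K, ∀ i < 2 ^ k, (∀ j ∈ below K k i, j ∈ S ↔ j ∈ S') →
      T.subtreeRate S r k i = T.subtreeRate S' r k i := by
  apply node_induction
  · intro i _ h
    simp only [subtreeRate, Nat.sub_self, subtreeSum]
    exact T.restrictedFun_congr_set r le_rfl h
  · intro k hk i hi h1 h2 h
    have hcq : IsChildPair i (2 * i) (2 * i + 1) := Or.inl ⟨rfl, rfl⟩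
    rw [T.subtreeRate_eq r hk hcq, T.subtreeRate_eq r hk hcq, T.restrictedFun_congr_set r hk.le h,
      h1 fun j hj => h j ((mem_below_iff_child hk).mpr (Or.inl hj)),
      h2 fun j hj => h j ((mem_below_iff_child hk).mpr (Or.inr hj))]

/-- The sum of the rates of the observations below the node `(k, i)` that are not in `S`. -/
def weightOff (R : Leaf K → ℝ) (S : Finset (Leaf K)) (k i : ℕ) : ℝ :=
  ∑ j ∈ below K k i \ S, R j

theorem weightOff_root (R : Leaf K → ℝ) (S : Finset (Leaf K)) :
    weightOff R S 0 0 = ∑ j ∈ Sᶜ, R j := by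
  rw [weightOff, below_root, Finset.compl_eq_univ_sdiff]

theorem weightOff_eq (R : Leaf K → ℝ) (S : Finset (Leaf K)) {k i c q : ℕ} (hk : k < K)
    (hcq : IsChildPair i c q) :
    weightOff R S k i = weightOff R S (k + 1) c + weightOff R S (k + 1) q := by
  rw [weightOff, hcq.below_eq hk, Finset.union_sdiff_distrib, Finset.sum_union]
  · rfl
  · exact (hcq.disjoint k).mono Finset.sdiff_subset Finset.sdiff_subset

theorem weightOff_congr (R : Leaf K → ℝ) {S S' : Finset (Leaf K)} {k i : ℕ}
    (h : ∀ j ∈ below K k i, j ∈ S ↔ j ∈ S') : weightOff R S k i = weightOff R S' k i := by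
  unfold weightOff
  congr 1
  ext j
  simp only [Finset.mem_sdiff]
  exact and_congr_right fun hj => not_congr (h j hj)

theorem weightOff_of_subset (R : Leaf K → ℝ) {S : Finset (Leaf K)} {k i : ℕ}
    (h : below K k i ⊆ S) : weightOff R S k i = 0 := by
  rw [weightOff, Finset.sdiff_eq_empty_iff_subset.mpr h, Finset.sum_empty]

/-- Two tight sets `A`, `B` and two sets `S`, `S'` that contradict the tightness within the
subtree of the node `(k, i)`. -/
def HasCrossing (R : Leaf K → ℝ) (r : ℕ → ℕ → ℝ) (k i : ℕ) : Prop :=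
  ∃ A B S S' : Finset (Leaf K), T.IsTight R r A ∧ T.IsTight R r B
    ∧ ¬ below K k i ⊆ A ∧ ¬ below K k i ⊆ B
    ∧ weightOff R S k i + weightOff R S' k i ≤ weightOff R A k i + weightOff R B k i
    ∧ T.subtreeRate S r k i + T.subtreeRate S' r k i
      < T.subtreeRate A r k i + T.subtreeRate B r k i
    ∧ ((T.restrictedFun S r k i ≤ T.restrictedFun A r k i
        ∧ T.restrictedFun S' r k i ≤ T.restrictedFun B r k i)
      ∨ (T.restrictedFun S' r k i ≤ T.restrictedFun A r k i
        ∧ T.restrictedFun S' r k i ≤ T.restrictedFun B r k i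
        ∧ T.restrictedFun S r k i + T.restrictedFun S' r k i
          ≤ T.restrictedFun A r k i + T.restrictedFun B r k i))

/-- Adding the two tight equalities for A and B and comparing with the sum of the constraints for S
and S' gives F_A + F_B ≤ F_S + F_{S'}, against the strict inequality of the crossing. -/
theorem not_hasCrossing_root {R : Leaf K → ℝ} {d : ℝ} {r : ℕ → ℕ → ℝ}
    (hr : r ∈ T.feasibleRates R d) : ¬ T.HasCrossing R r 0 0 := by
  rintro ⟨A, B, S, S', hA, hB, -, -, hw, hs, -⟩
  simp only [weightOff_root, subtreeRate_root] at hw hs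
  have h1 := hr.2 S
  have h2 := hr.2 S'
  unfold IsTight at hA hB
  linarith

/-- The set that agrees with `S` below the node `(k, c)` and with `X` elsewhere. -/
def glue (k c : ℕ) (S X : Finset (Leaf K)) : Finset (Leaf K) :=
  S ∩ below K k c ∪ X \ below K k c

theorem mem_glue_of_mem {k c : ℕ} {S X : Finset (Leaf K)} {j : Leaf K} (hj : j ∈ below K k c) :
    j ∈ glue k c S X ↔ j ∈ S := by
  simp [glue, hj]

theorem mem_glue_of_notMem {k c : ℕ} {S X : Finset (Leaf K)} {j : Leaf K}
    (hj : j ∉ below K k c) : j ∈ glue k c S X ↔ j ∈ X := by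
  simp [glue, hj]

/-- At a node inside S this is the node constraint on r; at all other nodes it is the recursion,
with equality. -/
theorem restrictedFun_le_rateFun {d : ℝ} {r : ℕ → ℕ → ℝ} (hr : r ∈ T.noiseRates d)
    (S : Finset (Leaf K)) {k i c q : ℕ} (hk : k < K) (hi : i < 2 ^ k) (hcq : IsChildPair i c q) :
    T.restrictedFun S r k i ≤ rateFun (T.coef k i c) (T.coef k i q)
      (T.restrictedFun S r (k + 1) c) (T.restrictedFun S r (k + 1) q) := by
  by_cases hS : below K k i ⊆ S
  · have hS' := hS
    rw [hcq.below_eq hk, Finset.union_subset_iff] at hS'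
    rw [T.restrictedFun_of_subset r hk.le hS, T.restrictedFun_of_subset r hk hS'.1,
      T.restrictedFun_of_subset r hk hS'.2, ← hcq.nodeFun_eq T k (r (k + 1))]
    exact hr.2.2 k hk i hi
  · exact (hcq.restrictedFun_eq T hk hi r hS).le

/-- Below c the replacement sets S, S' are kept; on the sibling's side they are continued by A and B
in one of the two orders, so that the sums there are unchanged. The values at the parent do not
increase in total: by monotonicity if S, S' are dominated by A, B at c, and otherwise by
submodularity, with S' paired with the set that is smaller on the sibling. One of the two
alternatives for the values is recovered at the parent. -/
theorem HasCrossing.parent {R : Leaf K → ℝ} {d : ℝ} {r : ℕ → ℕ → ℝ}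
    (hr : r ∈ T.noiseRates d) {k i c q : ℕ} (hk : k < K) (hi : i < 2 ^ k)
    (hcq : IsChildPair i c q) (h : T.HasCrossing R r (k + 1) c) : T.HasCrossing R r k i := by
  obtain ⟨A, B, S, S', hA, hB, hfA, hfB, hw, hs, hDM⟩ := h
  have hfA' : ¬ below K k i ⊆ A := fun hh => hfA <| by
    rw [hcq.below_eq hk, Finset.union_subset_iff] at hh; exact hh.1
  have hfB' : ¬ below K k i ⊆ B := fun hh => hfB <| by
    rw [hcq.below_eq hk, Finset.union_subset_iff] at hh; exact hh.1
  obtain ⟨hc, hq⟩ := hcq.lt hi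
  have hp0 := T.coef_nonneg k i c
  have hq0 := T.coef_nonneg k i q
  set g := rateFun (T.coef k i c) (T.coef k i q) with hg
  set φ := fun S => T.restrictedFun S r (k + 1) c with hφ
  set ψ := fun S => T.restrictedFun S r (k + 1) q with hψ
  have hφ0 : ∀ S, 0 ≤ φ S := fun S => T.restrictedFun_nonneg S hr.1 _ hk _ hc
  have hψ0 : ∀ S, 0 ≤ ψ S := fun S => T.restrictedFun_nonneg S hr.1 _ hk _ hq
  have hmono : ∀ {x y x' y' : ℝ}, 0 ≤ x → 0 ≤ y → x ≤ x' → y ≤ y' → g x y ≤ g x' y' :=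
    fun h1 h2 h3 h4 => rateFun_mono hp0 hq0 h1 h2 h3 h4
  -- Equality, because A and B miss a leaf below the node. This is why a crossing records that
  -- neither contains all these leaves.
  have hgA : T.restrictedFun A r k i = g (φ A) (ψ A) := hcq.restrictedFun_eq T hk hi r hfA'
  have hgB : T.restrictedFun B r k i = g (φ B) (ψ B) := hcq.restrictedFun_eq T hk hi r hfB'
  have hq_notMem : ∀ j ∈ below K (k + 1) q, j ∉ below K (k + 1) c := fun j hj hjc =>
    Finset.disjoint_left.mp (hcq.disjoint k) hjc hj
  -- U and V are the new sets below c, and X, Y are A, B in some order on the sibling's side. The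
  -- last premise is the alternative required at the parent, stated for the upper bounds g(φ, ψ) of
  -- the glued values.
  have build : ∀ U V X Y : Finset (Leaf K),
      weightOff R U (k + 1) c + weightOff R V (k + 1) c
        ≤ weightOff R A (k + 1) c + weightOff R B (k + 1) c →
      T.subtreeRate U r (k + 1) c + T.subtreeRate V r (k + 1) c
        < T.subtreeRate A r (k + 1) c + T.subtreeRate B r (k + 1) c →
      (X = A ∧ Y = B ∨ X = B ∧ Y = A) →
      ((g (φ U) (ψ X) ≤ g (φ A) (ψ A) ∧ g (φ V) (ψ Y) ≤ g (φ B) (ψ B))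
        ∨ (g (φ V) (ψ Y) ≤ g (φ A) (ψ A) ∧ g (φ V) (ψ Y) ≤ g (φ B) (ψ B)
          ∧ g (φ U) (ψ X) + g (φ V) (ψ Y) ≤ g (φ A) (ψ A) + g (φ B) (ψ B))) →
      T.HasCrossing R r k i := by
    intro U V X Y hW hT hXY hG
    -- Only an upper bound: the glued set may contain all leaves below the node.
    have hval : ∀ U X, T.restrictedFun (glue (k + 1) c U X) r k i ≤ g (φ U) (ψ X) := by
      intro U X
      refine (T.restrictedFun_le_rateFun hr _ hk hi hcq).trans_eq ?_
      rw [T.restrictedFun_congr_set r hk fun j hj => mem_glue_of_mem (S := U) (X := X) hj,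
        T.restrictedFun_congr_set r hk
          fun j hj => mem_glue_of_notMem (S := U) (X := X) (hq_notMem j hj)]
    have hwt : ∀ U X, weightOff R (glue (k + 1) c U X) k i
        = weightOff R U (k + 1) c + weightOff R X (k + 1) q := by
      intro U X
      rw [weightOff_eq R _ hk hcq, weightOff_congr R fun j hj => mem_glue_of_mem hj,
        weightOff_congr R fun j hj => mem_glue_of_notMem (hq_notMem j hj)]
    have htt : ∀ U X, T.subtreeRate (glue (k + 1) c U X) r k i
        = T.restrictedFun (glue (k + 1) c U X) r k i + T.subtreeRate U r (k + 1) c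
          + T.subtreeRate X r (k + 1) q := by
      intro U X
      rw [T.subtreeRate_eq r hk hcq,
        T.subtreeRate_congr r _ hk _ hc fun j hj => mem_glue_of_mem (S := U) (X := X) hj,
        T.subtreeRate_congr r _ hk _ hq
          fun j hj => mem_glue_of_notMem (S := U) (X := X) (hq_notMem j hj)]
    have v1 := hval U X
    have v2 := hval V Y
    have hsum : T.restrictedFun (glue (k + 1) c U X) r k i
        + T.restrictedFun (glue (k + 1) c V Y) r k i
        ≤ T.restrictedFun A r k i + T.restrictedFun B r k i := by
      rw [hgA, hgB]
      rcases hG with ⟨h1, h2⟩ | ⟨h1, h2, h3⟩ <;> linarith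
    refine ⟨A, B, glue (k + 1) c U X, glue (k + 1) c V Y, hA, hB, hfA', hfB', ?_, ?_, ?_⟩
    · rw [hwt, hwt, weightOff_eq R A hk hcq, weightOff_eq R B hk hcq]
      rcases hXY with ⟨rfl, rfl⟩ | ⟨rfl, rfl⟩ <;> linarith
    · rw [htt, htt, T.subtreeRate_eq (S := A) r hk hcq, T.subtreeRate_eq (S := B) r hk hcq]
      rcases hXY with ⟨rfl, rfl⟩ | ⟨rfl, rfl⟩ <;> linarith
    · rw [hgA, hgB] at *
      rcases hG with ⟨h1, h2⟩ | ⟨h1, h2, h3⟩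
      · exact Or.inl ⟨by linarith, by linarith⟩
      · exact Or.inr ⟨by linarith, by linarith, by linarith⟩
  have dominated : ∀ U V : Finset (Leaf K),
      weightOff R U (k + 1) c + weightOff R V (k + 1) c
        ≤ weightOff R A (k + 1) c + weightOff R B (k + 1) c →
      T.subtreeRate U r (k + 1) c + T.subtreeRate V r (k + 1) c
        < T.subtreeRate A r (k + 1) c + T.subtreeRate B r (k + 1) c →
      φ U ≤ φ A → φ V ≤ φ B → T.HasCrossing R r k i := fun U V hW hT h1 h2 =>
    build U V A B hW hT (Or.inl ⟨rfl, rfl⟩)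
      (Or.inl ⟨hmono (hφ0 _) (hψ0 _) h1 le_rfl, hmono (hφ0 _) (hψ0 _) h2 le_rfl⟩)
  rcases hDM with ⟨h1, h2⟩ | ⟨h1, h2, h3⟩
  · exact dominated S S' hw hs h1 h2
  · by_cases c1 : φ S ≤ φ A
    · exact dominated S S' hw hs c1 h2
    by_cases c2 : φ S ≤ φ B
    · exact dominated S' S (by linarith) (by linarith) h1 c2
    -- S' has the smaller value at c. Combined with the smaller of ψ A and ψ B it forms the meet in
    -- the submodular inequality, and S receives the larger one.
    rcases le_total (ψ A) (ψ B) with h | h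
    · exact build S S' B A hw hs (Or.inr ⟨rfl, rfl⟩) (Or.inr
        ⟨hmono (hφ0 _) (hψ0 _) h1 le_rfl, hmono (hφ0 _) (hψ0 _) h2 h,
          rateFun_submodular hp0 hq0 (hφ0 _) (hφ0 _) (hψ0 _) (hψ0 _) h1 h2 h3 le_rfl h
            (add_comm _ _).le⟩)
    · exact build S S' A B hw hs (Or.inl ⟨rfl, rfl⟩) (Or.inr
        ⟨hmono (hφ0 _) (hψ0 _) h1 h, hmono (hφ0 _) (hψ0 _) h2 le_rfl,
          rateFun_submodular hp0 hq0 (hφ0 _) (hφ0 _) (hψ0 _) (hψ0 _) h1 h2 h3 h le_rfl le_rfl⟩)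

/-- A crossing anywhere climbs through the parents to the root, where it is impossible. -/
theorem not_hasCrossing {R : Leaf K → ℝ} {d : ℝ} {r : ℕ → ℕ → ℝ}
    (hr : r ∈ T.feasibleRates R d) (k : ℕ) : k ≤ K → ∀ i < 2 ^ k, ¬ T.HasCrossing R r k i := by
  induction k with
  | zero =>
    intro _ i hi
    obtain rfl : i = 0 := by simpa using hi
    exact T.not_hasCrossing_root hr
  | succ k ih =>
    intro hk i hi h
    have hi' : i / 2 < 2 ^ k := by rw [pow_succ] at hi; omega
    rcases Nat.even_or_odd' i with ⟨m, hm | hm⟩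
    · exact ih (by omega) (i / 2) hi' (HasCrossing.parent T hr.1 hk hi' (q := 2 * (i / 2) + 1)
        (Or.inl ⟨by omega, rfl⟩) h)
    · exact ih (by omega) (i / 2) hi' (HasCrossing.parent T hr.1 hk hi' (q := 2 * (i / 2))
        (Or.inr ⟨by omega, rfl⟩) h)

/-! ### Equality at the nodes of a minimal family. -/

/-- The constraint of the node `(k, i)` holds with equality. -/
def IsEqualityNode (r : ℕ → ℕ → ℝ) (k i : ℕ) : Prop :=
  r k i = T.nodeFun k i (r (k + 1) (2 * i)) (r (k + 1) (2 * i + 1))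

/-- With equality, r obeys the same recursion as f^S but starts from leaf rates that are at least as
large; the node functions are increasing. -/
theorem restrictedFun_le_of_equality {r : ℕ → ℕ → ℝ} (hr : r ∈ nonnegRates K) {k₀ : ℕ}
    (heq : ∀ k, k₀ ≤ k → k < K → ∀ i < 2 ^ k, T.IsEqualityNode r k i) (S : Finset (Leaf K)) :
    ∀ k ≤ K, ∀ i < 2 ^ k, k₀ ≤ k → T.restrictedFun S r k i ≤ r k i := by
  apply node_induction
  · intro i hi _
    by_cases hS : below K K i ⊆ S
    · exact (T.restrictedFun_of_subset r le_rfl hS).le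
    · rw [T.restrictedFun_leaf_of_notMem r hS]; exact hr K le_rfl i hi
  · intro k hk i hi h1 h2 hk0
    by_cases hS : below K k i ⊆ S
    · exact (T.restrictedFun_of_subset r hk.le hS).le
    · rw [T.restrictedFun_of_not_subset r hk hi hS, heq k hk0 hk i hi]
      exact rateFun_mono (T.coef_nonneg ..) (T.coef_nonneg ..)
        (T.restrictedFun_nonneg S hr _ hk _ (child_lt hi).1)
        (T.restrictedFun_nonneg S hr _ hk _ (child_lt hi).2) (h1 (by omega)) (h2 (by omega))

/-- A positive rate of the child with a nonzero coefficient would make the parent's rate positive;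
with coefficient zero it could be lowered freely, against minimality. -/
theorem IsMinimalRates.child_eq_zero {R : Leaf K → ℝ} {d : ℝ} {r : ℕ → ℕ → ℝ}
    (hr : T.IsMinimalRates R d r) {k i c q : ℕ} (hk : k < K) (hi : i < 2 ^ k)
    (hcq : IsChildPair i c q) (heq : T.IsEqualityNode r k i) (h0 : r k i = 0) :
    r (k + 1) c = 0 := by
  by_contra hne
  have hn := hcq.lt hi
  have hpos : 0 < r (k + 1) c := lt_of_le_of_ne (hr.1.1.1 _ hk _ hn.1) (Ne.symm hne)
  by_cases hcoef : T.coef k i c = 0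
  · obtain ⟨S, -, -, -, h⟩ := IsMinimalRates.exists_tight T hr hk hi hcq hpos (Or.inr hcoef)
    exact h hcoef
  · have hp : 0 < T.coef k i c := lt_of_le_of_ne (T.coef_nonneg ..) (Ne.symm hcoef)
    have := rateFun_pos hp (T.coef_nonneg k i q) hpos (hr.1.1.1 _ hk _ hn.2)
    rw [IsEqualityNode, hcq.nodeFun_eq T k (r (k + 1))] at heq
    linarith

theorem IsMinimalRates.subtreeRate_eq_zero {R : Leaf K → ℝ} {d : ℝ} {r : ℕ → ℕ → ℝ}
    (hr : T.IsMinimalRates R d r) {k₀ : ℕ}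
    (heq : ∀ k, k₀ ≤ k → k < K → ∀ i < 2 ^ k, T.IsEqualityNode r k i) (S : Finset (Leaf K)) :
    ∀ k ≤ K, ∀ i < 2 ^ k, k₀ ≤ k → r k i = 0 → T.subtreeRate S r k i = 0 := by
  have hz : ∀ k ≤ K, ∀ i < 2 ^ k, k₀ ≤ k → r k i = 0 → T.restrictedFun S r k i = 0 :=
    fun k hk i hi h0 h => le_antisymm
      ((T.restrictedFun_le_of_equality hr.1.1.1 heq S k hk i hi h0).trans_eq h)
      (T.restrictedFun_nonneg S hr.1.1.1 k hk i hi)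
  apply node_induction
  · intro i hi hk0 h
    simp only [subtreeRate, Nat.sub_self, subtreeSum]
    exact hz K le_rfl i hi hk0 h
  · intro k hk i hi h1 h2 hk0 h
    have hcq : IsChildPair i (2 * i) (2 * i + 1) := Or.inl ⟨rfl, rfl⟩
    rw [T.subtreeRate_eq r hk hcq, hz k hk.le i hi hk0 h,
      h1 (by omega) (IsMinimalRates.child_eq_zero T hr hk hi hcq (heq k hk0 hk i hi) h),
      h2 (by omega) (IsMinimalRates.child_eq_zero T hr hk hi hcq.symm (heq k hk0 hk i hi) h)]
    simp

/-- In a minimal family of rates all constraints of the inner nodes hold with equality. -/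
theorem IsMinimalRates.isEqualityNode {R : Leaf K → ℝ} {d : ℝ} {r : ℕ → ℕ → ℝ}
    (hr : T.IsMinimalRates R d r) (hR : ∀ j, 0 ≤ R j) :
    ∀ k < K, ∀ i < 2 ^ k, T.IsEqualityNode r k i := by
  suffices ∀ k₀ ≤ K, ∀ k, k₀ ≤ k → k < K → ∀ i < 2 ^ k, T.IsEqualityNode r k i from
    fun k hk => this k hk.le k le_rfl hk
  intro k₀ hk₀
  induction hk₀ using Nat.decreasingInduction with
  | self => intro k h1 h2; omega
  | of_succ k hk heq =>
    intro l hl hlK i hi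
    rcases hl.eq_or_lt with rfl | hl
    swap
    · exact heq l hl hlK i hi
    by_contra hne
    have hslack := lt_of_le_of_ne (hr.1.1.2.2 k hk i hi) hne
    have hle := fun S => T.restrictedFun_le_of_equality hr.1.1.1 heq S
    -- A child of rate zero has no blocking tight set, so this case needs its own argument. Here the
    -- sibling is positive, and its tight set S has at the node the full value g(0, r q), which
    -- exceeds r k i.
    have case_zero : ∀ c q, IsChildPair i c q → r (k + 1) c = 0 → False := by
      intro c q hcq hc0
      obtain ⟨hc, hq⟩ := hcq.lt hi
      have hq0 : 0 < r (k + 1) q := by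
        refine lt_of_le_of_ne (hr.1.1.1 _ hk _ hq) fun h => ?_
        have h1 := hr.1.1.1 k hk.le i hi
        rw [hcq.nodeFun_eq T k (r (k + 1)), hc0, ← h, rateFun_zero_zero] at hslack
        linarith
      obtain ⟨S, hS, hqS, hcS, -⟩ :=
        IsMinimalRates.exists_tight T hr hk hi hcq.symm hq0 (Or.inl hslack)
      have hfS : ¬ below K k i ⊆ S := fun hh => hcS <| by
        rw [hcq.below_eq hk, Finset.union_subset_iff] at hh; exact hh.1
      have hφc : T.restrictedFun S r (k + 1) c = 0 :=
        le_antisymm ((hle S _ hk _ hc le_rfl).trans_eq hc0)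
          (T.restrictedFun_nonneg S hr.1.1.1 _ hk _ hc)
      have hval : r k i < T.restrictedFun S r k i := by
        rw [hcq.nodeFun_eq T k (r (k + 1)), hc0] at hslack
        rwa [hcq.restrictedFun_eq T hk hi r hfS, hφc, T.restrictedFun_of_subset r hk hqS]
      have huniv : T.restrictedFun Finset.univ r k i = r k i :=
        T.restrictedFun_of_subset r hk.le (Finset.subset_univ _)
      have hq_eq : T.subtreeRate Finset.univ r (k + 1) q = T.subtreeRate S r (k + 1) q :=
        T.subtreeRate_congr r _ hk _ hq fun j hj => by simp [hqS hj]
      -- Adding to S all leaves below the node lowers the value there to r k i, changes nothing in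
      -- the two subtrees, and uncovers no weight.
      refine T.not_hasCrossing hr.1 k hk.le i hi
        ⟨S, S, Finset.univ, S, hS, hS, hfS, hfS, ?_, ?_, Or.inl ⟨?_, le_rfl⟩⟩
      · rw [weightOff_of_subset R (Finset.subset_univ _)]
        have : 0 ≤ weightOff R S k i := Finset.sum_nonneg fun j _ => hR j
        linarith
      · rw [T.subtreeRate_eq (S := Finset.univ) r hk hcq, T.subtreeRate_eq (S := S) r hk hcq,
          IsMinimalRates.subtreeRate_eq_zero T hr heq _ _ hk _ hc le_rfl hc0,
          IsMinimalRates.subtreeRate_eq_zero T hr heq _ _ hk _ hc le_rfl hc0, huniv, hq_eq]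
        linarith
      · rw [huniv]; exact hval.le
    have hcq : IsChildPair i (2 * i) (2 * i + 1) := Or.inl ⟨rfl, rfl⟩
    obtain ⟨hc, hq⟩ := hcq.lt hi
    have hc0 : 0 < r (k + 1) (2 * i) :=
      lt_of_le_of_ne (hr.1.1.1 _ hk _ hc) fun h => case_zero _ _ hcq h.symm
    have hq0 : 0 < r (k + 1) (2 * i + 1) :=
      lt_of_le_of_ne (hr.1.1.1 _ hk _ hq) fun h => case_zero _ _ hcq.symm h.symm
    obtain ⟨A, hA, hcA, hqA, -⟩ := IsMinimalRates.exists_tight T hr hk hi hcq hc0 (Or.inl hslack)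
    obtain ⟨B, hB, hqB, hcB, -⟩ :=
      IsMinimalRates.exists_tight T hr hk hi hcq.symm hq0 (Or.inl hslack)
    have hfA : ¬ below K k i ⊆ A := fun hh => hqA <| by
      rw [hcq.below_eq hk, Finset.union_subset_iff] at hh; exact hh.2
    have hfB : ¬ below K k i ⊆ B := fun hh => hcB <| by
      rw [hcq.below_eq hk, Finset.union_subset_iff] at hh; exact hh.1
    have hfAB : ¬ below K k i ⊆ A ∩ B := fun hh => hfA (hh.trans Finset.inter_subset_left)
    have hcAB : ∀ j ∈ below K (k + 1) (2 * i), j ∈ A ∩ B ↔ j ∈ B := fun j hj => by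
      simp [hcA hj]
    have hqAB : ∀ j ∈ below K (k + 1) (2 * i + 1), j ∈ A ∩ B ↔ j ∈ A := fun j hj => by
      simp [hqB hj]
    have vA := hcq.restrictedFun_eq T hk hi r hfA
    have vB := hcq.restrictedFun_eq T hk hi r hfB
    have vAB := hcq.restrictedFun_eq T hk hi r hfAB
    rw [T.restrictedFun_of_subset r hk hcA] at vA
    rw [T.restrictedFun_of_subset r hk hqB] at vB
    rw [T.restrictedFun_congr_set r hk hcAB, T.restrictedFun_congr_set r hk hqAB] at vAB
    have huniv : T.restrictedFun Finset.univ r k i = r k i :=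
      T.restrictedFun_of_subset r hk.le (Finset.subset_univ _)
    have n1 := T.restrictedFun_nonneg B hr.1.1.1 _ hk _ hc
    have n2 := T.restrictedFun_nonneg A hr.1.1.1 _ hk _ hq
    have l1 := hle B _ hk _ hc le_rfl
    have l2 := hle A _ hk _ hq le_rfl
    have p1 := T.coef_nonneg k i (2 * i)
    have p2 := T.coef_nonneg k i (2 * i + 1)
    -- The joins are the rates of the two children and the meets are the values of B at the first
    -- child and of A at the second.
    have hsub := rateFun_submodular p1 p2 hc0.le n1 hq0.le n2 l1 le_rfl le_rfl le_rfl l2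
      (add_comm _ _).le
    rw [nodeFun_eq] at hslack
    -- Below the node the full set is the union of A and B. Its value is r k i, strictly less than
    -- the node function of the children's rates, which makes the submodular inequality strict.
    refine T.not_hasCrossing hr.1 k hk.le i hi
      ⟨A, B, Finset.univ, A ∩ B, hA, hB, hfA, hfB, ?_, ?_, Or.inr ⟨?_, ?_, ?_⟩⟩
    · rw [weightOff_of_subset R (Finset.subset_univ _), weightOff_eq R _ hk hcq,
        weightOff_congr R hcAB, weightOff_congr R hqAB, weightOff_eq R A hk hcq,
        weightOff_eq R B hk hcq, weightOff_of_subset R hcA, weightOff_of_subset R hqB]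
      linarith
    · have e1 : T.subtreeRate Finset.univ r (k + 1) (2 * i) = T.subtreeRate A r (k + 1) (2 * i) :=
        T.subtreeRate_congr r _ hk _ hc fun j hj => by simp [hcA hj]
      have e2 : T.subtreeRate Finset.univ r (k + 1) (2 * i + 1)
          = T.subtreeRate B r (k + 1) (2 * i + 1) :=
        T.subtreeRate_congr r _ hk _ hq fun j hj => by simp [hqB hj]
      rw [T.subtreeRate_eq (S := Finset.univ) r hk hcq, T.subtreeRate_eq (S := A) r hk hcq,
        T.subtreeRate_eq (S := B) r hk hcq, T.subtreeRate_eq (S := A ∩ B) r hk hcq,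
        T.subtreeRate_congr r _ hk _ hc hcAB, T.subtreeRate_congr r _ hk _ hq hqAB, e1, e2, huniv,
        vA, vB, vAB]
      linarith
    · rw [vA, vAB]; exact rateFun_mono p1 p2 n1 n2 l1 le_rfl
    · rw [vB, vAB]; exact rateFun_mono p1 p2 n1 n2 le_rfl l2
    · rw [huniv, vA, vB, vAB]; linarith

end GaussTree

/-! ### Gaussian integrals -/

/-- The variance of a centred Gaussian variable of variance `v` after an observation of
precision `l`. -/
noncomputable def postVar (v : ℝ≥0) (l : ℝ) : ℝ≥0 := (v / (1 + v * l)).toNNReal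

theorem coe_postVar (v : ℝ≥0) {l : ℝ} (hl : 0 ≤ l) : (postVar v l : ℝ) = v / (1 + v * l) :=
  Real.coe_toNNReal _ (by positivity)

theorem postVar_pos {v : ℝ≥0} (hv : 0 < v) {l : ℝ} (hl : 0 ≤ l) : 0 < postVar v l := by
  rw [← NNReal.coe_pos, coe_postVar v hl]
  have : (0 : ℝ) < v := hv
  positivity

/-- Completing the square. The prior precision 1/v and the likelihood precision l add, and the
leftover constant is the normalization of the message. -/
theorem gaussianPDFReal_mul_exp {v : ℝ≥0} (hv : 0 < v) {l : ℝ} (hl : 0 ≤ l) (m b t : ℝ) :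
    gaussianPDFReal m v t * Real.exp (b * t - l * t ^ 2 / 2)
      = Real.exp (-(Real.log (1 + v * l) / 2)
          + (b * m + v * b ^ 2 / 2 - l * m ^ 2 / 2) / (1 + v * l))
        * gaussianPDFReal ((m + v * b) / (1 + v * l)) (postVar v l) t := by
  have hv' : (0 : ℝ) < v := hv
  have hd : 0 < 1 + v * l := by positivity
  rw [gaussianPDFReal_def, gaussianPDFReal_def, coe_postVar v hl, Real.exp_add, Real.exp_neg,
    ← Real.log_sqrt hd.le, Real.exp_log (Real.sqrt_pos.mpr hd)]
  have h1 : Real.sqrt (2 * Real.pi * (v / (1 + v * l)))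
      = Real.sqrt (2 * Real.pi * v) / Real.sqrt (1 + v * l) := by
    rw [← mul_div_assoc, Real.sqrt_div (by positivity)]
  rw [h1]
  have e : -(t - m) ^ 2 / (2 * v) + (b * t - l * t ^ 2 / 2)
      = (b * m + v * b ^ 2 / 2 - l * m ^ 2 / 2) / (1 + v * l)
        + -(t - (m + v * b) / (1 + v * l)) ^ 2 / (2 * (v / (1 + v * l))) := by
    field_simp
    ring
  have hs1 : Real.sqrt (1 + v * l) ≠ 0 := (Real.sqrt_pos.mpr hd).ne'
  have hs2 : Real.sqrt (2 * Real.pi * v) ≠ 0 := (Real.sqrt_pos.mpr (by positivity)).ne'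
  calc (Real.sqrt (2 * Real.pi * v))⁻¹ * Real.exp (-(t - m) ^ 2 / (2 * v))
        * Real.exp (b * t - l * t ^ 2 / 2)
      = (Real.sqrt (2 * Real.pi * v))⁻¹
        * Real.exp (-(t - m) ^ 2 / (2 * v) + (b * t - l * t ^ 2 / 2)) := by
          rw [Real.exp_add]; ring
    _ = _ := by
          rw [e, Real.exp_add]
          field_simp

/-- Integration against the likelihood of an observation of precision `l`. -/
theorem lintegral_gaussianReal_mul_exp {v : ℝ≥0} (hv : 0 < v) {l : ℝ} (hl : 0 ≤ l) (m b : ℝ)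
    {G : ℝ → ℝ≥0∞} (hG : Measurable G) :
    ∫⁻ t, G t * ENNReal.ofReal (Real.exp (b * t - l * t ^ 2 / 2)) ∂gaussianReal m v
      = ENNReal.ofReal (Real.exp (-(Real.log (1 + v * l) / 2)
          + (b * m + v * b ^ 2 / 2 - l * m ^ 2 / 2) / (1 + v * l)))
        * ∫⁻ t, G t ∂gaussianReal ((m + v * b) / (1 + v * l)) (postVar v l) := by
  rw [gaussianReal_of_var_ne_zero _ hv.ne', gaussianReal_of_var_ne_zero _ (postVar_pos hv hl).ne',
    lintegral_withDensity_eq_lintegral_mul _ (measurable_gaussianPDF _ _) (by fun_prop),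
    lintegral_withDensity_eq_lintegral_mul _ (measurable_gaussianPDF _ _) hG,
    ← lintegral_const_mul _ (by fun_prop)]
  refine lintegral_congr fun t => ?_
  have := congrArg ENNReal.ofReal (gaussianPDFReal_mul_exp hv hl m b t)
  rw [ENNReal.ofReal_mul (gaussianPDFReal_nonneg _ _ _),
    ENNReal.ofReal_mul (Real.exp_pos _).le] at this
  simp only [Pi.mul_apply, gaussianPDF]
  calc _ = ENNReal.ofReal (gaussianPDFReal m v t)
        * ENNReal.ofReal (Real.exp (b * t - l * t ^ 2 / 2)) * G t := by ring
    _ = _ := by rw [this]; ring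

/-- In an integral over a product of probability spaces, factors that depend on distinct
coordinates are integrated out. -/
theorem lintegral_pi_mul_prod {ι J : Type*} [Fintype ι] [DecidableEq ι] {X : ι → Type*}
    [∀ i, MeasurableSpace (X i)] (μ : ∀ i, Measure (X i)) [∀ i, IsProbabilityMeasure (μ i)]
    (e : J → ι) (s : Finset J) {f F : J → (∀ i, X i) → ℝ≥0∞}
    (hfm : ∀ a, Measurable (f a)) (hFm : ∀ a, Measurable (F a))
    (hf : ∀ a b, b ≠ a → ∀ ω t, f b (Function.update ω (e a) t) = f b ω)
    (hF : ∀ a b ω t, F b (Function.update ω (e a) t) = F b ω)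
    (hint : ∀ a ω, ∫⁻ t, f a (Function.update ω (e a) t) ∂μ (e a) = F a ω) :
    ∀ G : (∀ i, X i) → ℝ≥0∞, Measurable G →
      (∀ a ω t, G (Function.update ω (e a) t) = G ω) →
      ∫⁻ ω, G ω * ∏ a ∈ s, f a ω ∂Measure.pi μ = ∫⁻ ω, G ω * ∏ a ∈ s, F a ω ∂Measure.pi μ := by
  classical
  induction s using Finset.induction_on with
  | empty => intro G _ _; simp
  | insert a s ha ih =>
    intro G hG hGu
    simp only [Finset.prod_insert ha]
    have hs : Measurable fun ω => ∏ b ∈ s, f b ω := Finset.measurable_fun_prod _ fun b _ => hfm b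
    -- Integrate over the coordinate of a alone; all other factors are constant in it.
    have step : ∫⁻ ω, G ω * (f a ω * ∏ b ∈ s, f b ω) ∂Measure.pi μ
        = ∫⁻ ω, (G ω * F a ω) * ∏ b ∈ s, f b ω ∂Measure.pi μ := by
      refine lintegral_eq_of_lmarginal_eq {e a} (hG.mul ((hfm a).mul hs))
        ((hG.mul (hFm a)).mul hs) (funext fun ω => ?_)
      rw [lmarginal_singleton, lmarginal_singleton]
      have hp : ∀ t, ∏ b ∈ s, f b (Function.update ω (e a) t) = ∏ b ∈ s, f b ω := fun t =>
        Finset.prod_congr rfl fun b hb => hf a b (fun h => ha (h ▸ hb)) ω t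
      simp only [hGu, hF, hp]
      rw [lintegral_const, measure_univ, mul_one, ← hint a ω]
      have : ∀ t, G ω * (f a (Function.update ω (e a) t) * ∏ b ∈ s, f b ω)
          = (G ω * ∏ b ∈ s, f b ω) * f a (Function.update ω (e a) t) := fun t => by ring
      simp only [this]
      have hm : Measurable fun t => f a (Function.update ω (e a) t) :=
        (hfm a).comp (measurable_update ω)
      rw [lintegral_const_mul _ hm]
      ring
    rw [step, ih (fun ω => G ω * F a ω) (hG.mul (hFm a)) fun b ω t => by rw [hGu, hF]]
    refine lintegral_congr fun ω => by ring

/-- The change of variables by a translation of a product of centred Gaussian measures. -/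
theorem lintegral_pi_gaussianReal_translate {ι : Type*} [Fintype ι] {s : ι → ℝ≥0}
    (hs : ∀ j, 0 < s j) (z : ι → ℝ) {F : (ι → ℝ) → ℝ≥0∞} (hF : Measurable F) :
    ∫⁻ y, F (z + y) ∂(Measure.pi fun j => gaussianReal 0 (s j))
      = ∫⁻ y, F y * ENNReal.ofReal (Real.exp (∑ j, (z j / s j * y j - z j ^ 2 / (2 * s j))))
        ∂(Measure.pi fun j => gaussianReal 0 (s j)) := by
  classical
  have h1 : (Measure.pi fun j => gaussianReal 0 (s j)).map (fun y => z + y)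
      = Measure.pi fun j => gaussianReal (z j) (s j) := by
    have := Measure.pi_map_pi (μ := fun j => gaussianReal 0 (s j)) (f := fun j y => z j + y)
      fun j => by fun_prop
    simp only [gaussianReal_map_const_add, zero_add] at this
    exact this
  -- The density factors over the coordinates, so it suffices to compare one-dimensional Gaussian
  -- densities on boxes.
  have h2 : (Measure.pi fun j => gaussianReal 0 (s j)).withDensity
      (fun y => ENNReal.ofReal (Real.exp (∑ j, (z j / s j * y j - z j ^ 2 / (2 * s j)))))
      = Measure.pi fun j => gaussianReal (z j) (s j) := by
    symm
    refine Measure.pi_eq fun A hA => ?_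
    rw [withDensity_apply _ (MeasurableSet.univ_pi hA), ← lintegral_indicator
      (MeasurableSet.univ_pi hA)]
    set D : ι → ℝ → ℝ≥0∞ := fun j y =>
      ENNReal.ofReal (Real.exp (z j / s j * y - z j ^ 2 / (2 * s j))) with hD
    have hDm : ∀ j, Measurable (D j) := fun j => by fun_prop
    have e1 : ∀ y : ι → ℝ, (Set.univ.pi A).indicator (fun y => ENNReal.ofReal
        (Real.exp (∑ j, (z j / s j * y j - z j ^ 2 / (2 * s j))))) y
        = 1 * ∏ j ∈ Finset.univ, (A j).indicator (D j) (y j) := by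
      intro y
      rw [one_mul]
      by_cases hy : y ∈ Set.univ.pi A
      · rw [Set.indicator_of_mem hy, Real.exp_sum,
          ENNReal.ofReal_prod_of_nonneg fun _ _ => (Real.exp_pos _).le]
        exact Finset.prod_congr rfl fun j _ => by
          rw [Set.indicator_of_mem (hy j trivial)]
      · rw [Set.indicator_of_notMem hy]
        simp only [Set.mem_univ_pi, not_forall] at hy
        obtain ⟨j, hj⟩ := hy
        exact (Finset.prod_eq_zero (Finset.mem_univ j) (Set.indicator_of_notMem hj _)).symm
    simp only [e1]
    rw [lintegral_pi_mul_prod (fun j => gaussianReal 0 (s j)) id Finset.univ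
      (f := fun j y => (A j).indicator (D j) (y j))
      (F := fun j _ => gaussianReal (z j) (s j) (A j))
      (fun j => ((hDm j).indicator (hA j)).comp (measurable_pi_apply j)) (fun _ => measurable_const)
      (fun a b hb ω t => by simp [Function.update_of_ne hb]) (fun _ _ _ _ => rfl) ?_
      (fun _ => 1) measurable_const fun _ _ _ => rfl]
    · simp
    · intro j ω
      simp only [id_eq, Function.update_self]
      rw [lintegral_indicator (hA j), ← withDensity_apply _ (hA j)]
      congr 1
      have hv := (hs j).ne'
      have hv' : (s j : ℝ) ≠ 0 := by exact_mod_cast hv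
      rw [gaussianReal_of_var_ne_zero _ hv, gaussianReal_of_var_ne_zero _ hv,
        ← withDensity_mul _ (measurable_gaussianPDF _ _) (hDm j)]
      congr 1
      funext y
      simp only [Pi.mul_apply, gaussianPDF, hD, gaussianPDFReal_def]
      rw [← ENNReal.ofReal_mul (by positivity), mul_assoc, ← Real.exp_add]
      congr 3
      field_simp
      ring
  rw [← lintegral_map hF (by fun_prop), h1, ← h2,
    lintegral_withDensity_eq_lintegral_mul _ (by fun_prop) hF]
  exact lintegral_congr fun y => by simp [mul_comm]

theorem sum_range_two_mul (n : ℕ) (f : ℕ → ℝ) : ∑ i ∈ Finset.range (2 * n), f i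
    = ∑ i ∈ Finset.range n, (f (2 * i) + f (2 * i + 1)) := by
  induction n with
  | zero => simp
  | succ n ih =>
    rw [Nat.mul_succ, Finset.sum_range_succ, Finset.sum_range_succ, ih, Finset.sum_range_succ]
    ring

namespace GaussTree

variable {K : ℕ} (T : GaussTree K)

/-! ### The source -/

@[fun_prop]
theorem measurable_noise (k i : ℕ) : Measurable (noise (K := K) k i) := by
  unfold noise
  split_ifs <;> fun_prop

@[fun_prop]
theorem measurable_source : ∀ k i : ℕ, Measurable (T.source k i)
  | 0, i => measurable_noise 0 i
  | k + 1, i => ((measurable_source k (i / 2)).const_mul _).add (measurable_noise (k + 1) i)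

theorem noise_update_self (ω : Node K → ℝ) (v : Node K) (t : ℝ) :
    noise v.1 v.2 (Function.update ω v t) = t := by
  have h : (v.1 : ℕ) < K + 1 ∧ (v.2 : ℕ) < 2 ^ (v.1 : ℕ) := ⟨v.1.2, v.2.2⟩
  rw [noise, dif_pos h]
  exact Function.update_self ..

theorem noise_update_of_ne (ω : Node K → ℝ) (v : Node K) (t : ℝ) {k i : ℕ}
    (h : ¬ (k = v.1 ∧ i = v.2)) : noise k i (Function.update ω v t) = noise k i ω := by
  unfold noise
  split_ifs with hk
  · refine Function.update_of_ne ?_ _ _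
    rintro rfl
    exact h ⟨rfl, rfl⟩
  · rfl

theorem source_update_of_lt (ω : Node K → ℝ) (v : Node K) (t : ℝ) : ∀ {k i : ℕ}, k < v.1 →
    T.source k i (Function.update ω v t) = T.source k i ω
  | 0, i, h => noise_update_of_ne ω v t (by omega)
  | k + 1, i, h => by
    rw [source, source, source_update_of_lt ω v t (by omega), noise_update_of_ne ω v t (by omega)]

theorem source_update_of_ne (ω : Node K → ℝ) (v : Node K) (t : ℝ) {i : ℕ} (h : i ≠ v.2) :
    T.source v.1 i (Function.update ω v t) = T.source v.1 i ω := by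
  rcases hv : (v.1 : ℕ) with _ | k
  · exact noise_update_of_ne ω v t (by omega)
  · rw [source, source, T.source_update_of_lt ω v t (by omega),
      noise_update_of_ne ω v t (by omega)]

/-! ### Message passing -/

/-- The precision of the likelihood of the node `(k, i)`, given the precisions `c` of the
likelihoods of the observations; recursion on the height. -/
noncomputable def precisionAux (c : ℕ → ℝ) : ℕ → ℕ → ℕ → ℝ
  | 0, _, i => c i
  | h + 1, k, i =>
    T.gain (k + 1) (2 * i) ^ 2 * precisionAux c h (k + 1) (2 * i)
        / (1 + T.noiseVar (k + 1) (2 * i) * precisionAux c h (k + 1) (2 * i))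
      + T.gain (k + 1) (2 * i + 1) ^ 2 * precisionAux c h (k + 1) (2 * i + 1)
        / (1 + T.noiseVar (k + 1) (2 * i + 1) * precisionAux c h (k + 1) (2 * i + 1))

/-- The precision of the likelihood of the node `(k, i)`. -/
noncomputable def precision (c : ℕ → ℝ) (k i : ℕ) : ℝ := T.precisionAux c (K - k) k i

theorem precision_leaf (c : ℕ → ℝ) (i : ℕ) : T.precision c K i = c i := by
  rw [precision, Nat.sub_self, precisionAux]

/-- The precision of the message from the node `(k, i)` to its parent. -/
noncomputable def edgePrecision (c : ℕ → ℝ) (k i : ℕ) : ℝ :=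
  T.gain k i ^ 2 * T.precision c k i / (1 + T.noiseVar k i * T.precision c k i)

theorem precision_node (c : ℕ → ℝ) {k : ℕ} (hk : k < K) (i : ℕ) : T.precision c k i
    = T.edgePrecision c (k + 1) (2 * i) + T.edgePrecision c (k + 1) (2 * i + 1) := by
  have e : K - k = K - (k + 1) + 1 := by omega
  rw [precision, e, precisionAux]
  rfl

theorem precision_nonneg {c : ℕ → ℝ} (hc : ∀ i < 2 ^ K, 0 ≤ c i) :
    ∀ k ≤ K, ∀ i < 2 ^ k, 0 ≤ T.precision c k i := by
  apply node_induction
  · intro i hi; rw [precision_leaf]; exact hc i hi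
  · intro k hk i hi h1 h2
    rw [T.precision_node c hk, edgePrecision, edgePrecision]
    positivity

/-- The natural parameter of the likelihood of the node `(k, i)`, given the precisions `c` and
the natural parameters `b` of the likelihoods of the observations; recursion on the height. -/
noncomputable def naturalAux (c b : ℕ → ℝ) : ℕ → ℕ → ℕ → ℝ
  | 0, _, i => b i
  | h + 1, k, i =>
    T.gain (k + 1) (2 * i) * naturalAux c b h (k + 1) (2 * i)
        / (1 + T.noiseVar (k + 1) (2 * i) * T.precision c (k + 1) (2 * i))
      + T.gain (k + 1) (2 * i + 1) * naturalAux c b h (k + 1) (2 * i + 1)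
        / (1 + T.noiseVar (k + 1) (2 * i + 1) * T.precision c (k + 1) (2 * i + 1))

/-- The natural parameter of the likelihood of the node `(k, i)`. -/
noncomputable def natural (c b : ℕ → ℝ) (k i : ℕ) : ℝ := T.naturalAux c b (K - k) k i

theorem natural_leaf (c b : ℕ → ℝ) (i : ℕ) : T.natural c b K i = b i := by
  rw [natural, Nat.sub_self, naturalAux]

/-- The natural parameter of the message from the node `(k, i)` to its parent. -/
noncomputable def edgeNatural (c b : ℕ → ℝ) (k i : ℕ) : ℝ :=
  T.gain k i * T.natural c b k i / (1 + T.noiseVar k i * T.precision c k i)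

theorem natural_node (c b : ℕ → ℝ) {k : ℕ} (hk : k < K) (i : ℕ) : T.natural c b k i
    = T.edgeNatural c b (k + 1) (2 * i) + T.edgeNatural c b (k + 1) (2 * i + 1) := by
  have e : K - k = K - (k + 1) + 1 := by omega
  rw [natural, e, naturalAux]
  rfl

/-- The logarithm of the normalization of the message from the node `(k, i)` to its parent. -/
noncomputable def logNorm (c b : ℕ → ℝ) (k i : ℕ) : ℝ :=
  -(Real.log (1 + T.noiseVar k i * T.precision c k i) / 2)
    + T.noiseVar k i * T.natural c b k i ^ 2 / 2 / (1 + T.noiseVar k i * T.precision c k i)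

/-- The logarithm of the likelihood of the sources at level `k`. -/
noncomputable def logLik (c b : ℕ → ℝ) (k : ℕ) (ω : Node K → ℝ) : ℝ :=
  ∑ i : Fin (2 ^ k), (T.natural c b k i * T.source k i ω
    - T.precision c k i * T.source k i ω ^ 2 / 2)

@[fun_prop]
theorem measurable_logLik (c b : ℕ → ℝ) (k : ℕ) : Measurable (T.logLik c b k) := by
  unfold logLik; fun_prop

/-- Grouping the edges by their parent: the messages of two siblings multiply, so their parameters
add up to those of the parent. -/
theorem sum_edge_eq (c b : ℕ → ℝ) {k : ℕ} (hk : k < K) (ω : Node K → ℝ) :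
    ∑ i : Fin (2 ^ (k + 1)), (T.logNorm c b (k + 1) i
      + (T.edgeNatural c b (k + 1) i * T.source k (i / 2) ω
        - T.edgePrecision c (k + 1) i * T.source k (i / 2) ω ^ 2 / 2))
    = ∑ i : Fin (2 ^ (k + 1)), T.logNorm c b (k + 1) i + T.logLik c b k ω := by
  rw [Finset.sum_add_distrib, logLik]
  congr 1
  rw [Fin.sum_univ_eq_sum_range (fun i => T.edgeNatural c b (k + 1) i * T.source k (i / 2) ω
        - T.edgePrecision c (k + 1) i * T.source k (i / 2) ω ^ 2 / 2) (2 ^ (k + 1)),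
    Fin.sum_univ_eq_sum_range (fun i => T.natural c b k i * T.source k i ω
    - T.precision c k i * T.source k i ω ^ 2 / 2) (2 ^ k), pow_succ, mul_comm]
  rw [sum_range_two_mul]
  refine Finset.sum_congr rfl fun i _ => ?_
  rw [T.natural_node c b hk, T.precision_node c hk, show 2 * i / 2 = i by omega,
    show (2 * i + 1) / 2 = i by omega]
  ring

instance instIsProbabilityMeasureNoiseLaw : IsProbabilityMeasure T.noiseLaw := by
  unfold noiseLaw; infer_instance

/-- Integrating out the noises at level `k + 1`. -/
theorem lintegral_logLik_succ (hT : T.PosNoise) {c : ℕ → ℝ} (hc : ∀ i < 2 ^ K, 0 ≤ c i)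
    (b : ℕ → ℝ) {k : ℕ} (hk : k < K) {G : ℝ → ℝ≥0∞} (hG : Measurable G) :
    ∫⁻ ω, G (T.source 0 0 ω) * ENNReal.ofReal (Real.exp (T.logLik c b (k + 1) ω)) ∂T.noiseLaw
      = ENNReal.ofReal (Real.exp (∑ i : Fin (2 ^ (k + 1)), T.logNorm c b (k + 1) i))
        * ∫⁻ ω, G (T.source 0 0 ω) * ENNReal.ofReal (Real.exp (T.logLik c b k ω))
          ∂T.noiseLaw := by
  let e : Fin (2 ^ (k + 1)) → Node K := fun i => ⟨⟨k + 1, by omega⟩, i⟩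
  let f : Fin (2 ^ (k + 1)) → (Node K → ℝ) → ℝ≥0∞ := fun i ω => ENNReal.ofReal (Real.exp
    (T.natural c b (k + 1) i * T.source (k + 1) i ω
      - T.precision c (k + 1) i * T.source (k + 1) i ω ^ 2 / 2))
  let F : Fin (2 ^ (k + 1)) → (Node K → ℝ) → ℝ≥0∞ := fun i ω => ENNReal.ofReal (Real.exp
    (T.logNorm c b (k + 1) i + (T.edgeNatural c b (k + 1) i * T.source k (i / 2) ω
        - T.edgePrecision c (k + 1) i * T.source k (i / 2) ω ^ 2 / 2)))
  have key := lintegral_pi_mul_prod (fun v : Node K => gaussianReal 0 (T.noiseVar v.1 v.2)) e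
    Finset.univ (f := f) (F := F) (fun a => by fun_prop) (fun a => by fun_prop)
    (fun i j hij ω t => by
      have : T.source (k + 1) j (Function.update ω (e i) t) = T.source (k + 1) j ω :=
        T.source_update_of_ne ω (e i) t (i := j) fun h => hij (Fin.ext h)
      simp only [f, this])
    (fun i j ω t => by
      have : T.source k (j / 2) (Function.update ω (e i) t) = T.source k (j / 2) ω :=
        T.source_update_of_lt ω (e i) t (Nat.lt_succ_self k)
      simp only [F, this])
    (fun i ω => by
      have h1 : ∀ t, T.source (k + 1) i (Function.update ω (e i) t)
          = T.gain (k + 1) i * T.source k (i / 2) ω + t := fun t => by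
        rw [source, T.source_update_of_lt ω (e i) t (Nat.lt_succ_self k)]
        congr 1
        exact noise_update_self ω (e i) t
      simp only [f, F, h1]
      set m := T.gain (k + 1) i * T.source k (i / 2) ω with hm
      have hp := T.precision_nonneg hc (k + 1) hk i i.2
      have h2 := lintegral_gaussianReal_mul_exp (hT (k + 1) hk i i.2) hp m
        (T.natural c b (k + 1) i) (G := fun _ => 1) measurable_const
      simp only [one_mul, lintegral_const, measure_univ, mul_one] at h2
      have h3 : gaussianReal m (T.noiseVar (k + 1) i)
          = (gaussianReal 0 (T.noiseVar (k + 1) i)).map (fun t => m + t) := by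
        rw [gaussianReal_map_const_add, zero_add]
      rw [h3, lintegral_map (by fun_prop) (by fun_prop)] at h2
      refine h2.trans ?_
      congr 2
      rw [logNorm, edgeNatural, edgePrecision, hm]
      have : (0 : ℝ) < 1 + T.noiseVar (k + 1) i * T.precision c (k + 1) i := by positivity
      field_simp
      ring)
    (fun ω => G (T.source 0 0 ω)) (by fun_prop)
    (fun i ω t => by rw [T.source_update_of_lt ω (e i) t (Nat.succ_pos k)])
  have hf : ∀ ω, ENNReal.ofReal (Real.exp (T.logLik c b (k + 1) ω)) = ∏ i, f i ω := fun ω => by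
    rw [logLik, Real.exp_sum, ENNReal.ofReal_prod_of_nonneg fun _ _ => (Real.exp_pos _).le]
  have hF : ∀ ω, ENNReal.ofReal (Real.exp (∑ i : Fin (2 ^ (k + 1)), T.logNorm c b (k + 1) i))
      * ENNReal.ofReal (Real.exp (T.logLik c b k ω)) = ∏ i, F i ω := fun ω => by
    rw [← ENNReal.ofReal_mul (Real.exp_pos _).le, ← Real.exp_add, ← T.sum_edge_eq c b hk,
      Real.exp_sum, ENNReal.ofReal_prod_of_nonneg fun _ _ => (Real.exp_pos _).le]
  simp only [hf]
  rw [← lintegral_const_mul _ (by fun_prop)]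
  refine key.trans (lintegral_congr fun ω => ?_)
  rw [← hF]
  ring

/-- The logarithm of the marginal likelihood. -/
noncomputable def logMarginal (c b : ℕ → ℝ) : ℝ :=
  ∑ k ∈ Finset.range (K + 1), ∑ i ∈ Finset.range (2 ^ k), T.logNorm c b k i

/-- The unnormalized posterior law of the root. -/
theorem lintegral_logLik (hT : T.PosNoise) {c : ℕ → ℝ} (hc : ∀ i < 2 ^ K, 0 ≤ c i)
    (b : ℕ → ℝ) {G : ℝ → ℝ≥0∞} (hG : Measurable G) :
    ∫⁻ ω, G (T.source 0 0 ω) * ENNReal.ofReal (Real.exp (T.logLik c b K ω)) ∂T.noiseLaw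
      = ENNReal.ofReal (Real.exp (T.logMarginal c b))
        * ∫⁻ t, G t ∂gaussianReal (postVar (T.noiseVar 0 0) (T.precision c 0 0)
            * T.natural c b 0 0) (postVar (T.noiseVar 0 0) (T.precision c 0 0)) := by
  -- The induction removes the levels from the bottom: integrating out level k + 1 turns its
  -- likelihood into that of level k times a constant. At level 0 only the Gaussian prior of the
  -- root is left.
  have main : ∀ k ≤ K,
      ∫⁻ ω, G (T.source 0 0 ω) * ENNReal.ofReal (Real.exp (T.logLik c b k ω)) ∂T.noiseLaw
      = ENNReal.ofReal (Real.exp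
          (∑ l ∈ Finset.range (k + 1), ∑ i ∈ Finset.range (2 ^ l), T.logNorm c b l i))
        * ∫⁻ t, G t ∂gaussianReal (postVar (T.noiseVar 0 0) (T.precision c 0 0)
            * T.natural c b 0 0) (postVar (T.noiseVar 0 0) (T.precision c 0 0)) := by
    intro k
    induction k with
    | zero =>
      intro _
      have hp := T.precision_nonneg hc 0 (Nat.zero_le K) 0 (by simp)
      have h := lintegral_gaussianReal_mul_exp (hT 0 (Nat.zero_le K) 0 (by simp)) hp 0
        (T.natural c b 0 0) hG
      have hmap : T.noiseLaw.map (T.source 0 0) = gaussianReal 0 (T.noiseVar 0 0) := by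
        have := Measure.pi_map_eval (μ := fun v : Node K => gaussianReal 0 (T.noiseVar v.1 v.2))
          ⟨⟨0, Nat.succ_pos K⟩, ⟨0, by simp⟩⟩
        simp only [measure_univ, Finset.prod_const_one, one_smul] at this
        refine Eq.trans ?_ this
        rw [noiseLaw]
        congr 1
      rw [← hmap, lintegral_map (by fun_prop) (by fun_prop)] at h
      have hlog : ∀ ω, T.logLik c b 0 ω = T.natural c b 0 0 * T.source 0 0 ω
          - T.precision c 0 0 * T.source 0 0 ω ^ 2 / 2 := fun ω => by
        rw [logLik, Fin.sum_univ_eq_sum_range (fun i => T.natural c b 0 i * T.source 0 i ω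
          - T.precision c 0 i * T.source 0 i ω ^ 2 / 2) (2 ^ 0)]
        simp
      simp only [hlog]
      rw [h]
      congr 2
      · simp [logNorm]
      · congr 1
        rw [coe_postVar _ hp, zero_add]
        ring
    | succ k ih =>
      intro hk
      rw [T.lintegral_logLik_succ hT hc b hk hG, ih (by omega), ← mul_assoc,
        ← ENNReal.ofReal_mul (Real.exp_pos _).le, ← Real.exp_add,
        Finset.sum_range_succ _ (k + 1), add_comm,
        Fin.sum_univ_eq_sum_range (fun i => T.logNorm c b (k + 1) i)]
  exact main K le_rfl

end GaussTree

/-! ### Conditional mutual information from conditional densities -/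

theorem lintegral_compProd_prodMk {𝓧 𝓨 𝓩 : Type*} [MeasurableSpace 𝓧] [MeasurableSpace 𝓨]
    [MeasurableSpace 𝓩] (μ : Measure 𝓩) [SFinite μ] (κ : Kernel 𝓩 𝓧) [IsSFiniteKernel κ]
    (η : Kernel 𝓩 𝓨) [IsSFiniteKernel η] {F : 𝓩 × 𝓧 × 𝓨 → ℝ≥0∞} (hF : Measurable F) :
    ∫⁻ p, F p ∂(μ ⊗ₘ (κ ×ₖ η)) = ∫⁻ q, ∫⁻ y, F (q.1, q.2, y) ∂η q.1 ∂(μ ⊗ₘ κ) := by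
  rw [Measure.lintegral_compProd hF, Measure.lintegral_compProd]
  · refine lintegral_congr fun z => ?_
    rw [Kernel.prod_apply, lintegral_prod _ (by fun_prop)]
  · have : Measurable fun p : (𝓩 × 𝓧) × 𝓨 => F (p.1.1, p.1.2, p.2) := by fun_prop
    exact this.lintegral_kernel_prod_right' (κ := η.comap Prod.fst measurable_fst)

/-- If, with respect to a measure `ρ`, the conditional law of `Y` given `(Z, X)` has the density
`exp (k X y)`, and that of `Y` given `Z` the density `exp (h Z y)`, then the conditional mutual
information `I(X; Y | Z)` is the expectation of `k X Y - h Z Y`. -/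
theorem condMutualInfo_eq_of_density {Ω 𝓧 𝓨 𝓩 : Type*} [MeasurableSpace Ω]
    [MeasurableSpace 𝓧] [StandardBorelSpace 𝓧] [Nonempty 𝓧]
    [MeasurableSpace 𝓨] [StandardBorelSpace 𝓨] [Nonempty 𝓨] [MeasurableSpace 𝓩]
    {X : Ω → 𝓧} {Y : Ω → 𝓨} {Z : Ω → 𝓩} {P : Measure Ω} [IsProbabilityMeasure P]
    (hX : Measurable X) (hY : Measurable Y) (hZ : Measurable Z)
    {ρ : Measure 𝓨} [SFinite ρ] {k : 𝓧 × 𝓨 → ℝ} {h : 𝓩 × 𝓨 → ℝ}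
    (hk : Measurable k) (hh : Measurable h)
    (hjoint : ∀ F : 𝓩 × 𝓧 × 𝓨 → ℝ≥0∞, Measurable F → ∫⁻ ω, F (Z ω, X ω, Y ω) ∂P
      = ∫⁻ ω, ∫⁻ y, F (Z ω, X ω, y) * ENNReal.ofReal (Real.exp (k (X ω, y))) ∂ρ ∂P)
    (hpair : ∀ F : 𝓩 × 𝓨 → ℝ≥0∞, Measurable F → ∫⁻ ω, F (Z ω, Y ω) ∂P
      = ∫⁻ ω, ∫⁻ y, F (Z ω, y) * ENNReal.ofReal (Real.exp (h (Z ω, y))) ∂ρ ∂P)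
    (hone : ∀ z, ∫⁻ y, ENNReal.ofReal (Real.exp (h (z, y))) ∂ρ = 1)
    (hint : Integrable (fun ω => k (X ω, Y ω) - h (Z ω, Y ω)) P) :
    condMutualInfo X Y Z P = ENNReal.ofReal (∫ ω, k (X ω, Y ω) - h (Z ω, Y ω) ∂P) := by
  let d : 𝓩 → 𝓨 → ℝ≥0∞ := fun z y => ENNReal.ofReal (Real.exp (h (z, y)))
  have hd : Measurable (Function.uncurry d) := by
    change Measurable fun p : 𝓩 × 𝓨 => ENNReal.ofReal (Real.exp (h (p.1, p.2)))
    fun_prop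
  let η : Kernel 𝓩 𝓨 := (Kernel.const 𝓩 ρ).withDensity d
  have hη : ∀ z (F : 𝓨 → ℝ≥0∞), Measurable F →
      ∫⁻ y, F y ∂η z = ∫⁻ y, F y * ENNReal.ofReal (Real.exp (h (z, y))) ∂ρ := fun z F hF => by
    rw [Kernel.lintegral_withDensity _ hd z hF, Kernel.const_apply]
    exact lintegral_congr fun y => mul_comm _ _
  have : IsMarkovKernel η := ⟨fun z => ⟨by
    have := hη z (fun _ => 1) measurable_const
    simp only [lintegral_const, one_mul] at this
    rw [this]; exact hone z⟩⟩
  -- The density of Y given Z is normalized for every z, so it defines a Markov kernel, which is the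
  -- conditional law by uniqueness of disintegrations.
  have hpairKernel : P.map (fun ω => (Z ω, Y ω)) = P.map Z ⊗ₘ η := by
    refine Measure.ext_of_lintegral _ fun F hF => ?_
    rw [lintegral_map hF (hZ.prodMk hY), Measure.lintegral_compProd hF,
      lintegral_map hF.lintegral_kernel_prod_right' hZ, hpair F hF]
    exact lintegral_congr fun ω => (hη (Z ω) (fun y => F (Z ω, y)) (by fun_prop)).symm
  have hcond : condDistrib Y Z P =ᵐ[P.map Z] η :=
    condDistrib_ae_eq_of_measure_eq_compProd Z hY.aemeasurable hpairKernel
  set μ := P.map fun ω => (Z ω, (X ω, Y ω)) with hμ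
  set ν := P.map Z ⊗ₘ (condDistrib X Z P ×ₖ condDistrib Y Z P) with hν
  have : IsProbabilityMeasure (P.map Z) := Measure.isProbabilityMeasure_map hZ.aemeasurable
  have : IsProbabilityMeasure μ :=
    Measure.isProbabilityMeasure_map (hZ.prodMk (hX.prodMk hY)).aemeasurable
  have hν' : ν = P.map Z ⊗ₘ (condDistrib X Z P ×ₖ η) := by
    refine Measure.compProd_congr ?_
    filter_upwards [hcond] with z hz
    rw [Kernel.prod_apply, Kernel.prod_apply, hz]
  -- The conditional law of X given Z is never computed; it recombines with the law of Z to the law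
  -- of (Z, X).
  have hνint : ∀ F : 𝓩 × 𝓧 × 𝓨 → ℝ≥0∞, Measurable F → ∫⁻ p, F p ∂ν
      = ∫⁻ ω, ∫⁻ y, F (Z ω, X ω, y) * ENNReal.ofReal (Real.exp (h (Z ω, y))) ∂ρ ∂P := by
    intro F hF
    have hm : Measurable fun q : 𝓩 × 𝓧 => ∫⁻ y, F (q.1, q.2, y) ∂η q.1 := by
      have : Measurable fun p : (𝓩 × 𝓧) × 𝓨 => F (p.1.1, p.1.2, p.2) := by fun_prop
      exact this.lintegral_kernel_prod_right' (κ := η.comap Prod.fst measurable_fst)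
    rw [hν', lintegral_compProd_prodMk _ _ _ hF, compProd_map_condDistrib hX.aemeasurable,
      lintegral_map hm (hZ.prodMk hX)]
    exact lintegral_congr fun ω => hη (Z ω) (fun y => F (Z ω, X ω, y)) (by fun_prop)
  let L : 𝓩 × 𝓧 × 𝓨 → ℝ := fun p => k (p.2.1, p.2.2) - h (p.1, p.2.2)
  have hL : Measurable L := by fun_prop
  let D : 𝓩 × 𝓧 × 𝓨 → ℝ≥0∞ := fun p => ENNReal.ofReal (Real.exp (L p))
  have hD : Measurable D := by fun_prop
  have hdens : μ = ν.withDensity D := by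
    refine Measure.ext_of_lintegral _ fun F hF => ?_
    rw [lintegral_map hF (hZ.prodMk (hX.prodMk hY)), hjoint F hF,
      lintegral_withDensity_eq_lintegral_mul _ hD hF, hνint _ (hD.mul hF)]
    refine lintegral_congr fun ω => lintegral_congr fun y => ?_
    simp only [Pi.mul_apply, D, L]
    rw [mul_comm _ (F _), mul_assoc, ← ENNReal.ofReal_mul (Real.exp_pos _).le, ← Real.exp_add,
      sub_add_cancel]
  have hac : μ ≪ ν := hdens ▸ withDensity_absolutelyContinuous ν D
  have hllr : llr μ ν =ᵐ[μ] L := by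
    have h1 : μ.rnDeriv ν =ᵐ[ν] D := by
      rw [hdens]; exact Measure.rnDeriv_withDensity ν hD
    filter_upwards [hac.ae_le h1] with p hp
    rw [llr, hp, ENNReal.toReal_ofReal (Real.exp_pos _).le, Real.log_exp]
  have hLint : Integrable L μ := by
    rw [hμ, integrable_map_measure hL.aestronglyMeasurable
      (hZ.prodMk (hX.prodMk hY)).aemeasurable]
    exact hint
  have hllrint : Integrable (llr μ ν) μ := (integrable_congr hllr).mpr hLint
  have : IsProbabilityMeasure ν := by rw [hν']; infer_instance
  rw [condMutualInfo, klDiv_of_ac_of_integrable hac hllrint, integral_congr_ae hllr,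
    probReal_univ, probReal_univ, add_sub_cancel_right, hμ,
    integral_map (hZ.prodMk (hX.prodMk hY)).aemeasurable hL.aestronglyMeasurable]

/-! ### Splitting a product measure -/

/-- The two parts of a point of a product, with the coordinates in `A` and off `A`. -/
theorem map_restrict_compl_restrict {ι : Type*} [Fintype ι] [DecidableEq ι]
    (μ : ι → Measure ℝ) [∀ i, IsProbabilityMeasure (μ i)] (A : Finset ι) :
    (Measure.pi μ).map (fun y => ((fun j : ↥Aᶜ => y j), (fun j : A => y j)))
      = (Measure.pi fun j : ↥Aᶜ => μ j).prod (Measure.pi fun j : A => μ j) := by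
  have hind : iIndepFun (fun i (y : ι → ℝ) => y i) (Measure.pi μ) :=
    iIndepFun_pi (X := fun _ => id) fun _ => aemeasurable_id
  have h := (hind.indepFun_finset Aᶜ A disjoint_compl_left fun i => measurable_pi_apply i)
  have hm : ∀ B : Finset ι, Measurable fun (y : ι → ℝ) (j : B) => y j := fun B =>
    measurable_pi_lambda _ fun j => measurable_pi_apply _
  have h' := (indepFun_iff_map_prod_eq_prod_map_map (hm _).aemeasurable (hm _).aemeasurable).mp h
  refine h'.trans ?_
  have hmap : ∀ B : Finset ι, (Measure.pi μ).map (fun y (j : B) => y j)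
      = Measure.pi fun j : B => μ j := by
    intro B
    have hB := iIndepFun.precomp (g := ((↑) : B → ι)) Subtype.val_injective hind
    have := (iIndepFun_iff_map_fun_eq_pi_map
      (f := fun (j : B) (y : ι → ℝ) => y j) fun j => (measurable_pi_apply _).aemeasurable).mp hB
    rw [this]
    congr 1
    funext j
    have := Measure.pi_map_eval (μ := μ) (j : ι)
    simpa using this
  rw [hmap, hmap]

/-- The point with the coordinates `y` in `A` and `z` off `A`. -/
def mergeOn {ι : Type*} [Fintype ι] [DecidableEq ι] (A : Finset ι) (z : ↥Aᶜ → ℝ) (y : A → ℝ)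
    (j : ι) : ℝ :=
  if h : j ∈ A then y ⟨j, h⟩ else z ⟨j, Finset.mem_compl.mpr h⟩

theorem mergeOn_restrict {ι : Type*} [Fintype ι] [DecidableEq ι] (A : Finset ι) (y : ι → ℝ) :
    mergeOn A (fun j => y j) (fun j => y j) = y := by
  funext j; simp [mergeOn]

@[fun_prop]
theorem measurable_mergeOn {ι : Type*} [Fintype ι] [DecidableEq ι] (A : Finset ι) :
    Measurable fun p : (↥Aᶜ → ℝ) × (A → ℝ) => mergeOn A p.1 p.2 := by
  refine measurable_pi_lambda _ fun j => ?_
  unfold mergeOn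
  split_ifs <;> fun_prop

theorem lintegral_pi_split {ι : Type*} [Fintype ι] [DecidableEq ι]
    (μ : ι → Measure ℝ) [∀ i, IsProbabilityMeasure (μ i)] (A : Finset ι)
    {F : (↥Aᶜ → ℝ) → (A → ℝ) → ℝ≥0∞} (hF : Measurable fun p : (↥Aᶜ → ℝ) × (A → ℝ) => F p.1 p.2) :
    ∫⁻ y, F (fun j => y j) (fun j => y j) ∂Measure.pi μ
      = ∫⁻ z, ∫⁻ y, F z y ∂(Measure.pi fun j : A => μ j) ∂(Measure.pi fun j : ↥Aᶜ => μ j) := by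
  have h := lintegral_map (μ := Measure.pi μ) hF
    (show Measurable fun y : ι → ℝ => ((fun j : ↥Aᶜ => y j), (fun j : A => y j)) by fun_prop)
  rw [map_restrict_compl_restrict, lintegral_prod _ hF.aemeasurable] at h
  exact h.symm

namespace GaussTree

variable {K : ℕ} (T : GaussTree K)

/-! ### The joint law of the source and the auxiliary variables -/

/-- The variance of the test-channel noise of the observation `j`. -/
noncomputable def testVar (a : Leaf K → ℝ) (j : Leaf K) : ℝ≥0 :=
  ((1 - a j ^ 2) * T.obsVar j).toNNReal

/-- The joint law of the test-channel noises in `B`. -/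
noncomputable def testNoiseLaw (a : Leaf K → ℝ) (B : Finset (Leaf K)) : Measure (B → ℝ) :=
  Measure.pi fun j : B => gaussianReal 0 (T.testVar a j)

instance instIsProbabilityMeasureTestNoiseLaw (a : Leaf K → ℝ) (B : Finset (Leaf K)) :
    IsProbabilityMeasure (T.testNoiseLaw a B) := by
  unfold testNoiseLaw; infer_instance

/-- The joint law of all test-channel noises. -/
noncomputable def testNoise (a : Leaf K → ℝ) : Measure (Leaf K → ℝ) :=
  Measure.pi fun j => gaussianReal 0 (T.testVar a j)

instance instIsProbabilityMeasureTestNoise (a : Leaf K → ℝ) :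
    IsProbabilityMeasure (T.testNoise a) := by
  unfold testNoise; infer_instance

theorem testLaw_eq (a : Leaf K → ℝ) : T.testLaw a = T.noiseLaw.prod (T.testNoise a) := rfl

/-- The precisions of the likelihoods of the observations, when the auxiliary variables in `S` are
given. -/
noncomputable def obsPrecision (a : Leaf K → ℝ) (S : Finset (Leaf K)) (i : ℕ) : ℝ :=
  if h : i < 2 ^ K then (if ⟨i, h⟩ ∈ S then a ⟨i, h⟩ ^ 2 / T.testVar a ⟨i, h⟩ else 0) else 0

/-- The natural parameters of the likelihoods of the observations, when the auxiliary variables in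
`S` have the values `u`. -/
noncomputable def obsNatural (a : Leaf K → ℝ) (S : Finset (Leaf K)) (u : Leaf K → ℝ) (i : ℕ) : ℝ :=
  if h : i < 2 ^ K then (if ⟨i, h⟩ ∈ S then a ⟨i, h⟩ / T.testVar a ⟨i, h⟩ * u ⟨i, h⟩ else 0) else 0

theorem obsPrecision_nonneg (a : Leaf K → ℝ) (S : Finset (Leaf K)) (i : ℕ) :
    0 ≤ T.obsPrecision a S i := by
  unfold obsPrecision; split_ifs <;> positivity

theorem obsPrecision_coe (a : Leaf K → ℝ) (S : Finset (Leaf K)) (j : Leaf K) :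
    T.obsPrecision a S j = if j ∈ S then a j ^ 2 / T.testVar a j else 0 := by
  rw [obsPrecision, dif_pos j.2]

theorem obsNatural_coe (a : Leaf K → ℝ) (S : Finset (Leaf K)) (u : Leaf K → ℝ) (j : Leaf K) :
    T.obsNatural a S u j = if j ∈ S then a j / T.testVar a j * u j else 0 := by
  rw [obsNatural, dif_pos j.2]

theorem obsNatural_congr (a : Leaf K → ℝ) {S : Finset (Leaf K)} {u u' : Leaf K → ℝ}
    (h : ∀ j ∈ S, u j = u' j) : T.obsNatural a S u = T.obsNatural a S u' := by
  funext i
  unfold obsNatural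
  split_ifs with h1 h2
  · rw [h _ h2]
  · rfl
  · rfl

@[fun_prop]
theorem measurable_obsNatural (a : Leaf K → ℝ) (S : Finset (Leaf K)) (i : ℕ) :
    Measurable fun u => T.obsNatural a S u i := by
  unfold obsNatural; split_ifs <;> fun_prop

theorem measurable_naturalAux {α : Type*} [MeasurableSpace α] (c : ℕ → ℝ) {b : α → ℕ → ℝ}
    (hb : ∀ i, Measurable fun x => b x i) (h : ℕ) :
    ∀ k i, Measurable fun x => T.naturalAux c (b x) h k i := by
  induction h with
  | zero => intro k i; exact hb i
  | succ h ih =>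
    intro k i
    simp only [naturalAux]
    exact (((ih _ _).const_mul _).div_const _).add (((ih _ _).const_mul _).div_const _)

@[fun_prop]
theorem measurable_natural_obs (a : Leaf K → ℝ) (S : Finset (Leaf K)) (c : ℕ → ℝ) (k i : ℕ) :
    Measurable fun u => T.natural c (T.obsNatural a S u) k i :=
  T.measurable_naturalAux c (fun i => T.measurable_obsNatural a S i) _ k i

/-- The log-likelihood of the observations `x`, when the auxiliary variables in `S` have the
values `u`. -/
noncomputable def obsLogLik (a : Leaf K → ℝ) (S : Finset (Leaf K)) (x u : Leaf K → ℝ) : ℝ :=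
  ∑ j ∈ S, (a j / T.testVar a j * u j * x j - a j ^ 2 / T.testVar a j * x j ^ 2 / 2)

/-- The logarithm of the marginal likelihood of the values `u` of the auxiliary variables in
`S`. -/
noncomputable def obsLogMarginal (a : Leaf K → ℝ) (S : Finset (Leaf K)) (u : Leaf K → ℝ) : ℝ :=
  T.logMarginal (T.obsPrecision a S) (T.obsNatural a S u)

@[fun_prop]
theorem measurable_obsLogMarginal (a : Leaf K → ℝ) (S : Finset (Leaf K)) :
    Measurable (T.obsLogMarginal a S) := by
  unfold obsLogMarginal logMarginal logNorm
  fun_prop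

theorem obsLogMarginal_congr (a : Leaf K → ℝ) {S : Finset (Leaf K)} {u u' : Leaf K → ℝ}
    (h : ∀ j ∈ S, u j = u' j) : T.obsLogMarginal a S u = T.obsLogMarginal a S u' := by
  rw [obsLogMarginal, T.obsNatural_congr a h, obsLogMarginal]

/-- All observations. -/
def allObs (ω : Node K → ℝ) (j : Leaf K) : ℝ := T.source K j ω

@[fun_prop]
theorem measurable_allObs : Measurable T.allObs :=
  measurable_pi_lambda _ fun j => T.measurable_source K j

/-- A leaf outside S has precision and natural parameter zero and contributes nothing, so one
message-passing scheme serves all S. -/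
theorem logLik_obs (a : Leaf K → ℝ) (S : Finset (Leaf K)) (u : Leaf K → ℝ) (ω : Node K → ℝ) :
    T.logLik (T.obsPrecision a S) (T.obsNatural a S u) K ω = T.obsLogLik a S (T.allObs ω) u := by
  unfold logLik obsLogLik
  rw [← Finset.sum_filter_add_sum_filter_not Finset.univ (· ∈ S)]
  have h0 : ∑ j : Leaf K with j ∉ S, (T.natural (T.obsPrecision a S) (T.obsNatural a S u) K j
      * T.source K j ω - T.precision (T.obsPrecision a S) K j * T.source K j ω ^ 2 / 2) = 0 := by
    refine Finset.sum_eq_zero fun j hj => ?_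
    rw [natural_leaf, precision_leaf, obsPrecision_coe, obsNatural_coe,
      if_neg (Finset.mem_filter.mp hj).2, if_neg (Finset.mem_filter.mp hj).2]
    simp
  rw [h0, add_zero, Finset.filter_mem_eq_inter, Finset.univ_inter]
  refine Finset.sum_congr rfl fun j hj => ?_
  rw [natural_leaf, precision_leaf, obsPrecision_coe, obsNatural_coe, if_pos hj, if_pos hj]
  rfl

theorem measurable_obsLogLik (a : Leaf K → ℝ) (S : Finset (Leaf K)) :
    Measurable fun p : (Leaf K → ℝ) × (Leaf K → ℝ) => T.obsLogLik a S p.1 p.2 := by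
  unfold obsLogLik; fun_prop

@[fun_prop]
theorem measurable_aux (a : Leaf K → ℝ) : Measurable (T.aux a) := by
  refine measurable_pi_lambda _ fun j => ?_
  unfold aux; fun_prop

/-- The joint density of the source noises and the auxiliary variables. -/
theorem lintegral_aux {a : Leaf K → ℝ} (hs : ∀ j, 0 < T.testVar a j)
    {F : (Node K → ℝ) × (Leaf K → ℝ) → ℝ≥0∞} (hF : Measurable F) :
    ∫⁻ ω, F (ω.1, T.aux a ω) ∂T.testLaw a
      = ∫⁻ n, ∫⁻ y, F (n, y) * ENNReal.ofReal
          (Real.exp (T.obsLogLik a Finset.univ (T.allObs n) y)) ∂T.testNoise a ∂T.noiseLaw := by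
  rw [testLaw_eq, lintegral_prod _ (by fun_prop)]
  refine lintegral_congr fun n => ?_
  refine (lintegral_pi_gaussianReal_translate hs (fun j => a j * T.source K j n)
    (F := fun y => F (n, y)) (by fun_prop)).trans (lintegral_congr fun y => ?_)
  congr 3
  refine Finset.sum_congr rfl fun j _ => ?_
  simp only [allObs]
  ring

/-- The posterior law of the root. -/
theorem lintegral_root_aux (hT : T.PosNoise) {a : Leaf K → ℝ} (hs : ∀ j, 0 < T.testVar a j)
    {F : ℝ × (Leaf K → ℝ) → ℝ≥0∞} (hF : Measurable F) :
    ∫⁻ ω, F (T.root ω, T.aux a ω) ∂T.testLaw a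
      = ∫⁻ y, ENNReal.ofReal (Real.exp (T.obsLogMarginal a Finset.univ y))
        * ∫⁻ t, F (t, y) ∂gaussianReal
          (postVar (T.noiseVar 0 0) (T.precision (T.obsPrecision a Finset.univ) 0 0)
            * T.natural (T.obsPrecision a Finset.univ) (T.obsNatural a Finset.univ y) 0 0)
          (postVar (T.noiseVar 0 0) (T.precision (T.obsPrecision a Finset.univ) 0 0))
        ∂T.testNoise a := by
  have hm := T.measurable_obsLogLik a Finset.univ
  refine (T.lintegral_aux hs (F := fun p => F (T.source 0 0 p.1, p.2)) (by fun_prop)).trans ?_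
  rw [lintegral_lintegral_swap]
  · refine lintegral_congr fun y => ?_
    simp only [← T.logLik_obs]
    exact T.lintegral_logLik hT (fun i _ => T.obsPrecision_nonneg a _ i) _
      (G := fun t => F (t, y)) (by fun_prop)
  · have : Measurable fun p : (Node K → ℝ) × (Leaf K → ℝ) =>
        T.obsLogLik a Finset.univ (T.allObs p.1) p.2 :=
      hm.comp (by fun_prop : Measurable fun p : (Node K → ℝ) × (Leaf K → ℝ) => (T.allObs p.1, p.2))
    exact Measurable.aemeasurable (by unfold Function.uncurry; fun_prop)

theorem lintegral_aux_marginal (hT : T.PosNoise) {a : Leaf K → ℝ} (hs : ∀ j, 0 < T.testVar a j)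
    {F : (Leaf K → ℝ) → ℝ≥0∞} (hF : Measurable F) :
    ∫⁻ ω, F (T.aux a ω) ∂T.testLaw a
      = ∫⁻ y, F y * ENNReal.ofReal (Real.exp (T.obsLogMarginal a Finset.univ y))
        ∂T.testNoise a := by
  rw [T.lintegral_root_aux hT hs (F := fun p => F p.2) (by fun_prop)]
  exact lintegral_congr fun y => by simp [mul_comm]

/-- The marginal likelihood as an integral over the source. -/
theorem ofReal_exp_obsLogMarginal (hT : T.PosNoise) (a : Leaf K → ℝ) (S : Finset (Leaf K))
    (u : Leaf K → ℝ) : ENNReal.ofReal (Real.exp (T.obsLogMarginal a S u))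
      = ∫⁻ n, ENNReal.ofReal (Real.exp (T.obsLogLik a S (T.allObs n) u)) ∂T.noiseLaw := by
  have := T.lintegral_logLik hT (fun i _ => T.obsPrecision_nonneg a S i) (T.obsNatural a S u)
    (G := fun _ => 1) measurable_const
  simp only [one_mul, lintegral_const, measure_univ, mul_one, logLik_obs] at this
  exact this.symm

/-- The translation of the test-channel noises in `A`. -/
theorem lintegral_testNoiseLaw_translate {a : Leaf K → ℝ} (hs : ∀ j, 0 < T.testVar a j)
    (A : Finset (Leaf K)) (x : A → ℝ) {F : (A → ℝ) → ℝ≥0∞} (hF : Measurable F) :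
    ∫⁻ y, F (fun j => a j * x j + y j) ∂T.testNoiseLaw a A
      = ∫⁻ y, F y * ENNReal.ofReal (Real.exp (∑ j : A, (a j / T.testVar a j * y j * x j
          - a j ^ 2 / T.testVar a j * x j ^ 2 / 2))) ∂T.testNoiseLaw a A := by
  refine (lintegral_pi_gaussianReal_translate (fun j : A => hs j) (fun j => a j * x j)
    hF).trans (lintegral_congr fun y => ?_)
  congr 3
  exact Finset.sum_congr rfl fun j _ => by ring

/-- The channels are independent given the observations, so the log-likelihood splits. The values y'
are arbitrary, because only coordinates off A are read. -/
theorem obsLogLik_univ_mergeOn (a : Leaf K → ℝ) (A : Finset (Leaf K)) (x : Leaf K → ℝ)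
    (z : ↥Aᶜ → ℝ) (y y' : A → ℝ) : T.obsLogLik a Finset.univ x (mergeOn A z y)
      = T.obsLogLik a Aᶜ x (mergeOn A z y') + ∑ j : A, (a j / T.testVar a j * y j * x j
          - a j ^ 2 / T.testVar a j * x j ^ 2 / 2) := by
  unfold obsLogLik
  rw [← Finset.sum_compl_add_sum A, ← Finset.sum_coe_sort A]
  congr 1
  · refine Finset.sum_congr rfl fun j hj => ?_
    simp [mergeOn, Finset.mem_compl.mp hj]
  · refine Finset.sum_congr rfl fun j _ => ?_
    simp [mergeOn]

theorem obsLogMarginal_compl_mergeOn (a : Leaf K → ℝ) (A : Finset (Leaf K))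
    (z : ↥Aᶜ → ℝ) (y y' : A → ℝ) :
    T.obsLogMarginal a Aᶜ (mergeOn A z y) = T.obsLogMarginal a Aᶜ (mergeOn A z y') :=
  T.obsLogMarginal_congr a fun j hj => by simp [mergeOn, Finset.mem_compl.mp hj]

/-- Integrating out the auxiliary variables in `A`. -/
theorem lintegral_exp_obsLogMarginal (hT : T.PosNoise) {a : Leaf K → ℝ}
    (hs : ∀ j, 0 < T.testVar a j) (A : Finset (Leaf K)) (z : ↥Aᶜ → ℝ) :
    ∫⁻ y, ENNReal.ofReal (Real.exp (T.obsLogMarginal a Finset.univ (mergeOn A z y)))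
        ∂T.testNoiseLaw a A
      = ENNReal.ofReal (Real.exp (T.obsLogMarginal a Aᶜ (mergeOn A z 0))) := by
  have hm := T.measurable_obsLogLik a Finset.univ
  -- With both sides written as integrals over the source, the factor for A is, for fixed source,
  -- the density of a translated probability measure and integrates to 1.
  simp only [T.ofReal_exp_obsLogMarginal hT]
  rw [lintegral_lintegral_swap]
  · refine lintegral_congr fun n => ?_
    simp only [T.obsLogLik_univ_mergeOn a A _ z _ 0, Real.exp_add,
      ENNReal.ofReal_mul (Real.exp_pos _).le]
    rw [lintegral_const_mul _ (by fun_prop)]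
    have := T.lintegral_testNoiseLaw_translate hs A (fun j => T.allObs n j) (F := fun _ => 1)
      measurable_const
    simp only [lintegral_const, measure_univ, mul_one, one_mul] at this
    rw [← this, mul_one]
  · have h2 : Measurable fun p : (A → ℝ) × (Node K → ℝ) => (T.allObs p.2, mergeOn A z p.1) :=
      (by fun_prop : Measurable fun p : (A → ℝ) × (Node K → ℝ) => T.allObs p.2).prodMk
        ((measurable_mergeOn A).comp (by fun_prop :
          Measurable fun p : (A → ℝ) × (Node K → ℝ) => (z, p.1)))
    have := hm.comp h2
    exact (ENNReal.measurable_ofReal.comp (Real.measurable_exp.comp this)).aemeasurable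

@[fun_prop]
theorem measurable_obs (A : Finset (Leaf K)) : Measurable (T.obs A) := by
  refine measurable_pi_lambda _ fun j => ?_
  unfold obs; fun_prop

@[fun_prop]
theorem measurable_auxOn (a : Leaf K → ℝ) (A : Finset (Leaf K)) : Measurable (T.auxOn a A) := by
  refine measurable_pi_lambda _ fun j => ?_
  exact (measurable_pi_apply (j : Leaf K)).comp (T.measurable_aux a)

/-- The information density between the observations and the auxiliary variables in `S`. -/
noncomputable def infoDensity (a : Leaf K → ℝ) (S : Finset (Leaf K))
    (ω : (Node K → ℝ) × (Leaf K → ℝ)) : ℝ :=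
  T.obsLogLik a S (T.allObs ω.1) (T.aux a ω) - T.obsLogMarginal a S (T.aux a ω)

/-- The logarithm of the conditional density of the auxiliary variables in `A` given the
observations in `A`. -/
noncomputable def channelLogLik (a : Leaf K → ℝ) (A : Finset (Leaf K)) (p : (A → ℝ) × (A → ℝ)) :
    ℝ :=
  ∑ j : A, (a j / T.testVar a j * p.2 j * p.1 j - a j ^ 2 / T.testVar a j * p.1 j ^ 2 / 2)

@[fun_prop]
theorem measurable_channelLogLik (a : Leaf K → ℝ) (A : Finset (Leaf K)) :
    Measurable (T.channelLogLik a A) := by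
  unfold channelLogLik; fun_prop

/-- The logarithm of the conditional density of the auxiliary variables in `A` given those off
`A`. -/
noncomputable def condLogLik (a : Leaf K → ℝ) (A : Finset (Leaf K)) (p : (↥Aᶜ → ℝ) × (A → ℝ)) :
    ℝ :=
  T.obsLogMarginal a Finset.univ (mergeOn A p.1 p.2) - T.obsLogMarginal a Aᶜ (mergeOn A p.1 0)

@[fun_prop]
theorem measurable_condLogLik (a : Leaf K → ℝ) (A : Finset (Leaf K)) :
    Measurable (T.condLogLik a A) := by
  refine ((T.measurable_obsLogMarginal a _).comp (measurable_mergeOn A)).sub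
    ((T.measurable_obsLogMarginal a _).comp ?_)
  exact (measurable_mergeOn A).comp (by fun_prop :
    Measurable fun p : (↥Aᶜ → ℝ) × (A → ℝ) => (p.1, (0 : A → ℝ)))

/-- The chain rule at the level of densities: the channels off A appear in both information
densities and cancel. -/
theorem channelLogLik_sub_condLogLik (a : Leaf K → ℝ) (A : Finset (Leaf K))
    (ω : (Node K → ℝ) × (Leaf K → ℝ)) :
    T.channelLogLik a A (T.obs A ω, T.auxOn a A ω)
        - T.condLogLik a A (T.auxOn a Aᶜ ω, T.auxOn a A ω)
      = T.infoDensity a Finset.univ ω - T.infoDensity a Aᶜ ω := by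
  have hmerge : mergeOn A (T.auxOn a Aᶜ ω) (T.auxOn a A ω) = T.aux a ω :=
    mergeOn_restrict A (T.aux a ω)
  have h1 := T.obsLogLik_univ_mergeOn a A (T.allObs ω.1) (T.auxOn a Aᶜ ω) (T.auxOn a A ω)
    (T.auxOn a A ω)
  have h2 := T.obsLogMarginal_compl_mergeOn a A (T.auxOn a Aᶜ ω) 0 (T.auxOn a A ω)
  rw [condLogLik, infoDensity, infoDensity, h2]
  rw [hmerge] at *
  have h3 : T.channelLogLik a A (T.obs A ω, T.auxOn a A ω) = ∑ j : A, (a j / T.testVar a j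
    * T.auxOn a A ω j * T.allObs ω.1 j - a j ^ 2 / T.testVar a j * T.allObs ω.1 j ^ 2 / 2) := rfl
  linarith

theorem exp_condLogLik (a : Leaf K → ℝ) (A : Finset (Leaf K)) (z : ↥Aᶜ → ℝ) (y : A → ℝ) :
    ENNReal.ofReal (Real.exp (T.condLogLik a A (z, y)))
      * ENNReal.ofReal (Real.exp (T.obsLogMarginal a Aᶜ (mergeOn A z 0)))
      = ENNReal.ofReal (Real.exp (T.obsLogMarginal a Finset.univ (mergeOn A z y))) := by
  rw [← ENNReal.ofReal_mul (Real.exp_pos _).le, ← Real.exp_add, condLogLik, sub_add_cancel]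

theorem lintegral_testNoise_split (a : Leaf K → ℝ) (A : Finset (Leaf K))
    (F : (↥Aᶜ → ℝ) → (A → ℝ) → ℝ≥0∞)
    (hF : Measurable fun p : (↥Aᶜ → ℝ) × (A → ℝ) => F p.1 p.2) :
    ∫⁻ y, F (fun j => y j) (fun j => y j) ∂T.testNoise a
      = ∫⁻ z, ∫⁻ y, F z y ∂T.testNoiseLaw a A ∂T.testNoiseLaw a Aᶜ :=
  lintegral_pi_split _ A hF

/-- Given the observations in A, the variables u_A depend only on their own channel noises, which
are independent of everything else. The conditional density therefore does not involve the variables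
off A. -/
theorem lintegral_aux_obs_auxOn {a : Leaf K → ℝ} (hs : ∀ j, 0 < T.testVar a j)
    (A : Finset (Leaf K)) {F : (↥Aᶜ → ℝ) × (A → ℝ) × (A → ℝ) → ℝ≥0∞} (hF : Measurable F) :
    ∫⁻ ω, F (T.auxOn a Aᶜ ω, T.obs A ω, T.auxOn a A ω) ∂T.testLaw a
      = ∫⁻ ω, ∫⁻ y, F (T.auxOn a Aᶜ ω, T.obs A ω, y)
        * ENNReal.ofReal (Real.exp (T.channelLogLik a A (T.obs A ω, y))) ∂T.testNoiseLaw a A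
        ∂T.testLaw a := by
  rw [testLaw_eq, lintegral_prod _ (by fun_prop), lintegral_prod]
  · refine lintegral_congr fun n => ?_
    have hm2 : Measurable fun p : (↥Aᶜ → ℝ) × (A → ℝ) => ∫⁻ y,
        F (fun j => a j * T.source K j n + p.1 j, fun j => T.source K (j : Leaf K) n, y)
          * ENNReal.ofReal (Real.exp (T.channelLogLik a A
            (fun j => T.source K (j : Leaf K) n, y))) ∂T.testNoiseLaw a A := by
      refine Measurable.lintegral_prod_right' (f := fun q : ((↥Aᶜ → ℝ) × (A → ℝ)) × (A → ℝ) =>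
        F (fun j => a j * T.source K j n + q.1.1 j, fun j => T.source K (j : Leaf K) n, q.2)
          * ENNReal.ofReal (Real.exp (T.channelLogLik a A
            (fun j => T.source K (j : Leaf K) n, q.2)))) ?_
      fun_prop
    refine (T.lintegral_testNoise_split a A (fun z y => F (fun j => a j * T.source K j n + z j,
        fun j => T.source K (j : Leaf K) n, fun j => a j * T.source K j n + y j))
        (by fun_prop)).trans (Eq.trans ?_ (T.lintegral_testNoise_split a A (fun z _ => ∫⁻ y,
          F (fun j => a j * T.source K j n + z j, fun j => T.source K (j : Leaf K) n, y)
            * ENNReal.ofReal (Real.exp (T.channelLogLik a A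
              (fun j => T.source K (j : Leaf K) n, y))) ∂T.testNoiseLaw a A) hm2).symm)
    refine lintegral_congr fun z => ?_
    rw [lintegral_const, measure_univ, mul_one]
    exact T.lintegral_testNoiseLaw_translate hs A (fun j => T.source K (j : Leaf K) n)
      (F := fun y => F (fun j => a j * T.source K j n + z j,
        fun j => T.source K (j : Leaf K) n, y)) (by fun_prop)
  · refine Measurable.aemeasurable (Measurable.lintegral_prod_right'
      (f := fun q : ((Node K → ℝ) × (Leaf K → ℝ)) × (A → ℝ) =>
        F (T.auxOn a Aᶜ q.1, T.obs A q.1, q.2)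
          * ENNReal.ofReal (Real.exp (T.channelLogLik a A (T.obs A q.1, q.2)))) ?_)
    fun_prop

/-- Bayes' rule: the joint density of all auxiliary variables is the marginal one off A times the
ratio of the two marginal likelihoods. -/
theorem lintegral_auxOn_compl_auxOn (hT : T.PosNoise) {a : Leaf K → ℝ}
    (hs : ∀ j, 0 < T.testVar a j) (A : Finset (Leaf K)) {F : (↥Aᶜ → ℝ) × (A → ℝ) → ℝ≥0∞}
    (hF : Measurable F) :
    ∫⁻ ω, F (T.auxOn a Aᶜ ω, T.auxOn a A ω) ∂T.testLaw a
      = ∫⁻ ω, ∫⁻ y, F (T.auxOn a Aᶜ ω, y)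
        * ENNReal.ofReal (Real.exp (T.condLogLik a A (T.auxOn a Aᶜ ω, y))) ∂T.testNoiseLaw a A
        ∂T.testLaw a := by
  let H : (↥Aᶜ → ℝ) → ℝ≥0∞ := fun z => ∫⁻ y, F (z, y)
    * ENNReal.ofReal (Real.exp (T.condLogLik a A (z, y))) ∂T.testNoiseLaw a A
  have hH : Measurable H :=
    Measurable.lintegral_prod_right' (f := fun q : (↥Aᶜ → ℝ) × (A → ℝ) =>
      F q * ENNReal.ofReal (Real.exp (T.condLogLik a A q))) (by fun_prop)
  let M : (↥Aᶜ → ℝ) × (A → ℝ) → ℝ≥0∞ := fun p =>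
    ENNReal.ofReal (Real.exp (T.obsLogMarginal a Finset.univ (mergeOn A p.1 p.2)))
  have hM : Measurable M := ENNReal.measurable_ofReal.comp (Real.measurable_exp.comp
    ((T.measurable_obsLogMarginal a Finset.univ).comp (measurable_mergeOn A)))
  have hMy : ∀ y : Leaf K → ℝ, M (fun j => y j, fun j => y j)
      = ENNReal.ofReal (Real.exp (T.obsLogMarginal a Finset.univ y)) := fun y => by
    simp only [M, mergeOn_restrict]
  have hres : ∀ B : Finset (Leaf K), Measurable fun (y : Leaf K → ℝ) (j : B) => y j := fun B =>
    measurable_pi_lambda _ fun j => measurable_pi_apply _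
  have e1 := T.lintegral_aux_marginal hT hs (F := fun y => F (fun j => y j, fun j => y j))
    (hF.comp ((hres _).prodMk (hres _)))
  have e2 := T.lintegral_aux_marginal hT hs (F := fun u => H fun j => u j) (hH.comp (hres _))
  have s1 := T.lintegral_testNoise_split a A (fun z y => F (z, y) * M (z, y)) (hF.mul hM)
  have s2 := T.lintegral_testNoise_split a A (fun z y => H z * M (z, y))
    ((hH.comp measurable_fst).mul hM)
  simp only [hMy] at s1 s2
  refine (e1.trans s1).trans (Eq.trans ?_ (e2.trans s2).symm)
  refine lintegral_congr fun z => ?_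
  have hMz : Measurable fun y : A → ℝ => M (z, y) := hM.comp (measurable_const.prodMk measurable_id)
  rw [lintegral_const_mul _ hMz, T.lintegral_exp_obsLogMarginal hT hs A z,
    ← lintegral_mul_const _ (by fun_prop)]
  refine lintegral_congr fun y => ?_
  rw [mul_assoc, T.exp_condLogLik]

theorem lintegral_exp_condLogLik (hT : T.PosNoise) {a : Leaf K → ℝ}
    (hs : ∀ j, 0 < T.testVar a j) (A : Finset (Leaf K)) (z : ↥Aᶜ → ℝ) :
    ∫⁻ y, ENNReal.ofReal (Real.exp (T.condLogLik a A (z, y))) ∂T.testNoiseLaw a A = 1 := by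
  have e := T.lintegral_exp_obsLogMarginal hT hs A z
  simp only [← T.exp_condLogLik] at e
  rw [lintegral_mul_const _ (by fun_prop)] at e
  have hpos : ENNReal.ofReal (Real.exp (T.obsLogMarginal a Aᶜ (mergeOn A z 0))) ≠ 0 := by
    simp [Real.exp_pos]
  exact (ENNReal.mul_eq_right hpos ENNReal.ofReal_ne_top).mp e

theorem condMutualInfo_eq_infoDensity (hT : T.PosNoise) {a : Leaf K → ℝ}
    (hs : ∀ j, 0 < T.testVar a j) (A : Finset (Leaf K))
    (hint : ∀ S, Integrable (T.infoDensity a S) (T.testLaw a)) :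
    condMutualInfo (T.obs A) (T.auxOn a A) (T.auxOn a Aᶜ) (T.testLaw a)
      = ENNReal.ofReal (∫ ω, T.infoDensity a Finset.univ ω ∂T.testLaw a
        - ∫ ω, T.infoDensity a Aᶜ ω ∂T.testLaw a) := by
  rw [condMutualInfo_eq_of_density (T.measurable_obs A) (T.measurable_auxOn a A)
    (T.measurable_auxOn a Aᶜ) (T.measurable_channelLogLik a A) (T.measurable_condLogLik a A)
    (fun F hF => T.lintegral_aux_obs_auxOn hs A hF)
    (fun F hF => T.lintegral_auxOn_compl_auxOn hT hs A hF)
    (fun z => T.lintegral_exp_condLogLik hT hs A z)]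
  · rw [← integral_sub (hint _) (hint _)]
    simp only [channelLogLik_sub_condLogLik]
  · simp only [channelLogLik_sub_condLogLik]
    exact (hint Finset.univ).sub (hint Aᶜ)

end GaussTree

/-! ### Second moments of independent Gaussian variables -/

theorem memLp_eval_pi_gaussianReal {ι : Type*} [Fintype ι] (v : ι → ℝ≥0) (i : ι) :
    MemLp (fun ω : ι → ℝ => ω i) 2 (Measure.pi fun i => gaussianReal 0 (v i)) :=
  (memLp_id_gaussianReal' 2 (by simp)).comp_measurePreserving
    (measurePreserving_eval (fun i => gaussianReal 0 (v i)) i)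

theorem integral_eval_pi_gaussianReal {ι : Type*} [Fintype ι] (v : ι → ℝ≥0) (i : ι) :
    ∫ ω : ι → ℝ, ω i ∂(Measure.pi fun i => gaussianReal 0 (v i)) = 0 := by
  have h := measurePreserving_eval (fun i => gaussianReal 0 (v i)) i
  have := integral_map (μ := Measure.pi fun i => gaussianReal 0 (v i)) h.measurable.aemeasurable
    (f := fun x : ℝ => x) aestronglyMeasurable_id
  rw [h.map_eq, integral_id_gaussianReal] at this
  exact this.symm

theorem integral_sq_gaussianReal (v : ℝ≥0) : ∫ x, x ^ 2 ∂gaussianReal 0 v = v := by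
  have h := variance_fun_id_gaussianReal (μ := 0) (v := v)
  rw [variance_of_integral_eq_zero aemeasurable_id' (by simp)] at h
  exact h

theorem integral_mul_eval_pi_gaussianReal {ι : Type*} [Fintype ι] [DecidableEq ι] (v : ι → ℝ≥0)
    (i j : ι) :
    ∫ ω : ι → ℝ, ω i * ω j ∂(Measure.pi fun i => gaussianReal 0 (v i))
      = if i = j then (v i : ℝ) else 0 := by
  split_ifs with hij
  · subst hij
    have h := measurePreserving_eval (fun i => gaussianReal 0 (v i)) i
    have := integral_map (μ := Measure.pi fun i => gaussianReal 0 (v i)) h.measurable.aemeasurable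
      (f := fun x : ℝ => x ^ 2) (by fun_prop)
    rw [h.map_eq, integral_sq_gaussianReal] at this
    rw [this]
    exact integral_congr_ae (Filter.Eventually.of_forall fun ω => (sq (ω i)).symm)
  · have hind : iIndepFun (fun i (y : ι → ℝ) => y i) (Measure.pi fun i => gaussianReal 0 (v i)) :=
      iIndepFun_pi (X := fun _ => id) fun _ => aemeasurable_id
    have := (hind.indepFun hij).integral_fun_mul_eq_mul_integral
      (measurable_pi_apply i).aestronglyMeasurable (measurable_pi_apply j).aestronglyMeasurable
    rw [this, integral_eval_pi_gaussianReal, zero_mul]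

theorem integrable_fun_mul {α : Type*} [MeasurableSpace α] {μ : Measure α} {f g : α → ℝ}
    (hf : MemLp f 2 μ) (hg : MemLp g 2 μ) : Integrable (fun x => f x * g x) μ :=
  hf.integrable_mul hg

namespace GaussTree

variable {K : ℕ} (T : GaussTree K)

/-- The source noises and the test-channel noises. -/
def coord : Node K ⊕ Leaf K → (Node K → ℝ) × (Leaf K → ℝ) → ℝ
  | Sum.inl v, ω => ω.1 v
  | Sum.inr j, ω => ω.2 j

/-- The variances of the source noises and of the test-channel noises. -/
noncomputable def coordVar (a : Leaf K → ℝ) : Node K ⊕ Leaf K → ℝ≥0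
  | Sum.inl v => T.noiseVar v.1 v.2
  | Sum.inr j => T.testVar a j

theorem memLp_coord (a : Leaf K → ℝ) (p : Node K ⊕ Leaf K) :
    MemLp (coord p) 2 (T.testLaw a) := by
  rw [testLaw_eq]
  rcases p with v | j
  · exact (memLp_eval_pi_gaussianReal (fun v : Node K => T.noiseVar v.1 v.2)
      v).comp_measurePreserving measurePreserving_fst
  · exact (memLp_eval_pi_gaussianReal (T.testVar a) j).comp_measurePreserving
      measurePreserving_snd

theorem integral_coord_mul (a : Leaf K → ℝ) (p q : Node K ⊕ Leaf K) :
    ∫ ω, coord p ω * coord q ω ∂T.testLaw a = if p = q then (T.coordVar a p : ℝ) else 0 := by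
  rw [testLaw_eq]
  rcases p with v | j <;> rcases q with v' | j'
  · simp only [coord]
    rw [integral_fun_fst (fun n : Node K → ℝ => n v * n v'), probReal_univ, one_smul, noiseLaw,
      integral_mul_eval_pi_gaussianReal]
    simp [coordVar]
  · simp only [coord]
    rw [integral_prod_mul (fun n : Node K → ℝ => n v) (fun y : Leaf K → ℝ => y j'), noiseLaw,
      integral_eval_pi_gaussianReal]
    simp
  · simp only [coord]
    rw [integral_congr_ae (Filter.Eventually.of_forall fun ω : (Node K → ℝ) × (Leaf K → ℝ) =>
        mul_comm (ω.2 j) (ω.1 v')),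
      integral_prod_mul (fun n : Node K → ℝ => n v') (fun y : Leaf K → ℝ => y j), noiseLaw,
      integral_eval_pi_gaussianReal]
    simp
  · simp only [coord]
    rw [integral_fun_snd (fun y : Leaf K → ℝ => y j * y j'), probReal_univ, one_smul, testNoise,
      integral_mul_eval_pi_gaussianReal]
    simp [coordVar]

/-- The linear combinations of the noises with index in `D`. -/
def coordSpan (D : Set (Node K ⊕ Leaf K)) : Submodule ℝ ((Node K → ℝ) × (Leaf K → ℝ) → ℝ) :=
  Submodule.span ℝ (coord '' D)

theorem coord_mem_coordSpan {D : Set (Node K ⊕ Leaf K)} {p : Node K ⊕ Leaf K} (hp : p ∈ D) :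
    coord p ∈ coordSpan D := Submodule.subset_span ⟨p, hp, rfl⟩

theorem coordSpan_mono {D D' : Set (Node K ⊕ Leaf K)} (h : D ⊆ D') :
    coordSpan D ≤ coordSpan D' := Submodule.span_mono (Set.image_mono h)

theorem memLp_of_mem_coordSpan (a : Leaf K → ℝ) {D : Set (Node K ⊕ Leaf K)}
    {f : (Node K → ℝ) × (Leaf K → ℝ) → ℝ} (hf : f ∈ coordSpan D) : MemLp f 2 (T.testLaw a) := by
  induction hf using Submodule.span_induction with
  | mem f hf => obtain ⟨p, -, rfl⟩ := hf; exact T.memLp_coord a p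
  | zero => exact MemLp.zero'
  | add f g _ _ hf hg => exact hf.add hg
  | smul c f _ hf => exact hf.const_smul c

/-- Bilinearity reduces this to distinct noises, which are independent and centred. -/
theorem integral_mul_of_disjoint (a : Leaf K → ℝ) {D D' : Set (Node K ⊕ Leaf K)}
    (hD : Disjoint D D') {f g : (Node K → ℝ) × (Leaf K → ℝ) → ℝ} (hf : f ∈ coordSpan D)
    (hg : g ∈ coordSpan D') : ∫ ω, f ω * g ω ∂T.testLaw a = 0 := by
  have hgL := T.memLp_of_mem_coordSpan a hg
  induction hf using Submodule.span_induction with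
  | mem f hf =>
    obtain ⟨p, hp, rfl⟩ := hf
    have hpL := T.memLp_coord a p
    clear hgL
    induction hg using Submodule.span_induction with
    | mem g hg =>
      obtain ⟨q, hq, rfl⟩ := hg
      rw [integral_coord_mul, if_neg (hD.ne_of_mem hp hq)]
    | zero => simp
    | add f g hf' hg' hf hg =>
      simp only [Pi.add_apply, mul_add]
      rw [integral_add (integrable_fun_mul hpL (T.memLp_of_mem_coordSpan a hf'))
        (integrable_fun_mul hpL (T.memLp_of_mem_coordSpan a hg')), hf, hg, add_zero]
    | smul c f _ hf =>
      simp only [Pi.smul_apply, smul_eq_mul, mul_left_comm _ c]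
      rw [integral_const_mul, hf, mul_zero]
  | zero => simp
  | add f f' hf' hg' hf hg =>
    simp only [Pi.add_apply, add_mul]
    rw [integral_add (integrable_fun_mul (T.memLp_of_mem_coordSpan a hf') hgL)
      (integrable_fun_mul (T.memLp_of_mem_coordSpan a hg') hgL), hf, hg, add_zero]
  | smul c f _ hf =>
    simp only [Pi.smul_apply, smul_eq_mul, mul_assoc]
    rw [integral_const_mul, hf, mul_zero]

theorem integral_sq_add_of_disjoint (a : Leaf K → ℝ) {D D' : Set (Node K ⊕ Leaf K)}
    (hD : Disjoint D D') {f g : (Node K → ℝ) × (Leaf K → ℝ) → ℝ} (hf : f ∈ coordSpan D)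
    (hg : g ∈ coordSpan D') (s t : ℝ) : ∫ ω, (s * f ω + t * g ω) ^ 2 ∂T.testLaw a
      = s ^ 2 * ∫ ω, f ω ^ 2 ∂T.testLaw a + t ^ 2 * ∫ ω, g ω ^ 2 ∂T.testLaw a := by
  have hfL := T.memLp_of_mem_coordSpan a hf
  have hgL := T.memLp_of_mem_coordSpan a hg
  have e : ∀ ω, (s * f ω + t * g ω) ^ 2
      = s ^ 2 * f ω ^ 2 + t ^ 2 * g ω ^ 2 + 2 * s * t * (f ω * g ω) := fun ω => by ring
  simp only [e]
  rw [integral_add, integral_add, integral_const_mul, integral_const_mul, integral_const_mul,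
    T.integral_mul_of_disjoint a hD hf hg, mul_zero, add_zero]
  · exact hfL.integrable_sq.const_mul _
  · exact hgL.integrable_sq.const_mul _
  · exact (hfL.integrable_sq.const_mul _).add (hgL.integrable_sq.const_mul _)
  · exact (hfL.integrable_mul hgL).const_mul _

/-! ### Second moments of the source and of the natural parameters -/

/-- The source noises up to level `k`. -/
def upTo (k : ℕ) : Set (Node K ⊕ Leaf K) := {p | ∃ v : Node K, p = Sum.inl v ∧ (v.1 : ℕ) ≤ k}

/-- The noises strictly below the node `(k, i)`. -/
def strictlyBelow (k i : ℕ) : Set (Node K ⊕ Leaf K) :=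
  {p | (∃ v : Node K, p = Sum.inl v ∧ k < v.1 ∧ (v.2 : ℕ) / 2 ^ ((v.1 : ℕ) - k) = i)
    ∨ ∃ j : Leaf K, p = Sum.inr j ∧ (j : ℕ) / 2 ^ (K - k) = i}

theorem disjoint_strictlyBelow_upTo (k i : ℕ) :
    Disjoint (strictlyBelow k i) (upTo (K := K) k) := by
  rw [Set.disjoint_left]
  rintro p (⟨v, rfl, h, -⟩ | ⟨j, rfl, -⟩) ⟨v', hv, h'⟩
  · cases hv; omega
  · cases hv

theorem noise_mem (k i : ℕ) (hk : k ≤ K) (hi : i < 2 ^ k) :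
    (fun ω : (Node K → ℝ) × (Leaf K → ℝ) => noise k i ω.1)
      = coord (Sum.inl ⟨⟨k, Nat.lt_succ_of_le hk⟩, ⟨i, hi⟩⟩) := by
  funext ω
  rw [noise, dif_pos ⟨Nat.lt_succ_of_le hk, hi⟩]
  rfl

theorem source_mem : ∀ k ≤ K, ∀ i < 2 ^ k,
    (fun ω : (Node K → ℝ) × (Leaf K → ℝ) => T.source k i ω.1) ∈ coordSpan (upTo k) := by
  intro k
  induction k with
  | zero =>
    intro hk i hi
    have := coord_mem_coordSpan (D := upTo (K := K) 0)
      (p := Sum.inl ⟨⟨0, Nat.lt_succ_of_le hk⟩, ⟨i, hi⟩⟩) ⟨_, rfl, le_rfl⟩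
    rw [← noise_mem 0 i hk hi] at this
    exact this
  | succ k ih =>
    intro hk i hi
    have h1 := coord_mem_coordSpan (D := upTo (K := K) (k + 1))
      (p := Sum.inl ⟨⟨k + 1, Nat.lt_succ_of_le hk⟩, ⟨i, hi⟩⟩) ⟨_, rfl, le_rfl⟩
    rw [← noise_mem (k + 1) i hk hi] at h1
    have h2 := coordSpan_mono (D := upTo (K := K) k) (D' := upTo (K := K) (k + 1))
      (fun p ⟨v, hv, h⟩ => ⟨v, hv, h.trans (Nat.le_succ k)⟩)
      (ih (by omega) (i / 2) (by rw [pow_succ] at hi; omega))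
    exact Submodule.add_mem _ (Submodule.smul_mem _ (T.gain (k + 1) i) h2) h1

/-- The variance of the source at the node `(k, i)`. -/
noncomputable def sourceVar (k i : ℕ) : ℝ := ∫ ω, T.source k i ω ^ 2 ∂T.noiseLaw

theorem integral_source_sq (a : Leaf K → ℝ) (k i : ℕ) :
    ∫ ω, T.source k i ω.1 ^ 2 ∂T.testLaw a = T.sourceVar k i := by
  rw [testLaw_eq, integral_fun_fst (fun n => T.source k i n ^ 2), probReal_univ, one_smul]
  rfl

theorem integral_noise_sq (a : Leaf K → ℝ) {k i : ℕ} (hk : k ≤ K) (hi : i < 2 ^ k) :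
    ∫ ω, noise k i ω.1 ^ 2 ∂T.testLaw a = T.noiseVar k i := by
  have h := T.integral_coord_mul a (Sum.inl ⟨⟨k, Nat.lt_succ_of_le hk⟩, ⟨i, hi⟩⟩)
    (Sum.inl ⟨⟨k, Nat.lt_succ_of_le hk⟩, ⟨i, hi⟩⟩)
  rw [if_pos rfl, ← noise_mem k i hk hi] at h
  simp only [← sq] at h
  exact h

theorem sourceVar_zero : T.sourceVar 0 0 = T.noiseVar 0 0 := by
  rw [← T.integral_source_sq 0, ← T.integral_noise_sq 0 (Nat.zero_le K) (by simp)]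
  rfl

theorem sourceVar_succ {k i : ℕ} (hk : k < K) (hi : i < 2 ^ (k + 1)) :
    T.sourceVar (k + 1) i = T.gain (k + 1) i ^ 2 * T.sourceVar k (i / 2)
      + T.noiseVar (k + 1) i := by
  have h1 := coord_mem_coordSpan (K := K)
    (D := {Sum.inl ⟨⟨k + 1, Nat.lt_succ_of_le hk⟩, ⟨i, hi⟩⟩}) rfl
  rw [← noise_mem (k + 1) i hk hi] at h1
  have h2 := T.source_mem k hk.le (i / 2) (by rw [pow_succ] at hi; omega)
  have := T.integral_sq_add_of_disjoint 0 (by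
    rw [Set.disjoint_right]
    rintro p rfl ⟨v, hv, h⟩
    cases hv
    simp at h) h2 h1 (T.gain (k + 1) i) 1
  rw [integral_source_sq, integral_noise_sq _ _ hk hi] at this
  rw [← T.integral_source_sq 0]
  simp only [one_mul, one_pow] at this
  exact this

theorem sourceVar_pos (hT : T.PosNoise) : ∀ k ≤ K, ∀ i < 2 ^ k, 0 < T.sourceVar k i := by
  intro k
  induction k with
  | zero =>
    intro hk i hi
    obtain rfl : i = 0 := by simpa using hi
    rw [sourceVar_zero]
    exact_mod_cast hT 0 hk 0 hi
  | succ k ih =>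
    intro hk i hi
    have := ih (by omega) (i / 2) (by rw [pow_succ] at hi; omega)
    have h2 : (0 : ℝ) < T.noiseVar (k + 1) i := by exact_mod_cast hT (k + 1) hk i hi
    rw [T.sourceVar_succ hk hi]
    positivity

theorem integral_of_mem_coordSpan (a : Leaf K → ℝ) {D : Set (Node K ⊕ Leaf K)}
    {f : (Node K → ℝ) × (Leaf K → ℝ) → ℝ} (hf : f ∈ coordSpan D) :
    ∫ ω, f ω ∂T.testLaw a = 0 := by
  induction hf using Submodule.span_induction with
  | mem f hf =>
    obtain ⟨p, -, rfl⟩ := hf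
    rw [testLaw_eq]
    rcases p with v | j
    · simp only [coord]
      rw [integral_fun_fst (fun n : Node K → ℝ => n v), noiseLaw, integral_eval_pi_gaussianReal,
        smul_zero]
    · simp only [coord]
      rw [integral_fun_snd (fun y : Leaf K → ℝ => y j), testNoise, integral_eval_pi_gaussianReal,
        smul_zero]
  | zero => simp
  | add f g hf' hg' hf hg =>
    simp only [Pi.add_apply]
    rw [integral_add ((T.memLp_of_mem_coordSpan a hf').integrable (by simp))
      ((T.memLp_of_mem_coordSpan a hg').integrable (by simp)), hf, hg, add_zero]
  | smul c f _ hf =>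
    simp only [Pi.smul_apply, smul_eq_mul]
    rw [integral_const_mul, hf, mul_zero]

theorem obsVar_eq (j : Leaf K) : T.obsVar j = T.sourceVar K j := by
  have h := T.integral_of_mem_coordSpan 0 (T.source_mem K le_rfl j j.2)
  rw [testLaw_eq, integral_fun_fst (fun n => T.source K j n), probReal_univ, one_smul] at h
  rw [obsVar, variance_of_integral_eq_zero (T.measurable_source K j).aemeasurable h]
  rfl

/-- The error of the natural parameter of the node `(k, i)`, as a multiple of the source. -/
noncomputable def naturalError (a : Leaf K → ℝ) (S : Finset (Leaf K)) (k i : ℕ)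
    (ω : (Node K → ℝ) × (Leaf K → ℝ)) : ℝ :=
  T.natural (T.obsPrecision a S) (T.obsNatural a S (T.aux a ω)) k i
    - T.precision (T.obsPrecision a S) k i * T.source k i ω.1

theorem naturalError_leaf {a : Leaf K → ℝ} (S : Finset (Leaf K)) (j : Leaf K) :
    T.naturalError a S K j = (if j ∈ S then a j / T.testVar a j else 0) • coord (Sum.inr j) := by
  funext ω
  rw [naturalError, natural_leaf, precision_leaf, obsNatural_coe, obsPrecision_coe]
  split_ifs
  · simp only [Pi.smul_apply, smul_eq_mul, coord, aux]
    ring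
  · simp

/-- Each child contributes its own noise, weighted by its precision, and its own error. These terms
come from disjoint sets of noises. -/
theorem naturalError_node (a : Leaf K → ℝ) (S : Finset (Leaf K)) {k : ℕ} (hk : k < K) (i : ℕ) :
    T.naturalError a S k i = fun ω =>
      T.gain (k + 1) (2 * i) / (1 + T.noiseVar (k + 1) (2 * i)
          * T.precision (T.obsPrecision a S) (k + 1) (2 * i))
        * (T.precision (T.obsPrecision a S) (k + 1) (2 * i) * noise (k + 1) (2 * i) ω.1
          + 1 * T.naturalError a S (k + 1) (2 * i) ω)
      + T.gain (k + 1) (2 * i + 1) / (1 + T.noiseVar (k + 1) (2 * i + 1)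
          * T.precision (T.obsPrecision a S) (k + 1) (2 * i + 1))
        * (T.precision (T.obsPrecision a S) (k + 1) (2 * i + 1) * noise (k + 1) (2 * i + 1) ω.1
          + 1 * T.naturalError a S (k + 1) (2 * i + 1) ω) := by
  funext ω
  simp only [naturalError]
  rw [T.natural_node _ _ hk, T.precision_node _ hk, edgeNatural, edgeNatural, edgePrecision,
    edgePrecision, source, source, show 2 * i / 2 = i by omega, show (2 * i + 1) / 2 = i by omega]
  ring

theorem disjoint_noise_strictlyBelow {k i : ℕ} (hk : k ≤ K) (hi : i < 2 ^ k) (c : ℕ) :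
    Disjoint {(Sum.inl ⟨⟨k, Nat.lt_succ_of_le hk⟩, ⟨i, hi⟩⟩ : Node K ⊕ Leaf K)}
      (strictlyBelow k c) := by
  rw [Set.disjoint_left]
  rintro p rfl (⟨v, hv, h, -⟩ | ⟨j, hj, -⟩)
  · cases hv; simp at h
  · cases hj

/-- The noise at the node `(k, i)` and the noises below it. -/
def withBelow (k i : ℕ) : Set (Node K ⊕ Leaf K) :=
  {p | (∃ v : Node K, p = Sum.inl v ∧ k ≤ v.1 ∧ (v.2 : ℕ) / 2 ^ ((v.1 : ℕ) - k) = i)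
    ∨ ∃ j : Leaf K, p = Sum.inr j ∧ (j : ℕ) / 2 ^ (K - k) = i}

theorem disjoint_withBelow {k i c : ℕ} (h : i ≠ c) :
    Disjoint (withBelow k i) (withBelow (K := K) k c) := by
  rw [Set.disjoint_left]
  rintro p (⟨v, rfl, h1, h2⟩ | ⟨j, rfl, h2⟩) (⟨v', hv, h1', h2'⟩ | ⟨j', hj, h2'⟩)
  · cases hv; exact h (h2.symm.trans h2')
  · cases hj
  · cases hv
  · cases hj; exact h (h2.symm.trans h2')

theorem strictlyBelow_subset_withBelow (k i : ℕ) :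
    strictlyBelow (K := K) k i ⊆ withBelow k i := by
  rintro p (⟨v, rfl, h1, h2⟩ | h)
  · exact Or.inl ⟨v, rfl, h1.le, h2⟩
  · exact Or.inr h

theorem withBelow_child_subset {k i c : ℕ} (hk : k < K) (hc : c / 2 = i) :
    withBelow (K := K) (k + 1) c ⊆ strictlyBelow k i := by
  rintro p (⟨v, rfl, h1, h2⟩ | ⟨j, rfl, h⟩)
  · refine Or.inl ⟨v, rfl, by omega, ?_⟩
    have e : (v.1 : ℕ) - k = ((v.1 : ℕ) - (k + 1)) + 1 := by omega
    rw [e, pow_succ, ← Nat.div_div_eq_div_mul, h2, hc]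
  · refine Or.inr ⟨j, rfl, ?_⟩
    have e : K - k = (K - (k + 1)) + 1 := by omega
    rw [e, pow_succ, ← Nat.div_div_eq_div_mul, h, hc]

theorem noise_mem_withBelow {k i : ℕ} (hk : k ≤ K) (hi : i < 2 ^ k) :
    (fun ω : (Node K → ℝ) × (Leaf K → ℝ) => noise k i ω.1) ∈ coordSpan (withBelow k i) := by
  rw [noise_mem k i hk hi]
  exact coord_mem_coordSpan (Or.inl ⟨_, rfl, le_rfl, by simp⟩)

/-- For a child with precision λ and noise variance ν, the term λn + e has second moment λ²ν + λ =
λ(1 + νλ). The squared factor gain²/(1 + νλ)² turns this into the edge precision, and the edge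
precisions of the children add up to the precision of the node. -/
theorem naturalError_spec {a : Leaf K → ℝ} (hs : ∀ j, 0 < T.testVar a j) (S : Finset (Leaf K)) :
    ∀ k ≤ K, ∀ i < 2 ^ k, T.naturalError a S k i ∈ coordSpan (strictlyBelow k i)
      ∧ ∫ ω, T.naturalError a S k i ω ^ 2 ∂T.testLaw a
        = T.precision (T.obsPrecision a S) k i := by
  apply node_induction
  · intro i hi
    have e := T.naturalError_leaf (a := a) S ⟨i, hi⟩
    simp only at e
    rw [e]
    refine ⟨Submodule.smul_mem _ _ (coord_mem_coordSpan (Or.inr ⟨_, rfl, by simp⟩)), ?_⟩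
    have h := T.integral_coord_mul a (Sum.inr ⟨i, hi⟩) (Sum.inr ⟨i, hi⟩)
    rw [if_pos rfl] at h
    simp only [← sq] at h
    simp only [Pi.smul_apply, smul_eq_mul, mul_pow]
    rw [integral_const_mul, h, precision_leaf, obsPrecision, dif_pos hi, coordVar]
    have : (T.testVar a ⟨i, hi⟩ : ℝ) ≠ 0 := by exact_mod_cast (hs _).ne'
    split_ifs
    · field_simp
    · simp
  · intro k hk i hi h1 h2
    obtain ⟨hc1, hc2⟩ := child_lt hi
    have hp1 := T.precision_nonneg (c := T.obsPrecision a S)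
      (fun i _ => T.obsPrecision_nonneg a S i) (k + 1) hk _ hc1
    have hp2 := T.precision_nonneg (c := T.obsPrecision a S)
      (fun i _ => T.obsPrecision_nonneg a S i) (k + 1) hk _ hc2
    set l₁ := T.precision (T.obsPrecision a S) (k + 1) (2 * i) with hl₁
    set l₂ := T.precision (T.obsPrecision a S) (k + 1) (2 * i + 1) with hl₂
    have key : ∀ c (hc : c < 2 ^ (k + 1)) (l : ℝ), T.naturalError a S (k + 1) c
        ∈ coordSpan (strictlyBelow (k + 1) c) →
        ∫ ω, T.naturalError a S (k + 1) c ω ^ 2 ∂T.testLaw a = l →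
        (fun ω => l * noise (k + 1) c ω.1 + 1 * T.naturalError a S (k + 1) c ω)
          ∈ coordSpan (withBelow (k + 1) c)
        ∧ ∫ ω, (l * noise (k + 1) c ω.1 + 1 * T.naturalError a S (k + 1) c ω) ^ 2 ∂T.testLaw a
          = l ^ 2 * T.noiseVar (k + 1) c + l := by
      intro c hc l hm hl
      refine ⟨Submodule.add_mem _ (Submodule.smul_mem _ l (noise_mem_withBelow hk hc))
        (Submodule.smul_mem _ 1 (coordSpan_mono (strictlyBelow_subset_withBelow _ _) hm)), ?_⟩
      have hn := coord_mem_coordSpan (K := K)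
        (D := {Sum.inl ⟨⟨k + 1, Nat.lt_succ_of_le hk⟩, ⟨c, hc⟩⟩}) rfl
      rw [← noise_mem (k + 1) c hk hc] at hn
      rw [T.integral_sq_add_of_disjoint a (disjoint_noise_strictlyBelow hk hc c) hn hm,
        T.integral_noise_sq a hk hc, hl]
      ring
    obtain ⟨m1, q1⟩ := key _ hc1 l₁ h1.1 h1.2
    obtain ⟨m2, q2⟩ := key _ hc2 l₂ h2.1 h2.2
    rw [T.naturalError_node a S hk i]
    refine ⟨Submodule.add_mem _ (Submodule.smul_mem _ _ (coordSpan_mono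
      (withBelow_child_subset hk (by omega)) m1)) (Submodule.smul_mem _ _ (coordSpan_mono
      (withBelow_child_subset hk (by omega)) m2)), ?_⟩
    rw [T.integral_sq_add_of_disjoint a (disjoint_withBelow (by omega)) m1 m2, q1, q2,
      T.precision_node _ hk, edgePrecision, edgePrecision, ← hl₁, ← hl₂]
    have d1 : (0 : ℝ) < 1 + T.noiseVar (k + 1) (2 * i) * l₁ := by positivity
    have d2 : (0 : ℝ) < 1 + T.noiseVar (k + 1) (2 * i + 1) * l₂ := by positivity
    field_simp
    ring

theorem natural_eq (a : Leaf K → ℝ) (S : Finset (Leaf K)) (k i : ℕ)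
    (ω : (Node K → ℝ) × (Leaf K → ℝ)) :
    T.natural (T.obsPrecision a S) (T.obsNatural a S (T.aux a ω)) k i
      = T.precision (T.obsPrecision a S) k i * T.source k i ω.1
        + 1 * T.naturalError a S k i ω := by
  rw [naturalError]; ring

theorem memLp_source (a : Leaf K → ℝ) {k i : ℕ} (hk : k ≤ K) (hi : i < 2 ^ k) :
    MemLp (fun ω => T.source k i ω.1) 2 (T.testLaw a) :=
  T.memLp_of_mem_coordSpan a (T.source_mem k hk i hi)

theorem memLp_natural {a : Leaf K → ℝ} (hs : ∀ j, 0 < T.testVar a j) (S : Finset (Leaf K))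
    {k i : ℕ} (hk : k ≤ K) (hi : i < 2 ^ k) : MemLp (fun ω => T.natural (T.obsPrecision a S)
      (T.obsNatural a S (T.aux a ω)) k i) 2 (T.testLaw a) := by
  simp only [natural_eq]
  exact ((T.memLp_source a hk hi).const_mul _).add
    ((T.memLp_of_mem_coordSpan a (T.naturalError_spec hs S k hk i hi).1).const_mul _)

theorem integral_natural_sq {a : Leaf K → ℝ} (hs : ∀ j, 0 < T.testVar a j) (S : Finset (Leaf K))
    {k i : ℕ} (hk : k ≤ K) (hi : i < 2 ^ k) :
    ∫ ω, T.natural (T.obsPrecision a S) (T.obsNatural a S (T.aux a ω)) k i ^ 2 ∂T.testLaw a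
      = T.precision (T.obsPrecision a S) k i ^ 2 * T.sourceVar k i
        + T.precision (T.obsPrecision a S) k i := by
  obtain ⟨hm, hq⟩ := T.naturalError_spec hs S k hk i hi
  simp only [natural_eq]
  rw [T.integral_sq_add_of_disjoint a (disjoint_strictlyBelow_upTo k i).symm
    (T.source_mem k hk i hi) hm, integral_source_sq, hq]
  ring

theorem integral_natural_mul_source {a : Leaf K → ℝ} (hs : ∀ j, 0 < T.testVar a j)
    (S : Finset (Leaf K)) {k i : ℕ} (hk : k ≤ K) (hi : i < 2 ^ k) :
    ∫ ω, T.natural (T.obsPrecision a S) (T.obsNatural a S (T.aux a ω)) k i * T.source k i ω.1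
        ∂T.testLaw a = T.precision (T.obsPrecision a S) k i * T.sourceVar k i := by
  obtain ⟨hm, -⟩ := T.naturalError_spec hs S k hk i hi
  have e : ∀ ω, T.natural (T.obsPrecision a S) (T.obsNatural a S (T.aux a ω)) k i
      * T.source k i ω.1 = T.precision (T.obsPrecision a S) k i * T.source k i ω.1 ^ 2
        + T.naturalError a S k i ω * T.source k i ω.1 := fun ω => by rw [natural_eq]; ring
  simp only [e]
  rw [integral_add ((T.memLp_source a hk hi).integrable_sq.const_mul _)
    (integrable_fun_mul (T.memLp_of_mem_coordSpan a hm) (T.memLp_source a hk hi)),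
    integral_const_mul, integral_source_sq,
    T.integral_mul_of_disjoint a (disjoint_strictlyBelow_upTo k i) hm (T.source_mem k hk i hi),
    add_zero]

/-! ### The expected information density -/

/-- With V the source variance, V = gain² V_parent + ν shows that the summand of a node is λV minus
its edge precision times V_parent. Summed over a level, the subtracted terms are the total of λV one
level up. -/
theorem sum_telescope {a : Leaf K → ℝ} (S : Finset (Leaf K)) : ∀ k ≤ K,
    ∑ l ∈ Finset.range (k + 1), ∑ i ∈ Finset.range (2 ^ l),
      T.noiseVar l i * (T.precision (T.obsPrecision a S) l i ^ 2 * T.sourceVar l i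
        + T.precision (T.obsPrecision a S) l i)
        / (1 + T.noiseVar l i * T.precision (T.obsPrecision a S) l i)
      = ∑ i ∈ Finset.range (2 ^ k), T.precision (T.obsPrecision a S) k i * T.sourceVar k i := by
  have hp := T.precision_nonneg (c := T.obsPrecision a S)
    (fun i _ => T.obsPrecision_nonneg a S i)
  intro k
  induction k with
  | zero =>
    intro hk
    simp only [zero_add, Finset.sum_range_one, pow_zero, sourceVar_zero]
    have := hp 0 hk 0 (by simp)
    have d : (0 : ℝ) < 1 + T.noiseVar 0 0 * T.precision (T.obsPrecision a S) 0 0 := by positivity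
    field_simp
    ring
  | succ k ih =>
    intro hk
    rw [Finset.sum_range_succ, ih (by omega)]
    have h1 : ∑ i ∈ Finset.range (2 ^ k),
        T.precision (T.obsPrecision a S) k i * T.sourceVar k i
        = ∑ i ∈ Finset.range (2 ^ (k + 1)),
          T.edgePrecision (T.obsPrecision a S) (k + 1) i * T.sourceVar k (i / 2) := by
      rw [pow_succ, mul_comm _ 2, sum_range_two_mul]
      refine Finset.sum_congr rfl fun i _ => ?_
      rw [T.precision_node _ (by omega), show 2 * i / 2 = i by omega,
        show (2 * i + 1) / 2 = i by omega]
      ring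
    rw [h1, ← Finset.sum_add_distrib]
    refine Finset.sum_congr rfl fun i hi => ?_
    have hi := Finset.mem_range.mp hi
    have := hp (k + 1) hk i hi
    have d : (0 : ℝ) < 1 + T.noiseVar (k + 1) i
      * T.precision (T.obsPrecision a S) (k + 1) i := by positivity
    rw [T.sourceVar_succ (by omega) hi, edgePrecision]
    field_simp
    ring

theorem infoDensity_eq (a : Leaf K → ℝ) (S : Finset (Leaf K)) :
    T.infoDensity a S = fun ω =>
      ∑ i ∈ Finset.range (2 ^ K),
        (T.natural (T.obsPrecision a S) (T.obsNatural a S (T.aux a ω)) K i * T.source K i ω.1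
          - T.precision (T.obsPrecision a S) K i / 2 * T.source K i ω.1 ^ 2)
      - ∑ k ∈ Finset.range (K + 1), ∑ i ∈ Finset.range (2 ^ k),
        (-(Real.log (1 + T.noiseVar k i * T.precision (T.obsPrecision a S) k i) / 2)
          + T.noiseVar k i / (2 * (1 + T.noiseVar k i * T.precision (T.obsPrecision a S) k i))
            * T.natural (T.obsPrecision a S) (T.obsNatural a S (T.aux a ω)) k i ^ 2) := by
  funext ω
  rw [infoDensity, ← T.logLik_obs, logLik, Fin.sum_univ_eq_sum_range
    (fun i => T.natural (T.obsPrecision a S) (T.obsNatural a S (T.aux a ω)) K i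
      * T.source K i ω.1 - T.precision (T.obsPrecision a S) K i * T.source K i ω.1 ^ 2 / 2),
    obsLogMarginal, logMarginal]
  congr 1
  · exact Finset.sum_congr rfl fun i _ => by ring
  · refine Finset.sum_congr rfl fun k _ => Finset.sum_congr rfl fun i _ => ?_
    rw [logNorm, div_mul_eq_mul_div, div_div]

theorem integrable_infoDensity {a : Leaf K → ℝ} (hs : ∀ j, 0 < T.testVar a j)
    (S : Finset (Leaf K)) : Integrable (T.infoDensity a S) (T.testLaw a) := by
  rw [infoDensity_eq]
  refine (integrable_finsetSum _ fun i hi => ?_).sub (integrable_finsetSum _ fun k hk =>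
    integrable_finsetSum _ fun i hi => ?_)
  · have hi := Finset.mem_range.mp hi
    exact ((T.memLp_natural hs S le_rfl hi).integrable_mul (T.memLp_source a le_rfl hi)).sub
      ((T.memLp_source a le_rfl hi).integrable_sq.const_mul _)
  · exact (integrable_const _).add ((T.memLp_natural hs S (by simpa [Nat.lt_succ_iff] using hk)
      (Finset.mem_range.mp hi)).integrable_sq.const_mul _)

/-- The quadratic terms at the leaves have expectation ½ ∑ λV. They cancel against the quadratic
terms of all the normalizations by `sum_telescope`, and only the logarithms remain. -/
theorem integral_infoDensity {a : Leaf K → ℝ} (hs : ∀ j, 0 < T.testVar a j)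
    (S : Finset (Leaf K)) : ∫ ω, T.infoDensity a S ω ∂T.testLaw a
      = ∑ k ∈ Finset.range (K + 1), ∑ i ∈ Finset.range (2 ^ k),
        1 / 2 * Real.log (1 + T.noiseVar k i * T.precision (T.obsPrecision a S) k i) := by
  have i1 : ∀ i ∈ Finset.range (2 ^ K), Integrable (fun ω =>
      T.natural (T.obsPrecision a S) (T.obsNatural a S (T.aux a ω)) K i * T.source K i ω.1)
      (T.testLaw a) := fun i hi =>
    (T.memLp_natural hs S le_rfl (Finset.mem_range.mp hi)).integrable_mul
      (T.memLp_source a le_rfl (Finset.mem_range.mp hi))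
  have i2 : ∀ i ∈ Finset.range (2 ^ K), Integrable (fun ω =>
      T.precision (T.obsPrecision a S) K i / 2 * T.source K i ω.1 ^ 2) (T.testLaw a) :=
    fun i hi => (T.memLp_source a le_rfl (Finset.mem_range.mp hi)).integrable_sq.const_mul _
  have i3 : ∀ k ∈ Finset.range (K + 1), ∀ i ∈ Finset.range (2 ^ k), Integrable (fun ω =>
      T.noiseVar k i / (2 * (1 + T.noiseVar k i * T.precision (T.obsPrecision a S) k i))
        * T.natural (T.obsPrecision a S) (T.obsNatural a S (T.aux a ω)) k i ^ 2) (T.testLaw a) :=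
    fun k hk i hi => (T.memLp_natural hs S (by simpa [Nat.lt_succ_iff] using hk)
      (Finset.mem_range.mp hi)).integrable_sq.const_mul _
  have j1 : ∀ i ∈ Finset.range (2 ^ K), Integrable (fun ω =>
      T.natural (T.obsPrecision a S) (T.obsNatural a S (T.aux a ω)) K i * T.source K i ω.1
        - T.precision (T.obsPrecision a S) K i / 2 * T.source K i ω.1 ^ 2) (T.testLaw a) :=
    fun i hi => (i1 i hi).sub (i2 i hi)
  have j3 : ∀ k ∈ Finset.range (K + 1), ∀ i ∈ Finset.range (2 ^ k), Integrable (fun ω =>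
      (-(Real.log (1 + T.noiseVar k i * T.precision (T.obsPrecision a S) k i) / 2)
          + T.noiseVar k i / (2 * (1 + T.noiseVar k i * T.precision (T.obsPrecision a S) k i))
            * T.natural (T.obsPrecision a S) (T.obsNatural a S (T.aux a ω)) k i ^ 2))
      (T.testLaw a) := fun k hk i hi => (integrable_const _).add (i3 k hk i hi)
  rw [infoDensity_eq, integral_sub (integrable_finsetSum _ j1)
    (integrable_finsetSum _ fun k hk => integrable_finsetSum _ (j3 k hk)),
    integral_finsetSum _ j1,
    integral_finsetSum _ fun k hk => integrable_finsetSum _ (j3 k hk)]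
  have e1 : ∑ i ∈ Finset.range (2 ^ K), ∫ ω,
      (T.natural (T.obsPrecision a S) (T.obsNatural a S (T.aux a ω)) K i * T.source K i ω.1
        - T.precision (T.obsPrecision a S) K i / 2 * T.source K i ω.1 ^ 2) ∂T.testLaw a
      = (∑ i ∈ Finset.range (2 ^ K),
        T.precision (T.obsPrecision a S) K i * T.sourceVar K i) / 2 := by
    rw [Finset.sum_div]
    refine Finset.sum_congr rfl fun i hi => ?_
    rw [integral_sub (i1 i hi) (i2 i hi),
      T.integral_natural_mul_source hs S le_rfl (Finset.mem_range.mp hi), integral_const_mul,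
      integral_source_sq]
    ring
  rw [e1, ← T.sum_telescope S K le_rfl, Finset.sum_div, ← Finset.sum_sub_distrib]
  refine Finset.sum_congr rfl fun k hk => ?_
  rw [integral_finsetSum _ (j3 k hk), Finset.sum_div, ← Finset.sum_sub_distrib]
  refine Finset.sum_congr rfl fun i hi => ?_
  rw [integral_add (integrable_const _) (i3 k hk i hi), integral_const, probReal_univ, one_smul,
    integral_const_mul, T.integral_natural_sq hs S (by simpa [Nat.lt_succ_iff] using hk)
    (Finset.mem_range.mp hi)]
  have := T.precision_nonneg (c := T.obsPrecision a S)
    (fun i _ => T.obsPrecision_nonneg a S i) k (by simpa [Nat.lt_succ_iff] using hk) i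
    (Finset.mem_range.mp hi)
  have d : (0 : ℝ) < 1 + T.noiseVar k i
    * T.precision (T.obsPrecision a S) k i := by positivity
  field_simp
  ring

end GaussTree

/-! ### Infinite information of noiseless test channels. -/

/-- If `f X = g Y` almost surely, `f X` has no atoms, and the conditioning variable takes values
in a trivial space, then the mutual information is infinite. -/
theorem condMutualInfo_eq_top {Ω 𝓧 𝓨 𝓩 : Type*} [MeasurableSpace Ω]
    [MeasurableSpace 𝓧] [StandardBorelSpace 𝓧] [Nonempty 𝓧]
    [MeasurableSpace 𝓨] [StandardBorelSpace 𝓨] [Nonempty 𝓨] [MeasurableSpace 𝓩] [Subsingleton 𝓩]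
    {X : Ω → 𝓧} {Y : Ω → 𝓨} {Z : Ω → 𝓩} {P : Measure Ω} [IsProbabilityMeasure P]
    (hX : Measurable X) (hY : Measurable Y) (hZ : Measurable Z) {f : 𝓧 → ℝ} {g : 𝓨 → ℝ}
    (hf : Measurable f) (hg : Measurable g) (h : ∀ᵐ ω ∂P, f (X ω) = g (Y ω))
    (h0 : ∀ t, P {ω | f (X ω) = t} = 0) : condMutualInfo X Y Z P = ∞ := by
  have := Measure.isProbabilityMeasure_map (μ := P) hZ.aemeasurable
  -- Conditioning on a variable with only one possible value gives back the law of X.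
  have hcond : ∀ z, condDistrib X Z P z = P.map X := fun z => by
    refine Measure.ext fun s hs => ?_
    have e : P.map (fun ω => (Z ω, X ω)) (Set.univ ×ˢ s)
        = (P.map Z ⊗ₘ condDistrib X Z P) (Set.univ ×ˢ s) := by
      rw [compProd_map_condDistrib hX.aemeasurable]
    rw [Measure.map_apply (hZ.prodMk hX) (MeasurableSet.univ.prod hs),
      Measure.compProd_apply (MeasurableSet.univ.prod hs)] at e
    have e2 : ∀ z', condDistrib X Z P z' (Prod.mk z' ⁻¹' Set.univ ×ˢ s)
        = condDistrib X Z P z s := fun z' => by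
      rw [Subsingleton.elim z' z]; congr 1; ext; simp
    simp only [e2, lintegral_const, measure_univ, mul_one] at e
    rw [← e, Measure.map_apply hX hs]
    congr 1; ext; simp
  refine klDiv_of_not_ac fun hac => ?_
  let D : Set (𝓩 × 𝓧 × 𝓨) := {p | f p.2.1 = g p.2.2}
  have hD : MeasurableSet D := measurableSet_eq_fun (by fun_prop) (by fun_prop)
  -- The joint law lives on the set where f X = g Y. Under the product law this set is null, since
  -- each of its sections in x is a fibre of f.
  have hν : (P.map Z ⊗ₘ (condDistrib X Z P ×ₖ condDistrib Y Z P)) D = 0 := by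
    rw [Measure.compProd_apply hD]
    refine lintegral_eq_zero_of_ae_eq_zero (Filter.Eventually.of_forall fun z => ?_)
    simp only [Pi.zero_apply]
    rw [Kernel.prod_apply, Measure.prod_apply_symm (hD.preimage measurable_prodMk_left)]
    refine lintegral_eq_zero_of_ae_eq_zero (Filter.Eventually.of_forall fun y => ?_)
    simp only [hcond, Pi.zero_apply]
    rw [Measure.map_apply hX (by
      exact (hD.preimage measurable_prodMk_left).preimage measurable_prodMk_right)]
    exact h0 (g y)
  have hμ := hac hν
  rw [Measure.map_apply (hZ.prodMk (hX.prodMk hY)) hD] at hμ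
  obtain ⟨ω, h1, h2⟩ := (h.and (measure_eq_zero_iff_ae_notMem.mp hμ)).exists
  exact h2 h1

namespace GaussTree

variable {K : ℕ} (T : GaussTree K)

/-! ### The minimum mean-square error -/

/-- The posterior variance of the root. -/
noncomputable def rootVar (a : Leaf K → ℝ) : ℝ≥0 :=
  postVar (T.noiseVar 0 0) (T.precision (T.obsPrecision a Finset.univ) 0 0)

/-- The posterior mean of the root, as a function of the auxiliary variables. -/
noncomputable def rootMean (a : Leaf K → ℝ) (y : Leaf K → ℝ) : ℝ :=
  T.rootVar a * T.natural (T.obsPrecision a Finset.univ) (T.obsNatural a Finset.univ y) 0 0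

@[fun_prop]
theorem measurable_rootMean (a : Leaf K → ℝ) : Measurable (T.rootMean a) := by
  unfold rootMean; fun_prop

@[fun_prop]
theorem measurable_root : Measurable T.root := by
  unfold root; fun_prop

/-- The estimation error of the root. -/
noncomputable def rootError (a : Leaf K → ℝ) (ω : (Node K → ℝ) × (Leaf K → ℝ)) : ℝ :=
  T.root ω - T.rootMean a (T.aux a ω)

@[fun_prop]
theorem measurable_rootError (a : Leaf K → ℝ) : Measurable (T.rootError a) := by
  unfold rootError; fun_prop

/-- The posterior variance does not depend on the observed values, so after subtraction of the
posterior mean the conditional law of the error is the same for all of them. -/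
theorem map_rootError_aux (hT : T.PosNoise) {a : Leaf K → ℝ} (hs : ∀ j, 0 < T.testVar a j) :
    (T.testLaw a).map (fun ω => (T.rootError a ω, T.aux a ω))
      = (gaussianReal 0 (T.rootVar a)).prod ((T.testLaw a).map (T.aux a)) := by
  refine Measure.ext_of_lintegral _ fun F hF => ?_
  rw [lintegral_map hF (by fun_prop), lintegral_prod_symm' _ hF,
    lintegral_map (hF.lintegral_prod_left') (by fun_prop),
    T.lintegral_aux_marginal hT hs hF.lintegral_prod_left']
  refine (T.lintegral_root_aux hT hs (F := fun p => F (p.1 - T.rootMean a p.2, p.2))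
    (by fun_prop)).trans (lintegral_congr fun y => ?_)
  rw [mul_comm]
  congr 1
  have h := gaussianReal_map_sub_const (μ := T.rootMean a y) (v := T.rootVar a) (T.rootMean a y)
  rw [sub_self] at h
  rw [← h, lintegral_map (by fun_prop) (by fun_prop)]
  rfl

theorem map_rootError (hT : T.PosNoise) {a : Leaf K → ℝ} (hs : ∀ j, 0 < T.testVar a j) :
    (T.testLaw a).map (T.rootError a) = gaussianReal 0 (T.rootVar a) := by
  have := Measure.isProbabilityMeasure_map (μ := T.testLaw a) (T.measurable_aux a).aemeasurable
  have h := congrArg (Measure.map Prod.fst) (T.map_rootError_aux hT hs)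
  rw [Measure.map_map measurable_fst (by fun_prop), Measure.map_fst_prod, measure_univ,
    one_smul] at h
  exact h

theorem indepFun_rootError_aux (hT : T.PosNoise) {a : Leaf K → ℝ}
    (hs : ∀ j, 0 < T.testVar a j) : IndepFun (T.rootError a) (T.aux a) (T.testLaw a) := by
  rw [indepFun_iff_map_prod_eq_prod_map_map (by fun_prop) (by fun_prop),
    T.map_rootError_aux hT hs, T.map_rootError hT hs]

/-- The error is centred and independent of the auxiliary variables, so the conditional expectation
is the posterior mean and the error has the posterior variance. -/
theorem mmse_eq (hT : T.PosNoise) {a : Leaf K → ℝ} (hs : ∀ j, 0 < T.testVar a j) :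
    T.mmse a = T.rootVar a := by
  have hm : MeasurableSpace.comap (T.aux a) inferInstance
      ≤ (inferInstance : MeasurableSpace ((Node K → ℝ) × (Leaf K → ℝ))) :=
    (T.measurable_aux a).comap_le
  have hmean : MemLp (fun ω => T.rootMean a (T.aux a ω)) 2 (T.testLaw a) :=
    (T.memLp_natural hs Finset.univ (Nat.zero_le K) (by simp)).const_mul _
  have hroot : MemLp T.root 2 (T.testLaw a) := T.memLp_source a (Nat.zero_le K) (by simp)
  have herr : MemLp (T.rootError a) 2 (T.testLaw a) := hroot.sub hmean
  have hmeas : StronglyMeasurable[MeasurableSpace.comap (T.aux a) inferInstance]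
      (fun ω => T.rootMean a (T.aux a ω)) :=
    ((T.measurable_rootMean a).comp (comap_measurable (T.aux a))).stronglyMeasurable
  have herrm : StronglyMeasurable[MeasurableSpace.comap (T.rootError a) inferInstance]
      (T.rootError a) := (comap_measurable (T.rootError a)).stronglyMeasurable
  have h0 : ∫ ω, T.rootError a ω ∂T.testLaw a = 0 := by
    have := integral_map (μ := T.testLaw a) (T.measurable_rootError a).aemeasurable
      (f := fun x : ℝ => x) aestronglyMeasurable_id
    rw [T.map_rootError hT hs, integral_id_gaussianReal] at this
    exact this.symm
  have hc1 := condExp_indep_eq (μ := T.testLaw a) (T.measurable_rootError a).comap_le hm herrm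
    (T.indepFun_rootError_aux hT hs)
  have hc2 := condExp_of_stronglyMeasurable (μ := T.testLaw a) hm hmeas
    (hmean.integrable (by simp))
  have hadd := condExp_add (herr.integrable (by simp)) (hmean.integrable (by simp))
    (MeasurableSpace.comap (T.aux a) inferInstance)
  have hsum : T.rootError a + (fun ω => T.rootMean a (T.aux a ω)) = T.root := by
    funext ω; simp [rootError]
  rw [hsum] at hadd
  have hint : T.mmse a = ∫ ω, T.rootError a ω ^ 2 ∂T.testLaw a := by
    refine integral_congr_ae ?_
    filter_upwards [hc1, hadd] with ω h1 h2
    rw [h2, Pi.add_apply, h1, hc2, h0, zero_add]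
    rfl
  rw [hint, ← integral_sq_gaussianReal, ← T.map_rootError hT hs,
    integral_map (by fun_prop) (by fun_prop)]

/-! ### The rates of a test channel -/

/-- The rate of the node `(k, i)`, when the likelihoods of the observations have the
precisions `c`. -/
noncomputable def precisionRate (c : ℕ → ℝ) (k i : ℕ) : ℝ :=
  1 / 2 * Real.log (1 + T.noiseVar k i * T.precision c k i)

theorem one_sub_exp_half_log {x : ℝ} (hx : 0 ≤ x) :
    1 - Real.exp (-2 * (1 / 2 * Real.log (1 + x))) = x / (1 + x) := by
  have h : (0 : ℝ) < 1 + x := by positivity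
  rw [show -2 * (1 / 2 * Real.log (1 + x)) = -Real.log (1 + x) by ring, Real.exp_neg,
    Real.exp_log h]
  field_simp
  ring

theorem precisionRate_nonneg {c : ℕ → ℝ} (hc : ∀ i < 2 ^ K, 0 ≤ c i) {k i : ℕ} (hk : k ≤ K)
    (hi : i < 2 ^ k) : 0 ≤ T.precisionRate c k i := by
  have := T.precision_nonneg hc k hk i hi
  have h : (0 : ℝ) ≤ T.noiseVar k i * T.precision c k i := by positivity
  exact mul_nonneg (by norm_num) (Real.log_nonneg (by linarith))

/-- Since 1 - e^{-2r} = νλ/(1 + νλ) for a child's rate r, its coefficient turns this into the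
parent's noise variance times the edge precision. The node function is message passing in terms of
rates. -/
theorem nodeFun_precisionRate (hT : T.PosNoise) {c : ℕ → ℝ} (hc : ∀ i < 2 ^ K, 0 ≤ c i)
    {k i : ℕ} (hk : k < K) (hi : i < 2 ^ k) :
    T.nodeFun k i (T.precisionRate c (k + 1) (2 * i)) (T.precisionRate c (k + 1) (2 * i + 1))
      = T.precisionRate c k i := by
  obtain ⟨hc1, hc2⟩ := child_lt hi
  have p1 := T.precision_nonneg hc (k + 1) hk _ hc1
  have p2 := T.precision_nonneg hc (k + 1) hk _ hc2
  have s1 : (0 : ℝ) < T.noiseVar (k + 1) (2 * i) := by exact_mod_cast hT _ hk _ hc1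
  have s2 : (0 : ℝ) < T.noiseVar (k + 1) (2 * i + 1) := by exact_mod_cast hT _ hk _ hc2
  rw [nodeFun, precisionRate, precisionRate, precisionRate, one_sub_exp_half_log (by positivity),
    one_sub_exp_half_log (by positivity), T.precision_node c hk, edgePrecision, edgePrecision]
  congr 2
  field_simp
  ring

theorem precision_congr {c c' : ℕ → ℝ} : ∀ k ≤ K, ∀ i < 2 ^ k,
    (∀ j ∈ below K k i, c j = c' j) → T.precision c k i = T.precision c' k i := by
  apply node_induction
  · intro i hi h
    rw [precision_leaf, precision_leaf]
    exact h ⟨i, hi⟩ (by rw [below_leaf ⟨i, hi⟩]; simp)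
  · intro k hk i hi h1 h2 h
    rw [below_eq_union hk] at h
    rw [T.precision_node _ hk, T.precision_node _ hk, edgePrecision, edgePrecision, edgePrecision,
      edgePrecision, h1 fun j hj => h j (Finset.mem_union_left _ hj),
      h2 fun j hj => h j (Finset.mem_union_right _ hj)]

/-- Replacing rates by zero outside S amounts to discarding the observations outside S. At a node
inside S the discarded ones play no role; elsewhere both sides obey the node recursion. -/
theorem restrictedFun_eq_precisionRate (hT : T.PosNoise) (a : Leaf K → ℝ) {r : ℕ → ℕ → ℝ}
    (hr : ∀ k ≤ K, ∀ i < 2 ^ k, r k i = T.precisionRate (T.obsPrecision a Finset.univ) k i)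
    (S : Finset (Leaf K)) : ∀ k ≤ K, ∀ i < 2 ^ k,
      T.restrictedFun S r k i = T.precisionRate (T.obsPrecision a S) k i := by
  have full : ∀ k ≤ K, ∀ i < 2 ^ k, below K k i ⊆ S →
      T.restrictedFun S r k i = T.precisionRate (T.obsPrecision a S) k i := by
    intro k hk i hi hS
    rw [T.restrictedFun_of_subset r hk hS, hr k hk i hi, precisionRate, precisionRate,
      T.precision_congr k hk i hi fun j hj => ?_]
    rw [obsPrecision_coe, obsPrecision_coe, if_pos (Finset.mem_univ _), if_pos (hS hj)]
  apply node_induction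
  · intro i hi
    by_cases hS : below K K i ⊆ S
    · exact full K le_rfl i hi hS
    · rw [T.restrictedFun_leaf_of_notMem r hS, precisionRate, precision_leaf]
      have h := T.obsPrecision_coe a S ⟨i, hi⟩
      rw [below_leaf ⟨i, hi⟩, Finset.singleton_subset_iff] at hS
      rw [if_neg hS] at h
      simp only at h
      rw [h]
      simp
  · intro k hk i hi h1 h2
    by_cases hS : below K k i ⊆ S
    · exact full k hk.le i hi hS
    · rw [T.restrictedFun_of_not_subset r hk hi hS, h1, h2,
        T.nodeFun_precisionRate hT (fun i _ => T.obsPrecision_nonneg a S i) hk hi]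

theorem condMutualInfo_eq_totalRate (hT : T.PosNoise) {a : Leaf K → ℝ}
    (hs : ∀ j, 0 < T.testVar a j) {r : ℕ → ℕ → ℝ}
    (hr : ∀ k ≤ K, ∀ i < 2 ^ k, r k i = T.precisionRate (T.obsPrecision a Finset.univ) k i)
    (A : Finset (Leaf K)) :
    condMutualInfo (T.obs A) (T.auxOn a A) (T.auxOn a Aᶜ) (T.testLaw a)
      = ENNReal.ofReal (T.totalRate Finset.univ r - T.totalRate Aᶜ r) := by
  have h : ∀ S, ∫ ω, T.infoDensity a S ω ∂T.testLaw a = T.totalRate S r := fun S => by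
    rw [T.integral_infoDensity hs S]
    exact Finset.sum_congr rfl fun k hk => Finset.sum_congr rfl fun i hi =>
      (T.restrictedFun_eq_precisionRate hT a hr S k (by simpa [Nat.lt_succ_iff] using hk) i
        (Finset.mem_range.mp hi)).symm
  rw [T.condMutualInfo_eq_infoDensity hT hs A fun S => T.integrable_infoDensity hs S, h, h]

theorem rootVar_le_iff (hT : T.PosNoise) (a : Leaf K → ℝ) {d : ℝ} (hd : 0 < d) :
    (T.rootVar a : ℝ) ≤ d ↔ 1 / 2 * Real.log (T.noiseVar 0 0 / d)
      ≤ T.precisionRate (T.obsPrecision a Finset.univ) 0 0 := by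
  have hp := T.precision_nonneg (c := T.obsPrecision a Finset.univ)
    (fun i _ => T.obsPrecision_nonneg a _ i) 0 (Nat.zero_le K) 0 (by simp)
  have h0 : (0 : ℝ) < T.noiseVar 0 0 := by exact_mod_cast hT 0 (Nat.zero_le K) 0 (by simp)
  have h1 : (0 : ℝ) < 1 + T.noiseVar 0 0 * T.precision (T.obsPrecision a Finset.univ) 0 0 := by
    positivity
  rw [rootVar, coe_postVar _ hp, precisionRate, mul_le_mul_iff_right₀ (by norm_num),
    Real.log_le_log_iff (by positivity) h1, div_le_iff₀ h1, div_le_iff₀ hd, mul_comm d]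

/-! ### The two regions agree -/

/-- With all other noises fixed, the observation is a constant plus its own noise, which has a
nondegenerate Gaussian law. -/
theorem noiseLaw_source_eq (hT : T.PosNoise) (j : Leaf K) (t : ℝ) :
    T.noiseLaw {ω | T.source K j ω = t} = 0 := by
  let v : Node K := ⟨⟨K, Nat.lt_succ_self K⟩, j⟩
  have hv : T.noiseVar K j ≠ 0 := (hT K le_rfl j j.2).ne'
  have := nullSingletonClass_gaussianReal (μ := 0) hv
  have hmeas : MeasurableSet {ω | T.source K j ω = t} :=
    measurableSet_eq_fun (T.measurable_source K j) measurable_const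
  obtain ⟨p, hp⟩ : ∃ p : (Node K → ℝ) → ℝ, ∀ ω x, T.source K j (Function.update ω v x)
      = p ω + x := by
    have hn : ∀ ω x, noise K j (Function.update ω v x) = x := fun ω x =>
      noise_update_self ω v x
    have hlt : ∀ ω x k i, k < K → T.source k i (Function.update ω v x) = T.source k i ω :=
      fun ω x k i h => T.source_update_of_lt ω v x h
    clear_value v
    revert j
    rcases K with _ | k
    · intro j _ _ _ hn
      exact ⟨fun _ => 0, fun ω x => by rw [source, hn, zero_add]⟩
    · intro j _ _ _ hn
      exact ⟨fun ω => T.gain (k + 1) j * T.source k (j / 2) ω, fun ω x => by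
        rw [source, hn, hlt _ _ _ _ (Nat.lt_succ_self k)]⟩
  rw [← lintegral_indicator_one hmeas, noiseLaw, ← lintegral_zero]
  refine lintegral_eq_of_lmarginal_eq {v} (measurable_one.indicator hmeas) measurable_const
    (funext fun ω => ?_)
  rw [lmarginal_singleton, lmarginal_singleton, lintegral_zero]
  refine lintegral_eq_zero_of_ae_eq_zero ?_
  have h : ∀ᵐ x ∂gaussianReal 0 (T.noiseVar K j), x ≠ t - p ω :=
    compl_mem_ae_iff.mpr (measure_singleton _)
  filter_upwards [h] with x hx
  refine Set.indicator_of_notMem (fun hmem => hx ?_) _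
  have : T.source K j (Function.update ω v x) = t := hmem
  rw [hp] at this
  linarith

theorem condMutualInfo_eq_top_of_eq_one (hT : T.PosNoise) {a : Leaf K → ℝ} {j : Leaf K}
    (hj : a j = 1) : condMutualInfo (T.obs Finset.univ) (T.auxOn a Finset.univ)
      (T.auxOn a Finset.univᶜ) (T.testLaw a) = ∞ := by
  have : IsEmpty ((Finset.univ : Finset (Leaf K))ᶜ : Finset (Leaf K)) := by
    rw [Finset.compl_univ]; infer_instance
  have hsub : Subsingleton (((Finset.univ : Finset (Leaf K))ᶜ : Finset (Leaf K)) → ℝ) :=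
    inferInstance
  have h0 : T.testVar a j = 0 := by rw [testVar, hj]; simp
  refine condMutualInfo_eq_top (T.measurable_obs _) (T.measurable_auxOn a _)
    (T.measurable_auxOn a _) (f := fun x => x ⟨j, Finset.mem_univ j⟩)
    (g := fun y => y ⟨j, Finset.mem_univ j⟩) (measurable_pi_apply _) (measurable_pi_apply _) ?_ ?_
  · have h1 : ∀ᵐ y ∂T.testNoise a, y j = 0 := by
      have hmp := measurePreserving_eval (fun i => gaussianReal 0 (T.testVar a i)) j
      refine hmp.quasiMeasurePreserving.ae (p := fun y : ℝ => y = 0) ?_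
      rw [h0, gaussianReal_zero_var]
      rw [ae_dirac_eq]
      rfl
    have h2 : ∀ᵐ ω ∂T.testLaw a, ω.2 j = 0 := by
      rw [testLaw_eq]
      exact Measure.quasiMeasurePreserving_snd.ae h1
    filter_upwards [h2] with ω hω
    simp [obs, auxOn, aux, hj, hω]
  · intro t
    have : {ω | T.obs Finset.univ ω ⟨j, Finset.mem_univ j⟩ = t}
        = {n | T.source K j n = t} ×ˢ (Set.univ : Set (Leaf K → ℝ)) := by
      ext ω; simp [obs]
    rw [this, testLaw_eq, Measure.prod_prod, T.noiseLaw_source_eq hT, zero_mul]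

/-- Finite information forces a_j < 1 for all j, so every channel has positive noise variance; the
rates ½ log(1 + σ²λ) of the channel are then a witness for the outer region. -/
theorem rdIn_subset_rdOut (hT : T.PosNoise) : T.rdIn ⊆ T.rdOut := by
  rintro ⟨R, d⟩ ⟨a, ⟨ha, hd⟩, hR⟩
  simp only at hd hR
  have hs : ∀ j, 0 < T.testVar a j := fun j => by
    have hne : a j ≠ 1 := fun h => by
      have := hR Finset.univ
      rw [T.condMutualInfo_eq_top_of_eq_one hT h] at this
      simp at this
    have hlt : a j < 1 := lt_of_le_of_ne (ha j).2 hne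
    have h1 : 0 < 1 - a j ^ 2 := by nlinarith [(ha j).1]
    have h2 : 0 < T.obsVar j := by rw [obsVar_eq]; exact T.sourceVar_pos hT K le_rfl j j.2
    exact Real.toNNReal_pos.mpr (mul_pos h1 h2)
  let r := T.precisionRate (T.obsPrecision a Finset.univ)
  have hc := fun i (_ : i < 2 ^ K) => T.obsPrecision_nonneg a Finset.univ i
  have h0 : 0 < T.noiseVar 0 0 := hT 0 (Nat.zero_le K) 0 (by simp)
  rw [T.mmse_eq hT hs] at hd
  have hd0 : 0 < d := lt_of_lt_of_le
    (NNReal.coe_pos.mpr (postVar_pos h0 (T.precision_nonneg hc 0 (Nat.zero_le K) 0 (by simp)))) hd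
  -- Mutual information takes nonnegative values, hence the truncation at 0. For singletons it
  -- yields R_j ≥ 0.
  have hR' : ∀ A : Finset (Leaf K), max (T.totalRate Finset.univ r - T.totalRate Aᶜ r) 0
      ≤ ∑ j ∈ A, R j := fun A => by
    have := hR A
    rw [T.condMutualInfo_eq_totalRate hT hs (r := r) (fun _ _ _ _ => rfl),
      EReal.coe_ennreal_ofReal] at this
    exact_mod_cast this
  refine T.mem_rdOut_iff.mpr ⟨fun j => ?_, hd0, r, ⟨fun k hk i hi =>
    T.precisionRate_nonneg hc hk hi, (T.rootVar_le_iff hT a hd0).mp hd, fun k hk i hi =>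
    (T.nodeFun_precisionRate hT hc hk hi).ge⟩, fun S => ?_⟩
  · simpa using (le_max_right _ _).trans (hR' {j})
  · simpa using (le_max_left _ _).trans (hR' Sᶜ)

/-- Every nonnegative family of rates of the observations is attained by a test channel. -/
theorem exists_testChannel (hT : T.PosNoise) {r : ℕ → ℕ → ℝ}
    (hr : ∀ i < 2 ^ K, 0 ≤ r K i) : ∃ a : Leaf K → ℝ, (∀ j, a j ∈ Set.Icc (0 : ℝ) 1)
      ∧ (∀ j, 0 < T.testVar a j)
      ∧ ∀ i < 2 ^ K, r K i = T.precisionRate (T.obsPrecision a Finset.univ) K i := by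
  have hV : ∀ j, 0 < T.obsVar j := fun j => by
    rw [obsVar_eq]; exact T.sourceVar_pos hT K le_rfl j j.2
  have hσ : ∀ j : Leaf K, (0 : ℝ) < T.noiseVar K j := fun j => by
    exact_mod_cast hT K le_rfl j j.2
  -- The required precision c solves ½ log(1 + σ²c) = r at the leaf. Solving a²/((1 - a²)V) = c,
  -- with V the variance of the observation, then gives a² = cV/(1 + cV), the value q below.
  let c : Leaf K → ℝ := fun j => (Real.exp (2 * r K j) - 1) / T.noiseVar K j
  have hc : ∀ j, 0 ≤ c j := fun j => div_nonneg
    (sub_nonneg.mpr (Real.one_le_exp (by have := hr j j.2; linarith))) (hσ j).le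
  let q : Leaf K → ℝ := fun j => c j * T.obsVar j / (1 + c j * T.obsVar j)
  have hq0 : ∀ j, 0 ≤ q j := fun j => by have := hc j; have := hV j; positivity
  have hq1 : ∀ j, 1 - q j = 1 / (1 + c j * T.obsVar j) := fun j => by
    have := hc j; have := hV j
    simp only [q]
    field_simp
    ring
  have hqpos : ∀ j, 0 < 1 - q j := fun j => by
    have := hc j; have := hV j; rw [hq1]; positivity
  have hsq : ∀ j, √(q j) ^ 2 = q j := fun j => Real.sq_sqrt (hq0 j)
  have htv : ∀ j, (T.testVar (fun j => √(q j)) j : ℝ) = (1 - q j) * T.obsVar j := fun j => by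
    rw [testVar, hsq, Real.coe_toNNReal _ (mul_pos (hqpos j) (hV j)).le]
  refine ⟨fun j => √(q j), fun j => ⟨Real.sqrt_nonneg _, Real.sqrt_le_one.mpr
    (by linarith [hqpos j])⟩, fun j => ?_, fun i hi => ?_⟩
  · rw [← NNReal.coe_pos, htv]; exact mul_pos (hqpos j) (hV j)
  · have h := T.obsPrecision_coe (fun j => √(q j)) Finset.univ ⟨i, hi⟩
    rw [if_pos (Finset.mem_univ _), htv, hsq, hq1] at h
    have hcv : q ⟨i, hi⟩ / (1 / (1 + c ⟨i, hi⟩ * T.obsVar ⟨i, hi⟩) * T.obsVar ⟨i, hi⟩)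
        = c ⟨i, hi⟩ := by
      have := hc ⟨i, hi⟩; have := hV ⟨i, hi⟩
      simp only [q]
      field_simp
    rw [hcv] at h
    simp only at h
    have hσi := hσ ⟨i, hi⟩
    simp only at hσi
    rw [precisionRate, precision_leaf, h]
    simp only [c]
    rw [mul_div_cancel₀ _ hσi.ne', add_sub_cancel, Real.log_exp]
    ring

/-- For the given R and d, a minimal feasible family is determined by its leaf rates through the
node equalities. The test channel with these leaf rates therefore has the same rates at all nodes,
and its inner constraints are the feasibility of the family. -/
theorem rdOut_subset_rdIn (hT : T.PosNoise) : T.rdOut ⊆ T.rdIn := by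
  rintro ⟨R, d⟩ hp
  obtain ⟨hR, hd, hne⟩ := T.mem_rdOut_iff.mp hp
  simp only at hR hd hne
  obtain ⟨r, hr⟩ := T.exists_isMinimalRates hd (hT 0 (Nat.zero_le K) 0 (by simp)) hne
  have heq := hr.isEqualityNode T hR
  obtain ⟨hr0, hroot, -⟩ := hr.1.1
  obtain ⟨a, ha, hs, hleaf⟩ := T.exists_testChannel hT (hr0 K le_rfl)
  have hc := fun i (_ : i < 2 ^ K) => T.obsPrecision_nonneg a Finset.univ i
  have hall : ∀ k ≤ K, ∀ i < 2 ^ k,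
      r k i = T.precisionRate (T.obsPrecision a Finset.univ) k i := by
    apply node_induction
    · exact hleaf
    · intro k hk i hi h1 h2
      have h := heq k hk i hi
      rw [IsEqualityNode, h1, h2, T.nodeFun_precisionRate hT hc hk hi] at h
      exact h
  refine ⟨a, ⟨ha, ?_⟩, fun A => ?_⟩
  · rw [T.mmse_eq hT hs, T.rootVar_le_iff hT a hd, ← hall 0 (Nat.zero_le K) 0 (by simp)]
    exact hroot
  · rw [T.condMutualInfo_eq_totalRate hT hs hall, EReal.coe_ennreal_ofReal]
    have h1 := hr.1.2 Aᶜ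
    rw [compl_compl] at h1
    exact_mod_cast max_le h1 (Finset.sum_nonneg fun j _ => hR j)

end GaussTree

theorem mainTheorem6 (K : ℕ) (T : GaussTree K) (hT : T.PosNoise) :
    T.rdOut = closure (convexHull ℝ T.rdIn) := by
  have h0 : 0 < T.noiseVar 0 0 := hT 0 (Nat.zero_le K) 0 (by simp)
  rw [(T.rdIn_subset_rdOut hT).antisymm (T.rdOut_subset_rdIn hT),
    (T.convex_rdOut h0).convexHull_eq, (T.isClosed_rdOut h0).closure_eq]
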